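/- **Setting.** Fix a horizon $\kappa$, a finite set $\Omega$ of attacker types and $\Omega^o=\Omega\cup\{\omega_o\}$, where $\omega_o$ is the controller of the system. For $k=1,\dots,\kappa$ let $$x_{k+1}=Ax_k+Bu_k+w_k,\qquad y_k=Cx_k+v_k,$$ with $x_k\in\mathbb R^m$, $u_k\in\mathbb R^r$, $y_k\in\mathbb R^n$ and independent $x_1\sim\mathcal N(0,\Sigma_1)$, $w_k\sim\mathcal N(0,\Sigma_w)$, $v_k\sim\mathcal N(0,\Sigma_v)$. Write $y_{1:k}$ for the augmented vector $(y_k',\dots,y_1')'\in\mathbb R^{nk}$. A linear-plus-noise signaling rule $\eta$ sends $s_k=L_k'y_{1:k}+\vartheta_k\in\mathbb R^m$, where $(\vartheta_k)_k$ is a centred Gaussian vector independent of $x_1,w,v$. Let $\Upsilon$ be the set of the rules whose noises $\vartheta_1,\dots,\vartheta_\kappa$ are mutually independent, and $\overline\Upsilon\supseteq\Upsilon$ the set of all of them (noise possibly correlated over time). A policy $\gamma$ consists of Borel maps with $u_k=\gamma_k(s_{1:k})$. For $Q^\omega\succeq O$, $R^\omega\succ O$, type $\omega\in\Omega^o$ minimizes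 $\sum_k E\|x_{k+1}\|^2_{Q^\omega}+E\|u_k\|^2_{R^\omega}$ over all policies, knowing $\eta$; if type $\omega$ uses $\gamma^\omega$ and $x^\omega,u^\omega$ are the resulting states and inputs, the sensor pays $$U_S(\eta,\{\gamma^\omega\})=\max_{p\in\Delta(\Omega^o)}\Big\{\sum_{\omega\in\Omega}p_\omega\sum_kE\|x^\omega_{k+1}\|^2_{Q^{\omega_o}}+p_{\omega_o}\sum_k\big(E\|x^{\omega_o}_{k+1}\|^2_{Q^{\omega_o}}+E\|u^{\omega_o}_k\|^2_{R^{\omega_o}}\big)\Big\}.$$ The sensor's problem is to minimize $U_S(\eta,\{\gamma^\omega(\eta)\})$ over $\eta\in\Upsilon$, where $\gamma^\omega(\eta)$ are best responses. **Parameters.** Let $x_k^o,y_k^o$ be the states and measurements for $u=0$, $\Sigma_k^o=E\{x_k^o(x_k^o)'\}$, $\Sigma_k^y=E\{y_{1:k}^o(y_{1:k}^o)'\}$, $D_k=E\{x_k^o(y_{1:k}^o)'\}(\Sigma_k^y)^\dagger$, and for $k>1$ $$A_k=\begin{bmatrix}E\{y_k^o(y_{1:k-1}^o)'\}(\Sigma_{k-1}^y)^\dagger\\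 I\end{bmatrix}.$$ Let $\tilde Q_{\kappa+1}^\omega=Q^\omega$, $\Delta_k^\omega=B'\tilde Q_{k+1}^\omega B+R^\omega$, $K_k^\omega=(\Delta_k^\omega)^{-1}B'\tilde Q_{k+1}^\omega A$ and $\tilde Q_k^\omega=Q^\omega+A'(\tilde Q_{k+1}^\omega-\tilde Q_{k+1}^\omega B(\Delta_k^\omega)^{-1}B'\tilde Q_{k+1}^\omega)A$. With blocks indexed by $k,l\in\{1,\dots,\kappa\}$ let $K^\omega=\mathrm{diag}(K_k^\omega)$, $\Delta^\omega=\mathrm{diag}(\Delta^\omega_k)$, $\bar A=\mathrm{diag}(A)$, $\bar Q=\mathrm{diag}(Q^{\omega_o})$; $\Phi^\omega_{k,k}=I$, $\Phi^\omega_{k,l}=K_k^\omega A^{k-l-1}B$ for $l<k$; $Z_{k,l}=A^{k-l}B$ for $l\le k$; other blocks $O$; $T^\omega=Z(\Phi^\omega)^{-1}K^\omega$; $\Sigma^o$ with blocks $E\{x_k^o(x_l^o)'\}$. Put $V^{\omega_o}=-(K^{\omega_o})'\Delta^{\omega_o}K^{\omega_o}$, $V^\omega=(T^\omega)'\bar QT^\omega-(T^\omega)'\bar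 Q\bar A-\bar A'\bar QT^\omega$ for $\omega\in\Omega$, $$\Xi_k^\omega=V_{k,k}^\omega+\sum_{l>k}\big(V_{k,l}^\omega A^{l-k}+(A^{l-k})'V^\omega_{l,k}\big),\qquad W_k^\omega=D_k'\,\Xi_k^\omega D_k,$$ $\xi^{\omega_o}=\mathrm{Tr}\{(\tilde Q_1^{\omega_o}-Q^{\omega_o})\Sigma_1\}+\sum_k\mathrm{Tr}\{\tilde Q^{\omega_o}_{k+1}\Sigma_w\}-\sum_k\mathrm{Tr}\{\Sigma^o_k\Xi_k^{\omega_o}\}$, and $\xi^\omega=\mathrm{Tr}\{\Sigma^o\bar A'\bar Q\bar A\}+\kappa\,\mathrm{Tr}\{\Sigma_wQ^{\omega_o}\}$ for $\omega\in\Omega$. For symmetric $S=(S_1,\dots,S_\kappa)$, $S_k\in\mathbb R^{nk\times nk}$, put $$f(S)=\max_{p\in\Delta(\Omega^o)}\sum_{\omega\in\Omega^o}p_\omega\Big(\xi^\omega+\sum_{k=1}^\kappa\mathrm{Tr}\{S_kW_k^\omega\}\Big),$$ and let $\bar\Psi$ be the set of the $S$ with all $S_k\succeq O$, $\Sigma_1^y\succeq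 S_1$ and $\Sigma_k^y\succeq S_k\succeq A_kS_{k-1}A_k'$ for $k>1$. For a rule $\eta$ put $Y_k(\eta)=\mathrm{cov}\{E\{y^o_{1:k}\mid s_{1:k}\}\}$. **Statement.** 1. For every $\eta\in\overline\Upsilon$: $Y(\eta)$ does not depend on the policy that generates $u$; every type has a best response; and for all choices of best responses $U_S(\eta,\{\gamma^\omega(\eta)\})=f(Y(\eta))<\infty$. 2. The sensor's problem $\min_{\eta\in\Upsilon}f(Y(\eta))$ is equivalent to the semidefinite program $\min_{S\in\bar\Psi}f(S)$: $Y(\eta)\in\bar\Psi$ for every $\eta\in\overline\Upsilon$; for every $S\in\bar\Psi$ there is $\eta\in\Upsilon$ with $f(Y(\eta))=f(S)$; both minima, and the minimum over $\overline\Upsilon$, are attained, and they are equal to each other and to the minimal value of $U_S(\eta,\{\gamma^\omega(\eta)\})$ over $\eta\in\Upsilon$. 3. Let $S\in\bar\Psi$ be a solution of the semidefinite program; read $A_1S_0A_1'$ as $O$. For each $k$ take eigendecompositions $\Sigma_k^y-A_kS_{k-1}A_k'=\bar U_k\begin{bmatrix}\bar\Lambda_k&O\\O&O\end{bmatrix}\bar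 U_k'$ with $\bar\Lambda_k\succ O$ diagonal, and $\begin{bmatrix}\bar\Lambda_k^{-1/2}&O\end{bmatrix}\bar U_k'(S_k-A_kS_{k-1}A_k')\bar U_k\begin{bmatrix}\bar\Lambda_k^{-1/2}\\O\end{bmatrix}=U_k\Lambda_kU_k'$ with $\Lambda_k=\mathrm{diag}(\lambda_{k,i})$, and reals with $(\lambda^o_{k,i})^2/((\lambda^o_{k,i})^2+\theta_{k,i}^2)=\lambda_{k,i}$. Let $\tilde\eta$ send the $nk$-dimensional signals $\tilde s_k=\tilde L_k'y_{1:k}+\tilde\vartheta_k$ with $\tilde L_k=\bar U_k\begin{bmatrix}\bar\Lambda_k^{-1/2}U_k\,\mathrm{diag}(\lambda^o_{k,i})&O\\O&O\end{bmatrix}$ and independent $\tilde\vartheta_k\sim\mathcal N(0,\mathrm{diag}(\theta_{k,1}^2,\theta_{k,2}^2,\dots,0,\dots,0))$. Such $\tilde\eta$ exist. For each of them there are matrices $G_{k,j}$ such that, without control, $E\{x_k^o\mid\tilde s_1,\dots,\tilde s_k\}=\sum_{j\le k}G_{k,j}\tilde s_j$ almost surely for all $k$; and for all such matrices the rule $\eta\in\overline\Upsilon$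 which sends $s_k=\sum_{j\le k}G_{k,j}\tilde s_j\in\mathbb R^m$ has $f(Y(\eta))=f(S)$ and is optimal: $f(Y(\eta))\le f(Y(\eta'))$ for all $\eta'\in\overline\Upsilon$, in particular for all $\eta'\in\Upsilon$. -/

import Mathlib

open MeasureTheory ProbabilityTheory Matrix
open scoped ENNReal

noncomputable section

namespace SensorDesign

/-! ### Linear algebra -/

/-- Euclidean vectors with `d` coordinates. -/
abbrev Vec (d : ℕ) := EuclideanSpace ℝ (Fin d)

/-- The vector `M x`. -/
def act {α β : Type*} [Fintype β] (M : Matrix α β ℝ) (x : EuclideanSpace ℝ β) :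
    EuclideanSpace ℝ α :=
  WithLp.toLp 2 (M *ᵥ x.ofLp)

/-- The weighted square `x' M x`. -/
def wsq {α : Type*} [Fintype α] (M : Matrix α α ℝ) (x : EuclideanSpace ℝ α) : ℝ :=
  x.ofLp ⬝ᵥ (M *ᵥ x.ofLp)

/-- The block matrix over the horizon with blocks `f k l`. -/
def blk {κ a b : ℕ} (f : Fin κ → Fin κ → Matrix (Fin a) (Fin b) ℝ) :
    Matrix (Fin κ × Fin a) (Fin κ × Fin b) ℝ :=
  Matrix.of fun p q => f p.1 q.1 p.2 q.2

/-- The four Penrose equations: `X` is the Moore-Penrose inverse of `M`. -/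
structure IsMoorePenrose {α β : Type*} [Fintype α] [Fintype β]
    (M : Matrix α β ℝ) (X : Matrix β α ℝ) : Prop where
  mul_inv_mul : M * X * M = M
  inv_mul_inv : X * M * X = X
  symm_left : (M * X)ᵀ = M * X
  symm_right : (X * M)ᵀ = X * M

open Classical in
/-- The Moore-Penrose inverse. -/
def pinv {α β : Type*} [Fintype α] [Fintype β] (M : Matrix α β ℝ) : Matrix β α ℝ :=
  if h : ∃ X, IsMoorePenrose M X then h.choose else 0

theorem isMoorePenrose_unique {α β : Type*} [Fintype α] [Fintype β]
    {M : Matrix α β ℝ} {X Y : Matrix β α ℝ} (hX : IsMoorePenrose M X)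
    (hY : IsMoorePenrose M Y) : X = Y := by
  have h1 : M * X = M * Y := by
    calc M * X = (M * X)ᵀ := hX.symm_left.symm
      _ = ((M * Y) * (M * X))ᵀ := by rw [← Matrix.mul_assoc, hY.mul_inv_mul]
      _ = (M * X)ᵀ * (M * Y)ᵀ := Matrix.transpose_mul _ _
      _ = M * X * (M * Y) := by rw [hX.symm_left, hY.symm_left]
      _ = M * Y := by rw [← Matrix.mul_assoc, hX.mul_inv_mul]
  have h2 : X * M = Y * M := by
    calc X * M = (X * M)ᵀ := hX.symm_right.symm
      _ = ((X * M) * (Y * M))ᵀ := by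
          rw [Matrix.mul_assoc, ← Matrix.mul_assoc M, hY.mul_inv_mul]
      _ = (Y * M)ᵀ * (X * M)ᵀ := Matrix.transpose_mul _ _
      _ = Y * M * (X * M) := by rw [hX.symm_right, hY.symm_right]
      _ = Y * M := by rw [Matrix.mul_assoc, ← Matrix.mul_assoc M, hX.mul_inv_mul]
  calc X = X * M * X := hX.inv_mul_inv.symm
    _ = Y * M * Y := by rw [Matrix.mul_assoc, h1, ← Matrix.mul_assoc, h2]
    _ = Y := hY.inv_mul_inv

theorem isMoorePenrose_pinv {α : Type*} [Fintype α] {M : Matrix α α ℝ}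
    (hM : M.IsHermitian) : IsMoorePenrose M (pinv M) := by
  classical
  have hex : ∃ X, IsMoorePenrose M X := by
    let V : Matrix α α ℝ := hM.eigenvectorUnitary
    let d : α → ℝ := hM.eigenvalues
    have hV : star V * V = 1 := Unitary.coe_star_mul_self _
    have hMV : M = V * diagonal d * star V := by
      have h := hM.spectral_theorem
      rw [Unitary.conjStarAlgAut_apply] at h
      simpa [V, d, Function.comp_def] using h
    have key : ∀ e f : α → ℝ, (V * diagonal e * star V) * (V * diagonal f * star V)
        = V * diagonal (fun i => e i * f i) * star V := by
      intro e f
      calc (V * diagonal e * star V) * (V * diagonal f * star V)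
          = V * diagonal e * (star V * V) * diagonal f * star V := by
            simp only [Matrix.mul_assoc]
        _ = _ := by rw [hV, Matrix.mul_one, Matrix.mul_assoc V, diagonal_mul_diagonal]
    have tr : ∀ e : α → ℝ, (V * diagonal e * star V)ᵀ = V * diagonal e * star V := by
      intro e
      simp [Matrix.star_eq_conjTranspose, Matrix.mul_assoc,
        Matrix.conjTranspose_eq_transpose_of_trivial]
    refine ⟨V * diagonal (fun i => (d i)⁻¹) * star V, ?_, ?_, ?_, ?_⟩
    · conv_lhs => rw [hMV]
      conv_rhs => rw [hMV]
      rw [key, key]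
      congr 3
      funext i
      exact mul_inv_mul_cancel (d i)
    · rw [hMV, key, key]
      congr 3
      funext i
      simpa using mul_inv_mul_cancel (d i)⁻¹
    · rw [hMV, key, tr]
    · rw [hMV, key, tr]
  rw [pinv, dif_pos hex]
  exact hex.choose_spec

/-! ### The control system

Times are indexed from `0`: stage `k : Fin κ` here is stage `k + 1` in the usual numbering
`1, …, κ`. -/

/-- The data of the control system and of the objectives of the types `Option Ω`; `none` is the
controller of the system and `some ω` is an attacker of type `ω`. -/
structure Model (m r n κ : ℕ) (Ω : Type*) where
  A : Matrix (Fin m) (Fin m) ℝ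
  B : Matrix (Fin m) (Fin r) ℝ
  C : Matrix (Fin n) (Fin m) ℝ
  /-- covariance of the initial state -/
  cov₁ : Matrix (Fin m) (Fin m) ℝ
  /-- covariance of the state noise -/
  covw : Matrix (Fin m) (Fin m) ℝ
  /-- covariance of the measurement noise -/
  covv : Matrix (Fin n) (Fin n) ℝ
  Q : Option Ω → Matrix (Fin m) (Fin m) ℝ
  R : Option Ω → Matrix (Fin r) (Fin r) ℝ
  cov₁_psd : cov₁.PosSemidef
  covw_psd : covw.PosSemidef
  covv_psd : covv.PosSemidef
  Q_psd : ∀ ω, (Q ω).PosSemidef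
  R_pd : ∀ ω, (R ω).PosDef

/-- Coordinates of the augmented vector of the measurements up to stage `k`. -/
abbrev Hist (n : ℕ) {κ : ℕ} (k : Fin κ) : Type := {j : Fin κ // j ≤ k} × Fin n

/-- Values of the initial state, the state noises and the measurement noises. -/
abbrev Prim (m n κ : ℕ) : Type := Vec m × (Fin κ → Vec m) × (Fin κ → Vec n)

/-- A linear-plus-noise signaling rule with signal coordinates `ι k` at stage `k`: gain matrices
`L k`, and the covariance matrix `T` of the whole Gaussian noise vector over the horizon. -/
structure Rule (n : ℕ) {κ : ℕ} (ι : Fin κ → Type) [∀ k, Fintype (ι k)] where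
  L : ∀ k, Matrix (Hist n k) (ι k) ℝ
  T : Matrix (Σ k, ι k) (Σ k, ι k) ℝ
  T_psd : T.PosSemidef

/-- The noises of different stages are independent (uncorrelated and jointly Gaussian). -/
def Rule.IndepNoise {n κ : ℕ} {ι : Fin κ → Type} [∀ k, Fintype (ι k)] (η : Rule n ι) : Prop :=
  ∀ (k l : Fin κ) (a : ι k) (b : ι l), k ≠ l → η.T ⟨k, a⟩ ⟨l, b⟩ = 0

/-- Rules with signals in `ℝᵐ`. -/
abbrev StateRule (m n κ : ℕ) := Rule n (fun _ : Fin κ => Fin m)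

/-- Rules whose signal at a stage has the dimension of the measurements made so far. -/
abbrev HistRule (n κ : ℕ) := Rule n (fun k : Fin κ => Hist n k)

/-- Signals up to stage `k`. -/
abbrev SigHist {κ : ℕ} (ι : Fin κ → Type) (k : Fin κ) : Type :=
  ∀ j : {j : Fin κ // j ≤ k}, EuclideanSpace ℝ (ι j)

/-- A control policy: at each stage a Borel function of the signals received so far. -/
structure Policy (r : ℕ) {κ : ℕ} (ι : Fin κ → Type) [∀ k, Fintype (ι k)] where
  act : ∀ k, SigHist ι k → Vec r
  meas : ∀ k, Measurable (act k)

/-- The policy without any control. -/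
def Policy.zero (r : ℕ) {κ : ℕ} (ι : Fin κ → Type) [∀ k, Fintype (ι k)] : Policy r ι where
  act := fun _ _ => 0
  meas := fun _ => measurable_const

section Dynamics

variable {m r n κ : ℕ} {Ω : Type*} (M : Model m r n κ Ω)

/-- Joint law of the independent Gaussian initial state and noises of the system. -/
def Model.primLaw : Measure (Prim m n κ) :=
  (multivariateGaussian 0 M.cov₁).prod
    ((Measure.pi fun _ : Fin κ => multivariateGaussian 0 M.covw).prod
      (Measure.pi fun _ : Fin κ => multivariateGaussian 0 M.covv))

/-- The states `x₀, …, x_κ` driven by the control inputs `u`. -/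
def Model.state (z : Prim m n κ) (u : Fin κ → Vec r) (k : Fin (κ + 1)) : Vec m :=
  Fin.induction (motive := fun _ => Vec m) z.1
    (fun k x => SensorDesign.act M.A x + SensorDesign.act M.B (u k) + z.2.1 k) k

/-- The measurement at stage `k`. -/
def Model.meas (z : Prim m n κ) (u : Fin κ → Vec r) (k : Fin κ) : Vec n :=
  SensorDesign.act M.C (M.state z u k.castSucc) + z.2.2 k

/-- The augmented vector of measurements up to stage `k`. -/
def Model.measHist (z : Prim m n κ) (u : Fin κ → Vec r) (k : Fin κ) :
    EuclideanSpace ℝ (Hist n k) :=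
  WithLp.toLp 2 fun p => M.meas z u p.1.1 p.2

/-- Control-free states. -/
def Model.freeState (z : Prim m n κ) (k : Fin κ) : Vec m := M.state z 0 k.castSucc

/-- Control-free augmented measurements. -/
def Model.freeHist (z : Prim m n κ) (k : Fin κ) : EuclideanSpace ℝ (Hist n k) :=
  M.measHist z 0 k

section Signals

variable {ι : Fin κ → Type} [∀ k, Fintype (ι k)]

/-- Values of all primitive random variables including the signaling noise. -/
abbrev World (m n : ℕ) {κ : ℕ} (ι : Fin κ → Type) : Type :=
  Prim m n κ × EuclideanSpace ℝ (Σ k, ι k)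

open Classical in
/-- The joint law: the signaling noise is independent of the system. -/
def Model.law (η : Rule n ι) : Measure (World m n ι) :=
  M.primLaw.prod (multivariateGaussian 0 η.T)

/-- The signal `s_k = L_k' y_{≤ k} + ϑ_k` under the control inputs `u`. -/
def Model.signal (η : Rule n ι) (z : World m n ι) (u : Fin κ → Vec r) (k : Fin κ) :
    EuclideanSpace ℝ (ι k) :=
  SensorDesign.act (η.L k)ᵀ (M.measHist z.1 u k) + WithLp.toLp 2 fun a => z.2 ⟨k, a⟩

/-- The control inputs of the first `t` stages generated by a policy (zero from stage `t` on). -/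
def Model.inputs (η : Rule n ι) (γ : Policy r ι) (z : World m n ι) : ℕ → Fin κ → Vec r
  | 0 => 0
  | t + 1 => fun k =>
      if k.val = t then γ.act k fun j => M.signal η z (Model.inputs η γ z t) j
      else Model.inputs η γ z t k

/-- The closed-loop control inputs. -/
def Model.control (η : Rule n ι) (γ : Policy r ι) (z : World m n ι) : Fin κ → Vec r :=
  M.inputs η γ z κ

theorem Model.state_congr (z : Prim m n κ) {u u' : Fin κ → Vec r} (k : Fin (κ + 1))
    (h : ∀ j : Fin κ, j.val < k.val → u j = u' j) : M.state z u k = M.state z u' k := by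
  induction k using Fin.induction with
  | zero => rfl
  | succ k ih =>
    have h1 := ih fun j hj => h j (by simp at hj ⊢; omega)
    have h2 : u k = u' k := h k (by simp)
    simp only [Model.state, Fin.induction_succ] at h1 ⊢
    rw [h1, h2]

theorem Model.signal_congr (η : Rule n ι) (z : World m n ι) {u u' : Fin κ → Vec r} (k : Fin κ)
    (h : ∀ j : Fin κ, j < k → u j = u' j) : M.signal η z u k = M.signal η z u' k := by
  have h1 : M.measHist z.1 u k = M.measHist z.1 u' k := by
    unfold Model.measHist
    congr 1
    funext p
    unfold Model.meas
    rw [M.state_congr z.1 (u' := u') p.1.1.castSucc]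
    intro j hj
    exact h j (lt_of_lt_of_le (Fin.lt_def.2 (by simpa using hj)) p.1.2)
  unfold Model.signal
  rw [h1]

theorem Model.inputs_stable (η : Rule n ι) (γ : Policy r ι) (z : World m n ι) (k : Fin κ)
    (t : ℕ) (ht : k.val < t) : M.inputs η γ z t k = M.inputs η γ z (k.val + 1) k := by
  induction t with
  | zero => omega
  | succ t ih =>
    rcases Nat.lt_succ_iff_lt_or_eq.1 ht with h | h
    · rw [← ih h]
      simp [Model.inputs, h.ne]
    · rw [h]

/-- The closed loop: the control input at each stage is the policy applied to the signals which
these very control inputs generate. -/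
theorem Model.control_eq (η : Rule n ι) (γ : Policy r ι) (z : World m n ι) (k : Fin κ) :
    M.control η γ z k = γ.act k fun j => M.signal η z (M.control η γ z) j := by
  have h1 : M.control η γ z k = γ.act k fun j => M.signal η z (M.inputs η γ z k.val) j := by
    rw [Model.control, M.inputs_stable η γ z k κ k.2]
    simp [Model.inputs]
  rw [h1]
  congr 1
  funext j
  refine M.signal_congr η z j.1 fun i hi => ?_
  have hik : i.val < k.val := lt_of_lt_of_le (Fin.lt_def.1 hi) (Fin.le_def.1 j.2)
  rw [Model.control, M.inputs_stable η γ z i κ i.2, M.inputs_stable η γ z i k.val hik]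

/-- The information `σ(s_{≤ k})` carried by the closed-loop signals up to stage `k`. -/
@[reducible]
def Model.info (η : Rule n ι) (γ : Policy r ι) (k : Fin κ) : MeasurableSpace (World m n ι) :=
  MeasurableSpace.comap
    (fun z => fun j : {j : Fin κ // j ≤ k} => M.signal η z (M.control η γ z) j) inferInstance

/-- `cov{E{y_{≤ k}ᵒ | s_{≤ k}}}`: covariance of the posterior of the control-free
measurements. -/
def Model.posteriorCov (η : Rule n ι) (γ : Policy r ι) (k : Fin κ) :
    Matrix (Hist n k) (Hist n k) ℝ :=
  Matrix.of fun p q =>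
    cov[fun z => ((M.law η)[fun z => M.freeHist z.1 k | M.info η γ k]) z p,
      fun z => ((M.law η)[fun z => M.freeHist z.1 k | M.info η γ k]) z q; M.law η]

/-! ### The game -/

/-- `∑ₖ E‖x_{k+1}‖²_W` in closed loop. -/
def Model.stateCost (η : Rule n ι) (γ : Policy r ι) (W : Matrix (Fin m) (Fin m) ℝ) : ℝ≥0∞ :=
  ∑ k : Fin κ, ∫⁻ z, ENNReal.ofReal (wsq W (M.state z.1 (M.control η γ z) k.succ)) ∂(M.law η)

/-- `∑ₖ E‖u_k‖²_W` in closed loop. -/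
def Model.inputCost (η : Rule n ι) (γ : Policy r ι) (W : Matrix (Fin r) (Fin r) ℝ) : ℝ≥0∞ :=
  ∑ k : Fin κ, ∫⁻ z, ENNReal.ofReal (wsq W (M.control η γ z k)) ∂(M.law η)

/-- The objective of the type-`ω` follower. -/
def Model.followerCost (η : Rule n ι) (ω : Option Ω) (γ : Policy r ι) : ℝ≥0∞ :=
  M.stateCost η γ (M.Q ω) + M.inputCost η γ (M.R ω)

/-- `γ` is a best response of the type-`ω` follower to `η`. -/
def Model.IsBestResponse (η : Rule n ι) (ω : Option Ω) (γ : Policy r ι) : Prop :=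
  ∀ γ' : Policy r ι, M.followerCost η ω γ ≤ M.followerCost η ω γ'

/-- What the sensor pays if the type-`ω` follower uses `γ`. -/
def Model.leaderTypeCost (η : Rule n ι) (ω : Option Ω) (γ : Policy r ι) : ℝ≥0∞ :=
  match ω with
  | none => M.stateCost η γ (M.Q none) + M.inputCost η γ (M.R none)
  | some _ => M.stateCost η γ (M.Q none)

/-- The objective of the sensor: the worst case over the distributions of the type. -/
def Model.leaderCost [Fintype Ω] (η : Rule n ι) (γ : Option Ω → Policy r ι) : ℝ≥0∞ :=
  ⨆ p : stdSimplex ℝ (Option Ω),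
    ∑ ω, ENNReal.ofReal (p.1 ω) * M.leaderTypeCost η ω (γ ω)

end Signals

/-! ### The parameters of the semidefinite program -/

/-- Riccati recursion with `i` steps to go. -/
def Model.riccati (ω : Option Ω) : ℕ → Matrix (Fin m) (Fin m) ℝ
  | 0 => M.Q ω
  | i + 1 => M.Q ω + M.Aᵀ * (Model.riccati ω i - Model.riccati ω i * M.B *
      (M.Bᵀ * Model.riccati ω i * M.B + M.R ω)⁻¹ * M.Bᵀ * Model.riccati ω i) * M.A

/-- Riccati matrix of the state with index `k = 0, …, κ`. -/
def Model.Qt (ω : Option Ω) (k : ℕ) : Matrix (Fin m) (Fin m) ℝ := M.riccati ω (κ - k)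

def Model.Del (ω : Option Ω) (k : Fin κ) : Matrix (Fin r) (Fin r) ℝ :=
  M.Bᵀ * M.Qt ω (k.val + 1) * M.B + M.R ω

def Model.K (ω : Option Ω) (k : Fin κ) : Matrix (Fin r) (Fin m) ℝ :=
  (M.Del ω k)⁻¹ * M.Bᵀ * M.Qt ω (k.val + 1) * M.A

def Model.delta₀ (ω : Option Ω) : ℝ :=
  ((M.Qt ω 0 - M.Q ω) * M.cov₁).trace + ∑ k : Fin κ, (M.Qt ω (k.val + 1) * M.covw).trace

def Model.Phi (ω : Option Ω) : Matrix (Fin κ × Fin r) (Fin κ × Fin r) ℝ :=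
  blk fun k l =>
    if l = k then 1 else if l < k then M.K ω k * M.A ^ (k.val - l.val - 1) * M.B else 0

def Model.KK (ω : Option Ω) : Matrix (Fin κ × Fin r) (Fin κ × Fin m) ℝ :=
  blk fun k l => if l = k then M.K ω k else 0

def Model.DD (ω : Option Ω) : Matrix (Fin κ × Fin r) (Fin κ × Fin r) ℝ :=
  blk fun k l => if l = k then M.Del ω k else 0

def Model.Z : Matrix (Fin κ × Fin m) (Fin κ × Fin r) ℝ :=
  blk fun k l => if l ≤ k then M.A ^ (k.val - l.val) * M.B else 0

def Model.TT (ω : Option Ω) : Matrix (Fin κ × Fin m) (Fin κ × Fin m) ℝ :=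
  M.Z * (M.Phi ω)⁻¹ * M.KK ω

def Model.Abar : Matrix (Fin κ × Fin m) (Fin κ × Fin m) ℝ :=
  blk fun k l => if l = k then M.A else 0

def Model.Qbar : Matrix (Fin κ × Fin m) (Fin κ × Fin m) ℝ :=
  blk fun k l => if l = k then M.Q none else 0

def Model.V (ω : Option Ω) : Matrix (Fin κ × Fin m) (Fin κ × Fin m) ℝ :=
  match ω with
  | none => -((M.KK none)ᵀ * M.DD none * M.KK none)
  | some ω => (M.TT (some ω))ᵀ * M.Qbar * M.TT (some ω) - (M.TT (some ω))ᵀ * M.Qbar * M.Abar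
      - (M.Abar)ᵀ * M.Qbar * M.TT (some ω)

/-- The block of `V` at the stages `k` and `l`. -/
def Model.Vblock (ω : Option Ω) (k l : Fin κ) : Matrix (Fin m) (Fin m) ℝ :=
  Matrix.of fun a b => M.V ω (k, a) (l, b)

def Model.Xi (ω : Option Ω) (k : Fin κ) : Matrix (Fin m) (Fin m) ℝ :=
  M.Vblock ω k k + ∑ l ∈ Finset.Ioi k,
    (M.Vblock ω k l * M.A ^ (l.val - k.val) + (M.A ^ (l.val - k.val))ᵀ * M.Vblock ω l k)

/-- Second moments of the control-free states of the stages `0, …, κ - 1`. -/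
def Model.stateMoment (k l : Fin κ) : Matrix (Fin m) (Fin m) ℝ :=
  Matrix.of fun a b => ∫ z, M.freeState z k a * M.freeState z l b ∂M.primLaw

def Model.xi (ω : Option Ω) : ℝ :=
  match ω with
  | none => M.delta₀ none - ∑ k : Fin κ, (M.stateMoment k k * M.Xi none k).trace
  | some _ => (blk M.stateMoment * (M.Abar)ᵀ * M.Qbar * M.Abar).trace
      + κ * (M.covw * M.Q none).trace

/-- Covariance of the control-free augmented measurements up to stage `k`. -/
def Model.measMoment (k : Fin κ) : Matrix (Hist n k) (Hist n k) ℝ :=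
  Matrix.of fun p q => ∫ z, M.freeHist z k p * M.freeHist z k q ∂M.primLaw

/-- `D_k = E{x_kᵒ (y_{≤ k}ᵒ)'} E{y_{≤ k}ᵒ (y_{≤ k}ᵒ)'}†`. -/
def Model.D (k : Fin κ) : Matrix (Fin m) (Hist n k) ℝ :=
  (Matrix.of fun a q => ∫ z, M.freeState z k a * M.freeHist z k q ∂M.primLaw)
    * pinv (M.measMoment k)

/-- `W_k = D_k' Ξ_k D_k`. -/
def Model.W (ω : Option Ω) (k : Fin κ) : Matrix (Hist n k) (Hist n k) ℝ :=
  (M.D k)ᵀ * M.Xi ω k * M.D k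

/-- For consecutive stages `j`, `k`, the matrix that predicts `y_{≤ k}ᵒ` from `y_{≤ j}ᵒ`: the
block row `E{y_kᵒ (y_{≤ j}ᵒ)'} E{y_{≤ j}ᵒ (y_{≤ j}ᵒ)'}†` for the new measurement on top of the
identity for the old ones. -/
def Model.trans (j k : Fin κ) : Matrix (Hist n k) (Hist n j) ℝ :=
  Matrix.of fun p q =>
    if p.1.1 ≤ j then (if p.1.1 = q.1.1 ∧ p.2 = q.2 then 1 else 0)
    else ((Matrix.of fun (c : Fin n) q => ∫ z, M.meas z 0 k c * M.freeHist z j q ∂M.primLaw)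
      * pinv (M.measMoment j)) p.2 q

/-- The stage before `k` (only used for `k.val ≠ 0`). -/
def prevStage {κ : ℕ} (k : Fin κ) : Fin κ := ⟨k.val - 1, lt_of_le_of_lt (Nat.sub_le _ _) k.2⟩

/-- `A_k S_{k-1} A_k'`, and `0` at the first stage. -/
def Model.prior (S : ∀ k : Fin κ, Matrix (Hist n k) (Hist n k) ℝ) (k : Fin κ) :
    Matrix (Hist n k) (Hist n k) ℝ :=
  if k.val = 0 then 0 else
    M.trans (prevStage k) k * S (prevStage k) * (M.trans (prevStage k) k)ᵀ

/-- The constraint set: positive semidefinite `S` with `Σ_kʸ ⪰ S_k ⪰ A_k S_{k-1} A_k'`. -/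
def Model.feasible : Set (∀ k : Fin κ, Matrix (Hist n k) (Hist n k) ℝ) :=
  {S | ∀ k, (S k).PosSemidef ∧ (M.measMoment k - S k).PosSemidef ∧
    (S k - M.prior S k).PosSemidef}

/-- The objective `max_p ∑_ω p_ω (ξ^ω + ∑ₖ Tr{S_k W_k^ω})` of the semidefinite program. -/
def Model.sdpObjective [Fintype Ω] (S : ∀ k : Fin κ, Matrix (Hist n k) (Hist n k) ℝ) : ℝ :=
  ⨆ p : stdSimplex ℝ (Option Ω),
    ∑ ω, p.1 ω * (M.xi ω + ∑ k, (S k * M.W ω k).trace)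

/-- The objective `max_p ∑_ω p_ω (ξ^ω + ∑ₖ Tr{Y_k W_k^ω})` of the sensor as a function of the
signaling rule; `Y_k` is computed from the signals without control. -/
def Model.sensorObjective [Fintype Ω] (η : StateRule m n κ) : ℝ :=
  M.sdpObjective (M.posteriorCov η (Policy.zero r _))

/-! ### The construction of optimal rules -/

/-- `η` is a rule with `nk`-dimensional signals constructed from `S`: with the
eigendecompositions `Σ_kʸ - A_k S_{k-1} A_k' = U₀ diag(d, 0) U₀'`, `d > 0`, and
`diag(d)^{-1/2} (U₀' (S_k - A_k S_{k-1} A_k') U₀)₁₁ diag(d)^{-1/2} = U diag(e) U'`, its gain is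
`L_k = U₀ diag(diag(d)^{-1/2} U diag(f), 0)` and its noise has covariance
`diag(θ², 0)`, where `f² / (f² + θ²) = e`; noises of different stages are independent.
The matrices are partitioned along `Fin t ⊕ Fin q`. -/
def Model.IsConstructed (S : ∀ k : Fin κ, Matrix (Hist n k) (Hist n k) ℝ)
    (η : HistRule n κ) : Prop :=
  η.IndepNoise ∧
  ∀ k : Fin κ, ∃ (t q : ℕ) (part : Fin t ⊕ Fin q ≃ Hist n k)
    (U₀ : Matrix (Hist n k) (Hist n k) ℝ) (d : Fin t → ℝ)
    (U : Matrix (Fin t) (Fin t) ℝ) (e f θ : Fin t → ℝ),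
    U₀ ∈ Matrix.orthogonalGroup (Hist n k) ℝ ∧ (∀ i, 0 < d i) ∧
    M.measMoment k - M.prior S k =
      U₀ * Matrix.reindex part part (Matrix.fromBlocks (Matrix.diagonal d) 0 0 0) * U₀ᵀ ∧
    U ∈ Matrix.orthogonalGroup (Fin t) ℝ ∧
    Matrix.diagonal (fun i => (√(d i))⁻¹) *
      (U₀ᵀ * (S k - M.prior S k) * U₀).submatrix (part ∘ Sum.inl) (part ∘ Sum.inl) *
      Matrix.diagonal (fun i => (√(d i))⁻¹) = U * Matrix.diagonal e * Uᵀ ∧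
    (∀ i, 0 < f i ^ 2 + θ i ^ 2 ∧ f i ^ 2 / (f i ^ 2 + θ i ^ 2) = e i) ∧
    η.L k = U₀ * Matrix.reindex part part (Matrix.fromBlocks
      (Matrix.diagonal (fun i => (√(d i))⁻¹) * U * Matrix.diagonal f) 0 0 0) ∧
    (Matrix.of fun a b => η.T ⟨k, a⟩ ⟨k, b⟩) =
      Matrix.reindex part part (Matrix.fromBlocks (Matrix.diagonal fun i => θ i ^ 2) 0 0 0)

section Compression

variable {ι : Fin κ → Type} [∀ k, Fintype (ι k)]

/-- `G` is the posterior map of the rule `η`: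
`E{x_kᵒ | s_{≤ k}} = ∑_{j ≤ k} G_{k,j} s_j` almost surely, for the control-free signals. -/
def Model.IsPosteriorMap (η : Rule n ι)
    (G : ∀ k : Fin κ, ∀ j : {j : Fin κ // j ≤ k}, Matrix (Fin m) (ι j) ℝ) : Prop :=
  ∀ k : Fin κ, (M.law η)[fun z => M.freeState z.1 k | M.info η (Policy.zero r ι) k]
    =ᵐ[M.law η] fun z => ∑ j : {j : Fin κ // j ≤ k}, act (G k j) (M.signal η z 0 j)

end Compression

end Dynamics

section Compress

variable {m n κ : ℕ} {ι : Fin κ → Type} [∀ k, Fintype (ι k)]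

/-- The family `G` as one block lower triangular matrix. -/
def bigG (G : ∀ k : Fin κ, ∀ j : {j : Fin κ // j ≤ k}, Matrix (Fin m) (ι j) ℝ) :
    Matrix (Σ _ : Fin κ, Fin m) (Σ k, ι k) ℝ :=
  Matrix.of fun p q => if h : q.1 ≤ p.1 then G p.1 ⟨q.1, h⟩ p.2 q.2 else 0

/-- The rule that sends `s_k = ∑_{j ≤ k} G_{k,j} s̃_j`, where `s̃_j = L_j' y_{≤ j} + ϑ_j` are the
signals of `η`, written as a linear-plus-noise rule: its gain satisfies
`L_k' y_{≤ k} = ∑_{j ≤ k} G_{k,j} L_j' y_{≤ j}`, and its noise is `∑_{j ≤ k} G_{k,j} ϑ_j`. -/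
def Rule.compress (η : Rule n ι)
    (G : ∀ k : Fin κ, ∀ j : {j : Fin κ // j ≤ k}, Matrix (Fin m) (ι j) ℝ) :
    StateRule m n κ where
  L := fun k => Matrix.of fun p a => ∑ j : {j : Fin κ // j ≤ k}, ∑ b : ι j,
    G k j a b * (if h : p.1.1 ≤ j.1 then η.L j.1 (⟨p.1.1, h⟩, p.2) b else 0)
  T := bigG G * η.T * (bigG G)ᵀ
  T_psd := by
    have h := η.T_psd.mul_mul_conjTranspose_same (bigG G)
    rwa [Matrix.conjTranspose_eq_transpose_of_trivial] at h

end Compress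

end SensorDesign

end

/-! Without control, every state, measurement and signal is a linear functional of one centred
Gaussian vector, the point of `World`. Second moments form a positive semidefinite bilinear form on
the dual space (`moment`), and conditioning a functional on signals is orthogonal projection to
their span (`condExp_dual`). The form may be degenerate, so projections are unique only up to null
vectors, and Moore-Penrose inverses solve the normal equations (`cross_mul_pinv_mul`).

Control shifts each signal by a function of earlier signals. Hence closed-loop and control-free
signals carry the same information (`Model.info_eq_comap_free`), and the posterior covariances do
not depend on the policy. Completing squares along the Riccati recursion writes the cost of a
follower as a constant plus the sum of `E‖u_k + K_k x̂_k‖²` weighted by `Δ_k`, with `x̂_k` the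
posterior of the closed-loop state (`Model.sum_integral_cost`, `Model.followerCost_eq`). So
certainty equivalence is a best response, and every best response agrees with it almost surely.

Inserting these inputs into the cost of the sensor gives a quadratic form in the posteriors of the
control-free states. The covariance of two such posteriors at stages `k ≤ l` is `A^(l-k)` times the
earlier posterior covariance (`Model.cross_compF`), which collapses the cross terms into `Ξ_k`. The
posterior of the state is `D_k` times that of the measurements, so the cost is affine in the
posterior covariances `Y_k`; maximizing over the simplex gives the objective of the program
(`Model.leaderCost_eq`).

The constraints are necessary because the three matrices required to be semidefinite are Gram
matrices (`Model.posteriorCov_mem_feasible`). Conversely, the objective depends on `S_k` only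
through `D_k S_k D_k'`. The filtered states `D_k y_{≤k}` obey a recursion with transition `A`, and a
Kalman filter steers their posterior covariances to these targets (`exists_isProj_cross_eq`): if the
error covariance is `E` and the wanted increment `D` satisfies `0 ⪯ D ⪯ E`, whitening `E` and
diagonalizing `D` gives scalar channels whose signal-to-noise ratios can be chosen freely
(`exists_isDesign`, `IsDesign.exists_gain`). This gives signals in `ℝᵐ` with independent noises
(`Model.exists_stateRule`).

The same filter on the full measurements gives the explicit construction. Sending only the resulting
posteriors of the state loses nothing relevant: the new signals lie in the old span and already
contain the projection of the state (`Model.D_mul_posteriorCov_of_comp`). Minima exist since the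
feasible set is compact and the objective continuous. -/

noncomputable section

namespace SensorDesign

/-! ### Projections for a positive semidefinite bilinear form. -/

section Moments

variable {V : Type*} [AddCommGroup V] [Module ℝ V] (b : LinearMap.BilinForm ℝ V)
variable {α β γ δ : Type*}

/-- The matrix of the values of a bilinear form on two families of vectors. -/
def cross (X : α → V) (Y : β → V) : Matrix α β ℝ := Matrix.of fun i j => b (X i) (Y j)

/-- The image of a family of vectors under a matrix. -/
def lin [Fintype β] (M : Matrix α β ℝ) (X : β → V) : α → V := fun i => ∑ j, M i j • X j

@[simp] theorem cross_apply (X : α → V) (Y : β → V) (i : α) (j : β) :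
    cross b X Y i j = b (X i) (Y j) := rfl

theorem cross_lin_left [Fintype β] (M : Matrix α β ℝ) (X : β → V) (Y : γ → V) :
    cross b (lin M X) Y = M * cross b X Y := by
  ext i j
  simp [lin, Matrix.mul_apply]

theorem cross_lin_right [Fintype β] (M : Matrix α β ℝ) (X : β → V) (Y : γ → V) :
    cross b Y (lin M X) = cross b Y X * Mᵀ := by
  ext i j
  simp [lin, Matrix.mul_apply, mul_comm]

theorem cross_add_left (X Y : α → V) (Z : β → V) :
    cross b (X + Y) Z = cross b X Z + cross b Y Z := by
  ext; simp

theorem cross_add_right (X Y : α → V) (Z : β → V) :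
    cross b Z (X + Y) = cross b Z X + cross b Z Y := by
  ext; simp

theorem cross_sub_left (X Y : α → V) (Z : β → V) :
    cross b (X - Y) Z = cross b X Z - cross b Y Z := by
  ext; simp

theorem cross_sub_right (X Y : α → V) (Z : β → V) :
    cross b Z (X - Y) = cross b Z X - cross b Z Y := by
  ext; simp

theorem cross_transpose (hb : b.IsPosSemidef) (X : α → V) (Y : β → V) :
    (cross b X Y)ᵀ = cross b Y X := by
  ext i j
  exact hb.eq _ _

theorem cross_eq_zero_comm (hb : b.IsPosSemidef) {X : α → V} {Y : β → V}
    (h : cross b X Y = 0) : cross b Y X = 0 := by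
  rw [← cross_transpose b hb, h, Matrix.transpose_zero]

theorem lin_mul [Fintype β] [Fintype γ] (M : Matrix α β ℝ) (N : Matrix β γ ℝ) (X : γ → V) :
    lin (M * N) X = lin M (lin N X) := by
  ext i
  simp only [lin, Matrix.mul_apply, Finset.sum_smul, Finset.smul_sum, smul_smul]
  exact Finset.sum_comm

theorem lin_one [Fintype α] [DecidableEq α] (X : α → V) : lin (1 : Matrix α α ℝ) X = X := by
  ext i
  simp [lin, Matrix.one_apply, ite_smul]

theorem lin_sub_right [Fintype β] (M : Matrix α β ℝ) (X Y : β → V) :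
    lin M (X - Y) = lin M X - lin M Y := by
  ext i
  simp [lin, smul_sub, Finset.sum_sub_distrib]

theorem lin_mem [Fintype β] (U : Submodule ℝ V) (M : Matrix α β ℝ) {X : β → V}
    (h : ∀ j, X j ∈ U) (i : α) : lin M X i ∈ U :=
  U.sum_mem fun j _ => U.smul_mem _ (h j)

theorem cross_posSemidef [Finite α] (hb : b.IsPosSemidef) (X : α → V) :
    (cross b X X).PosSemidef := by
  have := Fintype.ofFinite α
  refine Matrix.PosSemidef.of_dotProduct_mulVec_nonneg ?_ fun v => ?_
  · rw [Matrix.IsHermitian, Matrix.conjTranspose_eq_transpose_of_trivial, cross_transpose b hb]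
  · have h : star v ⬝ᵥ (cross b X X *ᵥ v) = b (∑ i, v i • X i) (∑ i, v i • X i) := by
      simp only [dotProduct, Matrix.mulVec, Finset.mul_sum, map_sum, map_smul, LinearMap.sum_apply,
        LinearMap.smul_apply, smul_eq_mul, cross_apply, star_trivial]
      exact Finset.sum_congr rfl fun _ _ => Finset.sum_congr rfl fun _ _ => by
        rw [hb.eq]; ring
    rw [h]
    exact hb.nonneg _

/-- Cauchy-Schwarz: null vectors are orthogonal to everything. This takes the place of nondegeneracy
throughout. -/
theorem form_eq_zero_of_self {b : LinearMap.BilinForm ℝ V} (hb : b.IsPosSemidef) {v : V}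
    (h : b v v = 0) (w : V) : b w v = 0 := by
  have := b.apply_sq_le_of_symm hb.nonneg ⟨hb.eq⟩ w v
  rw [h, mul_zero] at this
  exact pow_eq_zero_iff two_ne_zero |>.1 (le_antisymm this (sq_nonneg _))

/-- The normal equations are solved by the Moore-Penrose inverse of the Gram matrix. -/
theorem cross_mul_pinv_mul [Fintype β] (hb : b.IsPosSemidef) (X : α → V) (Y : β → V) :
    cross b X Y * pinv (cross b Y Y) * cross b Y Y = cross b X Y := by
  classical
  set G := cross b Y Y with hG
  have hP := isMoorePenrose_pinv (cross_posSemidef b hb Y).1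
  rw [← hG] at hP
  have h0 : G * (1 - pinv G * G) = 0 := by
    rw [Matrix.mul_sub, Matrix.mul_one, ← Matrix.mul_assoc, hP.mul_inv_mul, sub_self]
  -- The combinations of `Y` with coefficients from the kernel of the Gram matrix are null vectors,
  -- so `X` is orthogonal to them.
  have h1 : cross b (lin (1 - pinv G * G)ᵀ Y) (lin (1 - pinv G * G)ᵀ Y) = 0 := by
    rw [cross_lin_left, cross_lin_right, Matrix.transpose_transpose, ← hG, h0, Matrix.mul_zero]
  have h2 : cross b X (lin (1 - pinv G * G)ᵀ Y) = 0 := by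
    ext i j
    exact form_eq_zero_of_self hb (congrFun (congrFun h1 j) j) _
  rw [cross_lin_right, Matrix.transpose_transpose, Matrix.mul_sub, Matrix.mul_one, sub_eq_zero]
    at h2
  rw [Matrix.mul_assoc]
  exact h2.symm

/-- Orthogonality of a family to a subspace. -/
def Perp (X : α → V) (U : Submodule ℝ V) : Prop := ∀ i, ∀ u ∈ U, b (X i) u = 0

/-- `Xh` is the projection of the family `X` to the subspace `U`. -/
structure IsProj (U : Submodule ℝ V) (X Xh : α → V) : Prop where
  mem : ∀ i, Xh i ∈ U
  perp : Perp b (X - Xh) U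

variable {b}

theorem perp_span {X : α → V} {Y : β → V} (h : cross b X Y = 0) :
    Perp b X (Submodule.span ℝ (Set.range Y)) := by
  intro i u hu
  induction hu using Submodule.span_induction with
  | mem x hx =>
    obtain ⟨j, rfl⟩ := hx
    exact congrFun (congrFun h i) j
  | zero => simp
  | add x y _ _ hx hy => simp [hx, hy]
  | smul c x _ hx => simp [hx]

theorem Perp.cross_eq_zero {X : α → V} {U : Submodule ℝ V} (h : Perp b X U) {Y : β → V}
    (hY : ∀ j, Y j ∈ U) : cross b X Y = 0 := by
  ext i j
  exact h i _ (hY j)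

theorem Perp.lin [Fintype β] {X : β → V} {U : Submodule ℝ V} (h : Perp b X U)
    (M : Matrix α β ℝ) : Perp b (lin M X) U := by
  intro i u hu
  simp [SensorDesign.lin, h _ u hu]

theorem Perp.add {X Y : α → V} {U : Submodule ℝ V} (hX : Perp b X U) (hY : Perp b Y U) :
    Perp b (X + Y) U := by
  intro i u hu
  simp [hX i u hu, hY i u hu]

theorem Perp.sub {X Y : α → V} {U : Submodule ℝ V} (hX : Perp b X U) (hY : Perp b Y U) :
    Perp b (X - Y) U := by
  intro i u hu
  simp [hX i u hu, hY i u hu]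

theorem Perp.mono {X : α → V} {U U' : Submodule ℝ V} (h : Perp b X U) (hU : U' ≤ U) :
    Perp b X U' := fun i u hu => h i u (hU hu)

/-- The coefficients solve the normal equations even if the Gram matrix is singular. -/
theorem exists_isProj [Fintype β] (hb : b.IsPosSemidef) (X : α → V) (Y : β → V) :
    ∃ Xh, IsProj b (Submodule.span ℝ (Set.range Y)) X Xh := by
  refine ⟨lin (cross b X Y * pinv (cross b Y Y)) Y, IsProj.mk (fun i => ?_) (perp_span ?_)⟩
  · exact lin_mem _ _ (fun j => Submodule.subset_span (Set.mem_range_self j)) i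
  · rw [cross_sub_left, cross_lin_left, cross_mul_pinv_mul b hb, sub_self]

theorem IsProj.lin [Fintype β] {U : Submodule ℝ V} {X Xh : β → V} (h : IsProj b U X Xh)
    (M : Matrix α β ℝ) : IsProj b U (SensorDesign.lin M X) (SensorDesign.lin M Xh) where
  mem := lin_mem U M h.mem
  perp := by
    rw [← lin_sub_right]
    exact h.perp.lin M

/-- The projection of a vector is the projection of any vector that differs by something
orthogonal. -/
theorem IsProj.of_perp {U : Submodule ℝ V} {X X' Xh : α → V} (h : IsProj b U X Xh)
    (hp : Perp b (X' - X) U) : IsProj b U X' Xh where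
  mem := h.mem
  perp := by
    have := hp.add h.perp
    rwa [sub_add_sub_cancel] at this

theorem IsProj.sub_self_eq_zero {U : Submodule ℝ V} {X Xh Xh' : α → V}
    (h : IsProj b U X Xh) (h' : IsProj b U X Xh') (i : α) :
    b ((Xh - Xh') i) ((Xh - Xh') i) = 0 := by
  have h1 : Perp b (Xh - Xh') U := by
    have := h'.perp.sub h.perp
    rwa [sub_sub_sub_cancel_left] at this
  exact h1 i _ (U.sub_mem (h.mem i) (h'.mem i))

/-- Two projections differ by null vectors, which do not affect second moments. -/
theorem IsProj.cross_eq (hb : b.IsPosSemidef) {U : Submodule ℝ V} {X Xh Xh' : α → V}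
    (h : IsProj b U X Xh) (h' : IsProj b U X Xh') : cross b Xh Xh = cross b Xh' Xh' := by
  ext i j
  have h1 := form_eq_zero_of_self hb (h.sub_self_eq_zero h' j) (Xh i)
  have h2 := form_eq_zero_of_self hb (h.sub_self_eq_zero h' i) (Xh' j)
  rw [hb.eq] at h2
  simp only [Pi.sub_apply, map_sub, LinearMap.sub_apply] at h1 h2
  simp only [cross_apply]
  linarith

theorem IsProj.cross_left {U : Submodule ℝ V} {X Xh : α → V} (h : IsProj b U X Xh)
    {Y : β → V} (hY : ∀ j, Y j ∈ U) : cross b X Y = cross b Xh Y := by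
  rw [← sub_eq_zero, ← cross_sub_left]
  exact h.perp.cross_eq_zero hY

/-- Pythagoras: the Gram matrix of the residual. -/
theorem IsProj.cross_residual (hb : b.IsPosSemidef) {U : Submodule ℝ V} {X Xh : α → V}
    (h : IsProj b U X Xh) : cross b (X - Xh) (X - Xh) = cross b X X - cross b Xh Xh := by
  have h1 := h.perp.cross_eq_zero h.mem
  have h2 := cross_eq_zero_comm b hb h1
  rw [cross_sub_right, h1, sub_zero, cross_sub_left]
  rw [cross_sub_right, sub_eq_zero] at h2
  rw [h2]

/-- Updating a projection by the innovation of a new family of vectors. -/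
theorem isProj_update {ι : Type*} [Fintype α] [Fintype ι] (hb : b.IsPosSemidef)
    {U : Submodule ℝ V} {a ā : α → V} {ϑ : ι → V} {N : Matrix ι α ℝ} {G : Matrix α ι ℝ}
    {E D : Matrix α α ℝ} (hp : IsProj b U a ā) (hϑU : Perp b ϑ U) (hϑa : cross b ϑ a = 0)
    (hE : cross b a a - cross b ā ā = E)
    (hG : E * Nᵀ = G * (N * E * Nᵀ + cross b ϑ ϑ))
    (hD : G * (N * E * Nᵀ + cross b ϑ ϑ) * Gᵀ = D) :
    ∃ ah, IsProj b (U ⊔ Submodule.span ℝ (Set.range (lin N a + ϑ))) a ah ∧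
      cross b ah ah = cross b ā ā + D := by
  set e := a - ā with he
  set i := lin N e + ϑ with hi
  have hee : cross b e e = E := by rw [← hE, hp.cross_residual hb]
  have hϑe : cross b ϑ e = 0 := by
    rw [he, cross_sub_right, hϑa, hϑU.cross_eq_zero hp.mem, sub_zero]
  have heϑ := cross_eq_zero_comm b hb hϑe
  have hei : cross b e i = E * Nᵀ := by
    rw [hi, cross_add_right, cross_lin_right, hee, heϑ, add_zero]
  have hii : cross b i i = N * E * Nᵀ + cross b ϑ ϑ := by
    conv_lhs => rw [hi, cross_add_left, cross_lin_left, ← hi, hei]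
    rw [hi, cross_add_right, cross_lin_right, hϑe, Matrix.zero_mul, zero_add, Matrix.mul_assoc]
  have hiU : Perp b i U := (hp.perp.lin N).add hϑU
  have hs : lin N a + ϑ = i + lin N ā := by
    rw [hi, he, lin_sub_right]
    abel
  have hU : ∀ j, lin N ā j ∈ U := lin_mem U N hp.mem
  -- Old estimate plus gain times innovation `i`. The innovation is orthogonal to `U`, and `hG` is
  -- the normal equation for projecting the error `e` to it; no inverse of the innovation covariance
  -- is required.
  refine ⟨ā + lin G i, ⟨fun j => ?_, ?_⟩, ?_⟩
  · refine Submodule.add_mem _ (Submodule.mem_sup_left (hp.mem j)) (lin_mem _ _ (fun l => ?_) j)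
    have h1 : i l = (lin N a + ϑ) l - lin N ā l := by rw [hs]; simp
    rw [h1]
    exact Submodule.sub_mem _ (Submodule.mem_sup_right (Submodule.subset_span ⟨l, rfl⟩))
      (Submodule.mem_sup_left (hU l))
  · have h2 : a - (ā + lin G i) = e - lin G i := by rw [he]; abel
    have h3 : Perp b (e - lin G i) U := hp.perp.sub (hiU.lin G)
    have h4 : Perp b (e - lin G i) (Submodule.span ℝ (Set.range (lin N a + ϑ))) := by
      refine perp_span ?_
      rw [hs, cross_add_right, h3.cross_eq_zero hU, add_zero, cross_sub_left, cross_lin_left, hei,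
        hii, hG, sub_self]
    rw [h2]
    intro j u hu
    obtain ⟨v, hv, w, hw, rfl⟩ := Submodule.mem_sup.1 hu
    rw [map_add, h3 j v hv, h4 j w hw, add_zero]
  · have h5 : cross b i ā = 0 := hiU.cross_eq_zero hp.mem
    rw [cross_add_left, cross_add_right, cross_add_right, cross_lin_right, cross_lin_left,
      cross_lin_left, cross_lin_right, h5, cross_eq_zero_comm b hb h5, hii, ← hD,
      Matrix.mul_zero, Matrix.zero_mul, zero_add, add_zero, ← Matrix.mul_assoc G]

end Moments

/-! ### The Kalman filter with prescribed posterior covariances. -/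

section Filtering

variable {V : Type*} [AddCommGroup V] [Module ℝ V] {b : LinearMap.BilinForm ℝ V} {κ : ℕ}
variable {ι : Fin κ → Type*}

/-- The span of the signals of the first `t` stages. -/
def sigSpan (s : ∀ k, ι k → V) (t : ℕ) : Submodule ℝ V :=
  Submodule.span ℝ (Set.range fun p : Σ j : {j : Fin κ // j.val < t}, ι j.1 => s p.1.1 p.2)

theorem mem_sigSpan (s : ∀ k, ι k → V) {t : ℕ} {j : Fin κ} (hj : j.val < t) (i : ι j) :
    s j i ∈ sigSpan s t :=
  Submodule.subset_span ⟨⟨⟨j, hj⟩, i⟩, rfl⟩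

theorem sigSpan_le (s : ∀ k, ι k → V) {t : ℕ} {U : Submodule ℝ V}
    (h : ∀ j : Fin κ, j.val < t → ∀ i, s j i ∈ U) : sigSpan s t ≤ U := by
  refine Submodule.span_le.2 ?_
  rintro _ ⟨p, rfl⟩
  exact h _ p.1.2 _

theorem sigSpan_mono (s : ∀ k, ι k → V) {t t' : ℕ} (h : t ≤ t') : sigSpan s t ≤ sigSpan s t' :=
  sigSpan_le s fun _ hj i => mem_sigSpan s (hj.trans_le h) i

theorem perp_sigSpan {α : Type*} {X : α → V} {s : ∀ k, ι k → V} {t : ℕ}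
    (h : ∀ j : Fin κ, j.val < t → cross b X (s j) = 0) : Perp b X (sigSpan s t) :=
  perp_span (by ext i p; exact congrFun (congrFun (h p.1.1 p.1.2) i) p.2)

theorem exists_isProj_sigSpan {α : Type*} [∀ k, Fintype (ι k)] (hb : b.IsPosSemidef) (X : α → V)
    (s : ∀ k, ι k → V) (t : ℕ) : ∃ Xh, IsProj b (sigSpan s t) X Xh :=
  exists_isProj hb X _

theorem sigSpan_succ (s : ∀ k, ι k → V) (k : Fin κ) :
    sigSpan s (k.val + 1) = sigSpan s k.val ⊔ Submodule.span ℝ (Set.range (s k)) := by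
  apply le_antisymm
  · refine sigSpan_le s fun j hj i => ?_
    rcases Nat.lt_succ_iff_lt_or_eq.1 hj with h | h
    · exact Submodule.mem_sup_left (mem_sigSpan s h i)
    · obtain rfl := Fin.ext h
      exact Submodule.mem_sup_right (Submodule.subset_span ⟨i, rfl⟩)
  · refine sup_le (sigSpan_mono s (Nat.le_succ _)) (Submodule.span_le.2 ?_)
    rintro _ ⟨i, rfl⟩
    exact mem_sigSpan s (Nat.lt_succ_self _) i

/-- The Kalman filter: if the covariances of the signals match the target increments
`X_k - F_k X_{k-1} F_k'`, then the posteriors have the target covariances. -/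
theorem exists_isProj_cross_eq {α : Fin κ → Type*} [∀ k, Fintype (α k)] [∀ k, Fintype (ι k)]
    (hb : b.IsPosSemidef) (a : ∀ k, α k → V) (ϑ : ∀ k, ι k → V) (N : ∀ k, Matrix (ι k) (α k) ℝ)
    (F : ∀ k, Matrix (α k) (α (prevStage k)) ℝ) (X P : ∀ k, Matrix (α k) (α k) ℝ)
    (hP : ∀ k, P k = if k.val = 0 then 0 else F k * X (prevStage k) * (F k)ᵀ)
    (hϑ : ∀ k l, k ≠ l → cross b (ϑ k) (ϑ l) = 0) (hϑa : ∀ k l, cross b (ϑ k) (a l) = 0)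
    (hF : ∀ k : Fin κ, k.val ≠ 0 → ∀ l, l < k →
      cross b (a k - lin (F k) (a (prevStage k))) (a l) = 0)
    (hG : ∀ k, ∃ G : Matrix (α k) (ι k) ℝ,
      (cross b (a k) (a k) - P k) * (N k)ᵀ =
        G * (N k * (cross b (a k) (a k) - P k) * (N k)ᵀ + cross b (ϑ k) (ϑ k)) ∧
      G * (N k * (cross b (a k) (a k) - P k) * (N k)ᵀ + cross b (ϑ k) (ϑ k)) * Gᵀ = X k - P k)
    (k : Fin κ) :
    ∃ ah, IsProj b (sigSpan (fun k => lin (N k) (a k) + ϑ k) (k.val + 1)) (a k) ah ∧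
      cross b ah ah = X k := by
  set s : ∀ k, ι k → V := fun k => lin (N k) (a k) + ϑ k with hs
  have step : ∀ k, ∀ ā, IsProj b (sigSpan s k.val) (a k) ā → cross b ā ā = P k →
      ∃ ah, IsProj b (sigSpan s (k.val + 1)) (a k) ah ∧ cross b ah ah = X k := by
    intro k ā hp hc
    obtain ⟨G, hG1, hG2⟩ := hG k
    have h1 : Perp b (ϑ k) (sigSpan s k.val) := by
      refine perp_sigSpan fun j hj => ?_
      rw [hs, cross_add_right, cross_lin_right, hϑa, Matrix.zero_mul, zero_add]
      exact hϑ _ _ fun h => by simp [h] at hj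
    obtain ⟨ah, h2, h3⟩ := isProj_update hb hp h1 (hϑa k k) (by rw [hc]) hG1 hG2
    exact ⟨ah, by rwa [sigSpan_succ], by rw [h3, hc, add_sub_cancel]⟩
  obtain ⟨t, ht⟩ := k
  induction t with
  | zero =>
    refine step _ 0 ⟨fun _ => Submodule.zero_mem _, perp_sigSpan fun j hj => ?_⟩ ?_
    · simp at hj
    · rw [hP]
      ext i j
      simp
  | succ t ih =>
    set k : Fin κ := ⟨t + 1, ht⟩ with hk
    have ih' : ∃ ah, IsProj b (sigSpan s k.val) (a (prevStage k)) ah ∧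
      cross b ah ah = X (prevStage k) := ih (by omega)
    obtain ⟨ah, h1, h2⟩ := ih'
    -- The prediction from earlier signals is `F k` times the previous posterior: the residual of
    -- the transition is orthogonal to the earlier vectors `a j` and to all noises, hence to the
    -- earlier signals.
    refine step k (lin (F k) ah) ?_ ?_
    · refine (h1.lin (F k)).of_perp (perp_sigSpan fun j hj => ?_)
      have hjk : j < k := Fin.lt_def.2 hj
      have h3 := hF k (by simp [hk]) j hjk
      have h4 : cross b (a k) (ϑ j) = 0 := cross_eq_zero_comm b hb (hϑa _ _)
      have h5 : cross b (a (prevStage k)) (ϑ j) = 0 := cross_eq_zero_comm b hb (hϑa _ _)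
      rw [hs, cross_add_right, cross_lin_right]
      change cross b (a k - lin (F k) (a (prevStage k))) (a j) * _ +
        cross b (a k - lin (F k) (a (prevStage k))) (ϑ j) = 0
      rw [h3, Matrix.zero_mul, zero_add, cross_sub_left, cross_lin_left, h4, h5, Matrix.mul_zero,
        sub_zero]
    · rw [cross_lin_left, cross_lin_right, h2, hP, if_neg (by simp [hk]), Matrix.mul_assoc]

end Filtering

/-! ### Design of one signal from the error covariance and the wanted increment. -/

section Decomposition

variable {α β : Type*} [Fintype α]

/-- `0 ⪯ D ⪯ E` gives `v'Dv ≤ v'Ev`, so the kernel of `E` lies in that of `D`. -/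
theorem mul_eq_zero_of_posSemidef_sub {E D : Matrix α α ℝ} (hD : D.PosSemidef)
    (hED : (E - D).PosSemidef) {M : Matrix α β ℝ} (hM : E * M = 0) : D * M = 0 := by
  ext i j
  set v : α → ℝ := fun a => M a j with hv
  have h1 : E *ᵥ v = 0 := by
    ext a
    exact congrFun (congrFun hM a) j
  have h2 := hED.dotProduct_mulVec_nonneg v
  rw [Matrix.sub_mulVec, h1, zero_sub, dotProduct_neg] at h2
  have h3 := hD.dotProduct_mulVec_nonneg v
  have h4 : D *ᵥ v = 0 := (hD.dotProduct_mulVec_zero_iff v).1 (by linarith)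
  exact congrFun h4 i

theorem transpose_mul_cancel {γ : Type*} [Fintype γ] [DecidableEq γ] {A : Matrix α γ ℝ}
    (h : Aᵀ * A = 1) (M : Matrix γ β ℝ) : Aᵀ * (A * M) = M := by
  rw [← Matrix.mul_assoc, h, Matrix.one_mul]

theorem exists_orthogonal_diagonalization [DecidableEq α] {M : Matrix α α ℝ}
    (hM : M.IsHermitian) :
    ∃ U ∈ Matrix.orthogonalGroup α ℝ, ∃ d : α → ℝ, M = U * diagonal d * Uᵀ := by
  refine ⟨hM.eigenvectorUnitary, hM.eigenvectorUnitary.2, hM.eigenvalues, ?_⟩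
  have h := hM.spectral_theorem
  rw [Unitary.conjStarAlgAut_apply] at h
  simpa [Function.comp_def, Matrix.star_eq_conjTranspose,
    Matrix.conjTranspose_eq_transpose_of_trivial] using h

theorem diagonalization_nonneg [DecidableEq α] {M U : Matrix α α ℝ} {d : α → ℝ}
    (hM : M.PosSemidef) (hU : U ∈ Matrix.orthogonalGroup α ℝ) (h : M = U * diagonal d * Uᵀ)
    (i : α) : 0 ≤ d i := by
  have hU1 : Uᵀ * U = 1 := (Matrix.mem_orthogonalGroup_iff' α ℝ).1 hU
  have h1 : Uᵀ * M * U = diagonal d := by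
    rw [h]
    simp only [Matrix.mul_assoc, hU1, Matrix.mul_one, transpose_mul_cancel hU1]
  have h2 : (Uᵀ * M * U).PosSemidef := by
    simpa [Matrix.conjTranspose_eq_transpose_of_trivial] using hM.conjTranspose_mul_mul_same U
  rw [h1] at h2
  simpa using h2.diag_nonneg (i := i)

variable [DecidableEq α]

/-- The inclusion of the first block of a partition. -/
def blockIncl {t q : ℕ} (part : Fin t ⊕ Fin q ≃ α) : Matrix α (Fin t) ℝ :=
  (1 : Matrix α α ℝ).submatrix id (part ∘ Sum.inl)

variable {t q : ℕ} (part : Fin t ⊕ Fin q ≃ α)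

theorem mul_blockIncl (A : Matrix β α ℝ) :
    A * blockIncl part = A.submatrix id (part ∘ Sum.inl) := by
  ext i j
  simp [blockIncl, Matrix.mul_apply, Matrix.one_apply]

theorem blockIncl_transpose_mul (A : Matrix α β ℝ) :
    (blockIncl part)ᵀ * A = A.submatrix (part ∘ Sum.inl) id := by
  ext i j
  simp [blockIncl, Matrix.mul_apply, Matrix.one_apply]

theorem blockIncl_orthonormal : (blockIncl part)ᵀ * blockIncl part = 1 := by
  rw [blockIncl_transpose_mul]
  ext i j
  simp [blockIncl, Matrix.one_apply]

-- With the zero-padded block written as `J X Jᵀ` for an isometric inclusion `J`, block computations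
-- reduce to cancelling `Jᵀ J = 1`.
omit [Fintype α] in
theorem reindex_fromBlocks_eq (X : Matrix (Fin t) (Fin t) ℝ) :
    Matrix.reindex part part (Matrix.fromBlocks X 0 0 0) =
      blockIncl part * X * (blockIncl part)ᵀ := by
  have h : ∀ a i, blockIncl part (part a) i = if a = Sum.inl i then 1 else 0 := by
    intro a i
    simp [blockIncl, Matrix.one_apply]
  ext a c
  obtain ⟨a, rfl⟩ := part.surjective a
  obtain ⟨c, rfl⟩ := part.surjective c
  rcases a with a | a <;> rcases c with c | c <;>
    simp [Matrix.mul_apply, h]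

/-- The relation between the covariance `E` of the prediction error, the increment `D` of the
posterior covariance, the gain `L` and the noise covariance `T` in the construction of a
signal. -/
def IsDesign (E D L T : Matrix α α ℝ) : Prop :=
  ∃ (t q : ℕ) (part : Fin t ⊕ Fin q ≃ α)
    (U₀ : Matrix α α ℝ) (d : Fin t → ℝ)
    (U : Matrix (Fin t) (Fin t) ℝ) (e f θ : Fin t → ℝ),
    U₀ ∈ Matrix.orthogonalGroup α ℝ ∧ (∀ i, 0 < d i) ∧
    E = U₀ * Matrix.reindex part part (Matrix.fromBlocks (Matrix.diagonal d) 0 0 0) * U₀ᵀ ∧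
    U ∈ Matrix.orthogonalGroup (Fin t) ℝ ∧
    Matrix.diagonal (fun i => (√(d i))⁻¹) *
      (U₀ᵀ * D * U₀).submatrix (part ∘ Sum.inl) (part ∘ Sum.inl) *
      Matrix.diagonal (fun i => (√(d i))⁻¹) = U * Matrix.diagonal e * Uᵀ ∧
    (∀ i, 0 < f i ^ 2 + θ i ^ 2 ∧ f i ^ 2 / (f i ^ 2 + θ i ^ 2) = e i) ∧
    L = U₀ * Matrix.reindex part part (Matrix.fromBlocks
      (Matrix.diagonal (fun i => (√(d i))⁻¹) * U * Matrix.diagonal f) 0 0 0) ∧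
    T = Matrix.reindex part part (Matrix.fromBlocks (Matrix.diagonal fun i => θ i ^ 2) 0 0 0)

theorem submatrix_eq_mul (A : Matrix α α ℝ) :
    A.submatrix (part ∘ Sum.inl) (part ∘ Sum.inl) =
      (blockIncl part)ᵀ * A * blockIncl part := by
  rw [mul_blockIncl, blockIncl_transpose_mul]
  rfl

/-- In the whitened eigencoordinates the signal splits into scalar channels with unit error
variance, gain `f` and noise variance `θ²`. The innovation variance is `f² + θ²`, and the estimate
removes the fraction `f² / (f² + θ²) = e` of the error, which is the wanted eigenvalue of the
increment. -/
theorem IsDesign.exists_gain {E D L T : Matrix α α ℝ} (h : IsDesign E D L T)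
    (hD : D.PosSemidef) (hED : (E - D).PosSemidef) :
    ∃ G : Matrix α α ℝ, E * L = G * (Lᵀ * E * L + T) ∧ G * (Lᵀ * E * L + T) * Gᵀ = D := by
  obtain ⟨t, q, part, U₀, d, U, e, f, θ, hU₀, hd, hE, hU, hDe, hf, hL, hT⟩ := h
  rw [reindex_fromBlocks_eq] at hE hL hT
  rw [submatrix_eq_mul] at hDe
  set J := blockIncl part with hJ
  have hJJ : Jᵀ * J = 1 := blockIncl_orthonormal part
  have hU₀' : U₀ᵀ * U₀ = 1 := (Matrix.mem_orthogonalGroup_iff' α ℝ).1 hU₀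
  have hU1 : Uᵀ * U = 1 := (Matrix.mem_orthogonalGroup_iff' _ ℝ).1 hU
  have hU2 : U * Uᵀ = 1 := (Matrix.mem_orthogonalGroup_iff _ ℝ).1 hU
  set K := U₀ * J with hK
  have hKK : Kᵀ * K = 1 := by
    rw [hK, Matrix.transpose_mul, Matrix.mul_assoc, ← Matrix.mul_assoc U₀ᵀ, hU₀', Matrix.one_mul,
      hJJ]
  set r : Fin t → ℝ := fun i => √(d i) with hr
  have hrr : ∀ i, r i * r i = d i := fun i => Real.mul_self_sqrt (hd i).le
  have hr0 : ∀ i, r i ≠ 0 := fun i => (Real.sqrt_pos.2 (hd i)).ne'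
  have hE' : E = K * diagonal d * Kᵀ := by
    rw [hE, hK, Matrix.transpose_mul]
    simp only [Matrix.mul_assoc]
  have hL' : L = K * (diagonal (fun i => (r i)⁻¹) * U * diagonal f) * Jᵀ := by
    rw [hL, hK]
    simp only [Matrix.mul_assoc, hr]
  have dd : ∀ (x y : Fin t → ℝ) (M : Matrix (Fin t) α ℝ),
      diagonal x * (diagonal y * M) = diagonal (fun i => x i * y i) * M := fun x y M => by
    rw [← Matrix.mul_assoc, diagonal_mul_diagonal]
  set c : Fin t → ℝ := fun i => f i ^ 2 + θ i ^ 2 with hc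
  have hc0 : ∀ i, c i ≠ 0 := fun i => (hf i).1.ne'
  have hEL : E * L = K * (diagonal r * (U * (diagonal f * Jᵀ))) := by
    rw [hE', hL']
    simp only [Matrix.mul_assoc, transpose_mul_cancel hKK, dd]
    congr 3
    funext i
    rw [← hrr, mul_assoc, mul_inv_cancel₀ (hr0 i), mul_one]
  have hI : Lᵀ * E * L + T = J * (diagonal c * Jᵀ) := by
    rw [Matrix.mul_assoc, hEL, hL', hT]
    simp only [Matrix.mul_assoc, Matrix.transpose_mul, Matrix.transpose_transpose,
      diagonal_transpose, transpose_mul_cancel hKK, dd, inv_mul_cancel₀ (hr0 _), diagonal_one,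
      Matrix.one_mul, transpose_mul_cancel hU1]
    rw [← Matrix.mul_add, ← Matrix.add_mul, diagonal_add]
    simp only [hc, sq]
  -- The scalar Kalman gains `f / (f² + θ²)`, carried back to the original coordinates by undoing
  -- the whitening.
  refine ⟨K * (diagonal r * (U * (diagonal (fun i => f i / c i) * Jᵀ))), ?_, ?_⟩
  · rw [hI, hEL]
    simp only [Matrix.mul_assoc, transpose_mul_cancel hJJ, dd, div_mul_cancel₀ _ (hc0 _)]
  -- `D` lives on the range of `K`, because `E` vanishes on the orthogonal complement and `D ⪯ E`.
  -- So its compressed block determines it.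
  · have h1 : K * (Kᵀ * (D * K)) * Kᵀ = D := by
      have h2 : E * (1 - K * Kᵀ) = 0 := by
        rw [hE', Matrix.mul_sub, Matrix.mul_one]
        simp only [Matrix.mul_assoc, transpose_mul_cancel hKK, sub_self]
      have h3 := mul_eq_zero_of_posSemidef_sub hD hED h2
      rw [Matrix.mul_sub, Matrix.mul_one, sub_eq_zero] at h3
      have h4 : D = K * Kᵀ * D := by
        have := congrArg Matrix.transpose h3
        have hDt : Dᵀ = D := hD.1
        simpa only [Matrix.transpose_mul, hDt, Matrix.transpose_transpose, Matrix.mul_assoc]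
          using this
      conv_rhs => rw [h4, h3]
      simp only [Matrix.mul_assoc]
    have h5 : Kᵀ * (D * K) = diagonal r * (U * (diagonal e * (Uᵀ * diagonal r))) := by
      have h6 : diagonal r * (U * diagonal e * Uᵀ) * diagonal r = Kᵀ * (D * K) := by
        have h7 : diagonal r * diagonal (fun i => (r i)⁻¹) = 1 := by
          rw [diagonal_mul_diagonal]
          simp only [mul_inv_cancel₀ (hr0 _), diagonal_one]
        have h8 : diagonal (fun i => (r i)⁻¹) * diagonal r = 1 := by
          rw [diagonal_mul_diagonal]
          simp only [inv_mul_cancel₀ (hr0 _), diagonal_one]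
        rw [← hDe]
        calc _ = diagonal r * diagonal (fun i => (r i)⁻¹) * (Jᵀ * (U₀ᵀ * D * U₀) * J) *
            (diagonal (fun i => (r i)⁻¹) * diagonal r) := by simp only [Matrix.mul_assoc, hr]
          _ = _ := by
            rw [h7, h8, Matrix.one_mul, Matrix.mul_one, hK, Matrix.transpose_mul]
            simp only [Matrix.mul_assoc]
      rw [← h6]
      simp only [Matrix.mul_assoc]
    rw [hI]
    conv_rhs => rw [← h1, h5]
    simp only [Matrix.mul_assoc, Matrix.transpose_mul, Matrix.transpose_transpose,
      diagonal_transpose, transpose_mul_cancel hJJ, dd]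
    congr 5
    funext i
    rw [← (hf i).2]
    have := hc0 i
    simp only [hc] at this ⊢
    field_simp

/-- The whitened increment has eigenvalues `e` in `[0, 1]`, so `f = √e` and `θ = √(1 - e)` are
admissible and satisfy `f² + θ² = 1`. -/
theorem exists_isDesign {E D : Matrix α α ℝ} (hE : E.PosSemidef) (hD : D.PosSemidef)
    (hED : (E - D).PosSemidef) : ∃ L T, T.PosSemidef ∧ IsDesign E D L T := by
  obtain ⟨V, hV, w, hw⟩ := exists_orthogonal_diagonalization hE.1
  have hw0 := diagonalization_nonneg hE hV hw
  have hV1 : Vᵀ * V = 1 := (Matrix.mem_orthogonalGroup_iff' α ℝ).1 hV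
  -- The first block collects the positive eigenvalues of `E`, the second the zero ones.
  let part : Fin (Fintype.card {a // 0 < w a}) ⊕ Fin (Fintype.card {a // ¬ 0 < w a}) ≃ α :=
    (Equiv.sumCongr (Fintype.equivFin _).symm (Fintype.equivFin _).symm).trans
      (Equiv.sumCompl fun a => 0 < w a)
  set d := fun i => w (part (Sum.inl i)) with hd
  have hdpos : ∀ i, 0 < d i := fun i => by
    simpa [hd, part] using ((Fintype.equivFin {a // 0 < w a}).symm i).2
  have hzero : ∀ i, w (part (Sum.inr i)) = 0 := fun i => by
    refine le_antisymm ?_ (hw0 _)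
    simpa [part] using ((Fintype.equivFin {a // ¬ 0 < w a}).symm i).2
  have hblock : diagonal w =
      Matrix.reindex part part (Matrix.fromBlocks (Matrix.diagonal d) 0 0 0) := by
    ext a c
    obtain ⟨a, rfl⟩ := part.surjective a
    obtain ⟨c, rfl⟩ := part.surjective c
    rcases a with a | a <;> rcases c with c | c <;>
      simp [Matrix.diagonal_apply, hd, hzero]
  set r : Matrix _ _ ℝ := diagonal (fun i => (√(d i))⁻¹) with hr
  set J := blockIncl part with hJ
  have hrt : rᵀ = r := diagonal_transpose _
  have hpsd : ∀ {M : Matrix α α ℝ}, M.PosSemidef →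
      (r * (Vᵀ * M * V).submatrix (part ∘ Sum.inl) (part ∘ Sum.inl) * r).PosSemidef := by
    intro M hM
    have := hM.conjTranspose_mul_mul_same (V * J * r)
    rw [submatrix_eq_mul]
    simpa only [Matrix.conjTranspose_eq_transpose_of_trivial, Matrix.transpose_mul, hrt,
      Matrix.mul_assoc] using this
  obtain ⟨U, hU, e, he⟩ := exists_orthogonal_diagonalization (hpsd hD).1
  have he0 := diagonalization_nonneg (hpsd hD) hU he
  have hU2 : U * Uᵀ = 1 := (Matrix.mem_orthogonalGroup_iff _ ℝ).1 hU
  -- Whitening turns `E` into the identity on the first block, so `E - D ⪰ 0` becomes `1 - e ≥ 0`.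
  have he1 : ∀ i, e i ≤ 1 := by
    have h1 : r * (Vᵀ * (E - D) * V).submatrix (part ∘ Sum.inl) (part ∘ Sum.inl) * r =
        U * diagonal (fun i => 1 - e i) * Uᵀ := by
      have h2 : (Vᵀ * E * V).submatrix (part ∘ Sum.inl) (part ∘ Sum.inl) = diagonal d := by
        rw [hw]
        simp only [Matrix.mul_assoc, hV1, Matrix.mul_one, transpose_mul_cancel hV1]
        ext i j
        simp [Matrix.diagonal_apply, hd]
      have h3 : r * diagonal d * r = 1 := by
        rw [hr, diagonal_mul_diagonal, diagonal_mul_diagonal, ← diagonal_one]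
        congr 1
        funext i
        have := Real.mul_self_sqrt (hdpos i).le
        have h4 : √(d i) ≠ 0 := (Real.sqrt_pos.2 (hdpos i)).ne'
        field_simp
        rw [sq, this]
      rw [Matrix.mul_sub, Matrix.sub_mul, Matrix.submatrix_sub, Pi.sub_apply, Pi.sub_apply,
        Matrix.mul_sub, Matrix.sub_mul, he, h2, h3, ← diagonal_sub, Matrix.mul_sub, diagonal_one,
        Matrix.mul_one, Matrix.sub_mul, hU2]
    intro i
    have := diagonalization_nonneg (hpsd hED) hU h1 i
    linarith
  refine ⟨_, _, ?_, _, _, part, V, d, U, e, fun i => √(e i), fun i => √(1 - e i), hV, hdpos, ?_,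
    hU, he, fun i => ?_, rfl, rfl⟩
  · rw [reindex_fromBlocks_eq]
    have h1 : (diagonal fun i => √(1 - e i) ^ 2).PosSemidef :=
      Matrix.PosSemidef.diagonal fun i => sq_nonneg _
    simpa only [Matrix.conjTranspose_eq_transpose_of_trivial] using
      h1.mul_mul_conjTranspose_same (blockIncl part)
  · rw [← hblock, hw]
  · have h1 : √(e i) ^ 2 + √(1 - e i) ^ 2 = 1 := by
      rw [Real.sq_sqrt (he0 i), Real.sq_sqrt (by linarith [he1 i])]
      ring
    rw [h1, Real.sq_sqrt (he0 i)]
    simp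

end Decomposition

/-! ### Second moments, independence and conditioning for functionals of a Gaussian vector. -/

section Gaussian

variable {W : Type*} [NormedAddCommGroup W] [NormedSpace ℝ W] [MeasurableSpace W] [BorelSpace W]

theorem memLp_two_dual (μ : Measure W) [IsGaussian μ] (φ : StrongDual ℝ W) : MemLp φ 2 μ :=
  IsGaussian.memLp_dual μ φ 2 (by simp)

theorem integrable_dual_mul (μ : Measure W) [IsGaussian μ] (φ ψ : StrongDual ℝ W) :
    Integrable (fun w => φ w * ψ w) μ :=
  (memLp_two_dual μ φ).integrable_mul (memLp_two_dual μ ψ)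

/-- The second moments of the linear functionals of a Gaussian vector. -/
def moment (μ : Measure W) [IsGaussian μ] : LinearMap.BilinForm ℝ (StrongDual ℝ W) :=
  LinearMap.mk₂ ℝ (fun φ ψ => ∫ w, φ w * ψ w ∂μ)
    (fun φ φ' ψ => by
      rw [← integral_add (integrable_dual_mul μ φ ψ) (integrable_dual_mul μ φ' ψ)]
      simp [add_mul])
    (fun c φ ψ => by
      rw [smul_eq_mul, ← integral_const_mul]
      simp [mul_assoc])
    (fun φ ψ ψ' => by
      rw [← integral_add (integrable_dual_mul μ φ ψ) (integrable_dual_mul μ φ ψ')]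
      simp [mul_add])
    (fun c φ ψ => by
      rw [smul_eq_mul, ← integral_const_mul]
      simp [mul_left_comm])

variable (μ : Measure W) [IsGaussian μ]

theorem moment_apply (φ ψ : StrongDual ℝ W) : moment μ φ ψ = ∫ w, φ w * ψ w ∂μ := rfl

theorem moment_isPosSemidef : (moment μ).IsPosSemidef where
  eq φ ψ := by simp [moment_apply, mul_comm]
  nonneg φ := integral_nonneg fun w => mul_self_nonneg _

/-- All linear functionals have mean zero. -/
def IsCentered (μ : Measure W) : Prop := ∀ φ : StrongDual ℝ W, ∫ w, φ w ∂μ = 0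

variable {μ}

theorem covariance_eq_moment (h0 : IsCentered μ) (φ ψ : StrongDual ℝ W) :
    cov[φ, ψ; μ] = moment μ φ ψ := by
  simp [covariance, h0 φ, h0 ψ, moment_apply]

variable {J : Type*} [Fintype J]

/-- The information in finitely many linear functionals. -/
@[reducible]
def dualInfo (φ : J → StrongDual ℝ W) : MeasurableSpace W :=
  MeasurableSpace.comap (fun w j => φ j w) inferInstance

omit [Fintype J] in
theorem dualInfo_le (φ : J → StrongDual ℝ W) : dualInfo φ ≤ (inferInstance : MeasurableSpace W) :=
  (measurable_pi_lambda _ fun j => (φ j).continuous.measurable).comap_le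

omit [MeasurableSpace W] [BorelSpace W] [Fintype J] in
theorem measurable_dualInfo (φ : J → StrongDual ℝ W) {ψ : StrongDual ℝ W}
    (h : ψ ∈ Submodule.span ℝ (Set.range φ)) : Measurable[dualInfo φ] ψ := by
  induction h using Submodule.span_induction with
  | mem x hx =>
    obtain ⟨j, rfl⟩ := hx
    exact (measurable_pi_apply (X := fun _ : J => ℝ) j).comp (comap_measurable _)
  | zero => exact measurable_const
  | add x y _ _ hx hy => exact hx.add hy
  | smul c x _ hx => exact hx.const_mul c

theorem indepFun_of_moment_eq_zero (h0 : IsCentered μ) (φ : J → StrongDual ℝ W)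
    (ψ : StrongDual ℝ W) (h : ∀ j, moment μ ψ (φ j) = 0) :
    IndepFun ψ (fun w j => φ j w) μ := by
  -- The single functional is viewed as a family over `Unit`, to apply the covariance criterion for
  -- independence of two jointly Gaussian families.
  have h1 : HasGaussianLaw (fun w => ((fun _ : Unit => ψ w), fun j => φ j w)) μ :=
    IsGaussian.hasGaussianLaw_id.map_fun
      ((ContinuousLinearMap.pi fun _ : Unit => ψ).prod (ContinuousLinearMap.pi φ))
  have h2 := h1.indepFun_of_covariance_eval (X := fun _ w => ψ w) (Y := fun j w => φ j w)
    fun _ j => (covariance_eq_moment h0 ψ (φ j)).trans (h j)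
  exact h2.comp (φ := fun f : Unit → ℝ => f ()) (measurable_pi_apply ()) measurable_id

/-- Orthogonality to the span is upgraded to independence, so `g` may be any measurable function of
the observed functionals. This covers inputs of nonlinear policies. -/
theorem integral_mul_eq_zero (h0 : IsCentered μ) (φ : J → StrongDual ℝ W)
    (ψ : StrongDual ℝ W) (h : ∀ u ∈ Submodule.span ℝ (Set.range φ), moment μ ψ u = 0) {g : W → ℝ}
    (hg : Measurable[dualInfo φ] g) : ∫ w, ψ w * g w ∂μ = 0 := by
  have h1 : IndepFun ψ g μ := by
    have h2 := indepFun_of_moment_eq_zero h0 φ ψ fun j => h _ (Submodule.subset_span ⟨j, rfl⟩)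
    rw [IndepFun_iff_Indep] at h2 ⊢
    exact indep_of_indep_of_le_right h2 hg.comap_le
  have h3 := h1.integral_mul_eq_mul_integral ψ.continuous.aestronglyMeasurable
    (hg.mono (dualInfo_le φ) le_rfl).aestronglyMeasurable
  simpa [h0 ψ] using h3

/-- The residual is independent of the information and has mean zero, while the projection is
measurable with respect to it. -/
theorem condExp_dual (h0 : IsCentered μ) (φ : J → StrongDual ℝ W) {ψ ψh : StrongDual ℝ W}
    (hm : ψh ∈ Submodule.span ℝ (Set.range φ))
    (h : ∀ u ∈ Submodule.span ℝ (Set.range φ), moment μ (ψ - ψh) u = 0) :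
    μ[ψ | dualInfo φ] =ᵐ[μ] ψh := by
  have hle := dualInfo_le φ
  have hi : ∀ χ : StrongDual ℝ W, Integrable χ μ := fun χ =>
    (memLp_two_dual μ χ).integrable (by simp)
  have h1 : μ[⇑(ψ - ψh) | dualInfo φ] =ᵐ[μ] fun _ => ∫ w, (ψ - ψh) w ∂μ := by
    have h2 := indepFun_of_moment_eq_zero h0 φ (ψ - ψh)
      fun j => h _ (Submodule.subset_span ⟨j, rfl⟩)
    rw [IndepFun_iff_Indep] at h2
    refine condExp_indep_eq ((ψ - ψh).continuous.measurable.comap_le) hle ?_ h2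
    exact (comap_measurable _).stronglyMeasurable
  have h3 : μ[⇑ψh | dualInfo φ] = ψh :=
    condExp_of_stronglyMeasurable hle (measurable_dualInfo φ hm).stronglyMeasurable (hi _)
  have h4 := condExp_add (hi (ψ - ψh)) (hi ψh) (dualInfo φ)
  have h5 : (⇑(ψ - ψh) + ⇑ψh : W → ℝ) = ψ := by
    ext w
    simp
  rw [h5, h3] at h4
  filter_upwards [h1, h4] with w hw1 hw4
  rw [hw4, Pi.add_apply, hw1, h0, zero_add]

end Gaussian

/-! ### Centred Gaussian laws on products. -/

section Products

variable {E F : Type*} [NormedAddCommGroup E] [NormedSpace ℝ E] [MeasurableSpace E] [BorelSpace E]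
  [NormedAddCommGroup F] [NormedSpace ℝ F] [MeasurableSpace F] [BorelSpace F]

theorem IsCentered.prod [SecondCountableTopologyEither E F] {μ : Measure E} {ν : Measure F}
    [IsGaussian μ] [IsGaussian ν]
    (hμ : IsCentered μ) (hν : IsCentered ν) : IsCentered (μ.prod ν) := by
  intro φ
  have h1 : ∀ z : E × F, φ z = φ.comp (ContinuousLinearMap.inl ℝ E F) z.1 +
      φ.comp (ContinuousLinearMap.inr ℝ E F) z.2 := by
    intro z
    simp [← map_add]
  have h2 := (memLp_two_dual μ (φ.comp (ContinuousLinearMap.inl ℝ E F))).integrable (by simp)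
  have h3 := (memLp_two_dual ν (φ.comp (ContinuousLinearMap.inr ℝ E F))).integrable (by simp)
  simp_rw [h1]
  rw [integral_add (h2.comp_fst ν) (h3.comp_snd μ), integral_fun_fst (μ := μ) (ν := ν),
    integral_fun_snd (μ := μ) (ν := ν), hμ, hν]
  simp

instance isGaussian_pi {κ : ℕ} [SecondCountableTopology E] [CompleteSpace E] (μ : Measure E)
    [IsGaussian μ] : IsGaussian (Measure.pi fun _ : Fin κ => μ) := by
  have h1 : HasGaussianLaw (fun (w : Fin κ → E) i => w i) (Measure.pi fun _ : Fin κ => μ) := by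
    refine iIndepFun.hasGaussianLaw (X := fun i (w : Fin κ → E) => w i) (fun i => ?_) ?_
    · refine HasGaussianLaw.mk ?_
      rw [(measurePreserving_eval (fun _ : Fin κ => μ) i).map_eq]
      infer_instance
    · exact iIndepFun_pi (X := fun _ => id) fun _ => aemeasurable_id
  have h2 := h1.isGaussian_map
  change IsGaussian (Measure.map id _) at h2
  rwa [Measure.map_id] at h2

theorem IsCentered.pi {κ : ℕ} {μ : Measure E} [IsGaussian μ] (hμ : IsCentered μ) :
    IsCentered (Measure.pi fun _ : Fin κ => μ) := by
  intro φ
  have h1 : ∀ z : Fin κ → E, φ z =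
      ∑ i, φ.comp (ContinuousLinearMap.single ℝ (fun _ : Fin κ => E) i) (z i) := by
    intro z
    simp only [ContinuousLinearMap.comp_apply, ← map_sum]
    congr 1
    exact (Finset.univ_sum_single z).symm
  have h2 : ∀ i, MeasurePreserving (Function.eval i) (Measure.pi fun _ : Fin κ => μ) μ :=
    fun i => measurePreserving_eval (fun _ : Fin κ => μ) i
  simp_rw [h1]
  rw [integral_finsetSum]
  · refine Finset.sum_eq_zero fun i _ => ?_
    have h3 := hμ (φ.comp (ContinuousLinearMap.single ℝ (fun _ : Fin κ => E) i))
    rw [← (h2 i).map_eq, integral_map (h2 i).measurable.aemeasurable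
      (ContinuousLinearMap.continuous _).aestronglyMeasurable] at h3
    exact h3
  · intro i _
    exact (h2 i).integrable_comp_of_integrable ((memLp_two_dual μ _).integrable (by simp))

theorem isCentered_multivariateGaussian {α : Type*} [Fintype α] [DecidableEq α]
    (S : Matrix α α ℝ) : IsCentered (multivariateGaussian 0 S) := by
  intro φ
  rw [IsGaussian.integral_dual, integral_id_multivariateGaussian, map_zero]

end Products

/-! ### The law of the primitive variables is Gaussian and centred. -/

section Law

variable {m r n κ : ℕ} {Ω : Type*} (M : Model m r n κ Ω) {ι : Fin κ → Type} [∀ k, Fintype (ι k)]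

instance isGaussian_primLaw : IsGaussian M.primLaw := by
  unfold Model.primLaw
  infer_instance

theorem isCentered_primLaw : IsCentered M.primLaw := by
  exact (isCentered_multivariateGaussian _).prod
    ((isCentered_multivariateGaussian _).pi.prod (isCentered_multivariateGaussian _).pi)

instance isGaussian_law (η : Rule n ι) : IsGaussian (M.law η) := by
  unfold Model.law
  infer_instance

theorem isCentered_law (η : Rule n ι) : IsCentered (M.law η) := by
  classical
  exact (isCentered_primLaw M).prod (isCentered_multivariateGaussian _)

end Law

/-! ### Second moments under product laws. -/

section ProductMoments

variable {E F : Type*} [NormedAddCommGroup E] [NormedSpace ℝ E] [MeasurableSpace E] [BorelSpace E]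
  [NormedAddCommGroup F] [NormedSpace ℝ F] [MeasurableSpace F] [BorelSpace F]

/-- Each mixed term factors into a product of means, one of which is the mean of a functional of the
first component and so vanishes. -/
theorem moment_prod [SecondCountableTopologyEither E F] {μ : Measure E} {ν : Measure F}
    [IsGaussian μ] [IsGaussian ν] (hμ : IsCentered μ) (φ ψ : StrongDual ℝ (E × F)) :
    moment (μ.prod ν) φ ψ =
      moment μ (φ.comp (ContinuousLinearMap.inl ℝ E F)) (ψ.comp (ContinuousLinearMap.inl ℝ E F)) +
      moment ν (φ.comp (ContinuousLinearMap.inr ℝ E F))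
        (ψ.comp (ContinuousLinearMap.inr ℝ E F)) := by
  set φ₁ := φ.comp (ContinuousLinearMap.inl ℝ E F) with hφ₁
  set φ₂ := φ.comp (ContinuousLinearMap.inr ℝ E F) with hφ₂
  set ψ₁ := ψ.comp (ContinuousLinearMap.inl ℝ E F) with hψ₁
  set ψ₂ := ψ.comp (ContinuousLinearMap.inr ℝ E F) with hψ₂
  have h1 : ∀ z : E × F, φ z = φ₁ z.1 + φ₂ z.2 := by
    intro z
    simp [hφ₁, hφ₂, ← map_add]
  have h2 : ∀ z : E × F, ψ z = ψ₁ z.1 + ψ₂ z.2 := by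
    intro z
    simp [hψ₁, hψ₂, ← map_add]
  have hi : ∀ χ : StrongDual ℝ E, Integrable χ μ := fun χ =>
    (memLp_two_dual μ χ).integrable (by simp)
  have hj : ∀ χ : StrongDual ℝ F, Integrable χ ν := fun χ =>
    (memLp_two_dual ν χ).integrable (by simp)
  have h3 : ∀ z : E × F, φ z * ψ z =
      (φ₁ z.1 * ψ₁ z.1 + φ₂ z.2 * ψ₂ z.2) + (φ₁ z.1 * ψ₂ z.2 + ψ₁ z.1 * φ₂ z.2) := by
    intro z
    rw [h1, h2]
    ring
  have i1 : Integrable (fun z : E × F => φ₁ z.1 * ψ₁ z.1) (μ.prod ν) :=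
    (integrable_dual_mul μ φ₁ ψ₁).comp_fst ν
  have i2 : Integrable (fun z : E × F => φ₂ z.2 * ψ₂ z.2) (μ.prod ν) :=
    (integrable_dual_mul ν φ₂ ψ₂).comp_snd μ
  have i3 : Integrable (fun z : E × F => φ₁ z.1 * ψ₂ z.2) (μ.prod ν) := (hi φ₁).mul_prod (hj ψ₂)
  have i4 : Integrable (fun z : E × F => ψ₁ z.1 * φ₂ z.2) (μ.prod ν) := (hi ψ₁).mul_prod (hj φ₂)
  have e1 := integral_fun_fst (μ := μ) (ν := ν) fun x => φ₁ x * ψ₁ x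
  have e2 := integral_fun_snd (μ := μ) (ν := ν) fun x => φ₂ x * ψ₂ x
  rw [moment_apply, moment_apply, moment_apply]
  simp_rw [h3]
  rw [integral_add (by exact i1.add i2) (by exact i3.add i4), integral_add i1 i2,
    integral_add i3 i4,
    integral_prod_mul, integral_prod_mul, hμ, hμ, e1, e2]
  simp

theorem moment_pi_eval {κ : ℕ} [SecondCountableTopology E] [CompleteSpace E] {μ : Measure E}
    [IsGaussian μ]
    (hμ : IsCentered μ) (φ ψ : StrongDual ℝ E) (k l : Fin κ) :
    moment (Measure.pi fun _ : Fin κ => μ)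
        (φ.comp (ContinuousLinearMap.proj (R := ℝ) (φ := fun _ : Fin κ => E) k))
        (ψ.comp (ContinuousLinearMap.proj (R := ℝ) (φ := fun _ : Fin κ => E) l)) =
      if k = l then moment μ φ ψ else 0 := by
  have h2 : ∀ i, MeasurePreserving (Function.eval i) (Measure.pi fun _ : Fin κ => μ) μ :=
    fun i => measurePreserving_eval (fun _ : Fin κ => μ) i
  have h3 : ∀ (χ : StrongDual ℝ E) i, ∫ z, χ (z i) ∂(Measure.pi fun _ : Fin κ => μ) = 0 := by
    intro χ i
    have h4 := hμ χ
    rw [← (h2 i).map_eq, integral_map (h2 i).measurable.aemeasurable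
      χ.continuous.aestronglyMeasurable] at h4
    exact h4
  split_ifs with h
  · subst h
    rw [moment_apply, moment_apply]
    conv_rhs => rw [← (h2 k).map_eq]
    rw [integral_map (h2 k).measurable.aemeasurable (by fun_prop)]
    rfl
  · have h1 : iIndepFun (fun i (w : Fin κ → E) => w i) (Measure.pi fun _ : Fin κ => μ) :=
      iIndepFun_pi (X := fun _ => id) fun _ => aemeasurable_id
    have h5 := (h1.indepFun h).comp φ.continuous.measurable ψ.continuous.measurable
    have h6 := h5.integral_mul_eq_mul_integral
      (φ.continuous.comp (continuous_apply k)).aestronglyMeasurable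
      (ψ.continuous.comp (continuous_apply l)).aestronglyMeasurable
    have h7 : ∫ z, φ (z k) ∂(Measure.pi fun _ : Fin κ => μ) = 0 := h3 φ k
    change ∫ z, φ (z k) * ψ (z l) ∂(Measure.pi fun _ : Fin κ => μ) = 0
    refine h6.trans ?_
    simp only [Function.comp_def, h7, zero_mul]

theorem moment_multivariateGaussian {α : Type*} [Fintype α] [DecidableEq α] {S : Matrix α α ℝ}
    (hS : S.PosSemidef) (i j : α) :
    moment (multivariateGaussian 0 S) (EuclideanSpace.proj i) (EuclideanSpace.proj j) = S i j := by
  rw [← covariance_eq_moment (isCentered_multivariateGaussian S)]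
  exact covariance_eval_multivariateGaussian hS i j

theorem dual_eq_sum_proj {α : Type*} [Fintype α] [DecidableEq α]
    (φ : StrongDual ℝ (EuclideanSpace ℝ α)) :
    φ = ∑ i, φ (EuclideanSpace.single i 1) • (EuclideanSpace.proj i : StrongDual ℝ _) := by
  ext x
  have h : x = ∑ i, x i • EuclideanSpace.single i (1 : ℝ) := by
    ext j
    simp [Pi.single_apply]
  conv_lhs => rw [h]
  simp [mul_comm]

theorem moment_multivariateGaussian' {α : Type*} [Fintype α] [DecidableEq α] {S : Matrix α α ℝ}
    (hS : S.PosSemidef) (φ ψ : StrongDual ℝ (EuclideanSpace ℝ α)) :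
    moment (multivariateGaussian 0 S) φ ψ =
      ∑ i, ∑ j, φ (EuclideanSpace.single i 1) * S i j * ψ (EuclideanSpace.single j 1) := by
  conv_lhs => rw [dual_eq_sum_proj φ, dual_eq_sum_proj ψ]
  simp only [map_sum, map_smul, LinearMap.sum_apply, LinearMap.smul_apply, smul_eq_mul,
    moment_multivariateGaussian hS, Finset.mul_sum]
  rw [Finset.sum_comm]
  exact Finset.sum_congr rfl fun _ _ => Finset.sum_congr rfl fun _ _ => by ring

end ProductMoments

/-! ### Control-free states, measurements and signals as linear functionals. -/

section Functionals

/-- The Euclidean vector of the values of a family of linear functionals. -/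
def vec {W : Type*} [NormedAddCommGroup W] [NormedSpace ℝ W] {α : Type*}
    (X : α → StrongDual ℝ W) (w : W) : EuclideanSpace ℝ α := WithLp.toLp 2 fun i => X i w

@[simp] theorem vec_apply {W : Type*} [NormedAddCommGroup W] [NormedSpace ℝ W] {α : Type*}
    (X : α → StrongDual ℝ W) (w : W) (i : α) : vec X w i = X i w := rfl

@[simp] theorem act_apply {α β : Type*} [Fintype β] (M : Matrix α β ℝ) (x : EuclideanSpace ℝ β)
    (i : α) : act M x i = ∑ j, M i j * x j := rfl

theorem vec_lin {W : Type*} [NormedAddCommGroup W] [NormedSpace ℝ W] {α β : Type*} [Fintype β]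
    (M : Matrix α β ℝ) (X : β → StrongDual ℝ W) (w : W) :
    vec (lin M X) w = act M (vec X w) := by
  ext i
  simp [lin]

theorem vec_add {W : Type*} [NormedAddCommGroup W] [NormedSpace ℝ W] {α : Type*}
    (X Y : α → StrongDual ℝ W) (w : W) : vec (X + Y) w = vec X w + vec Y w := by
  ext i
  simp

variable {m r n κ : ℕ} {Ω : Type*} (M : Model m r n κ Ω) {ι : Fin κ → Type} [∀ k, Fintype (ι k)]

/-- The initial state as a family of linear functionals. -/
def initF (a : Fin m) : StrongDual ℝ (World m n ι) :=
  (EuclideanSpace.proj a : StrongDual ℝ (Vec m)).comp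
    ((ContinuousLinearMap.fst ℝ _ _).comp (ContinuousLinearMap.fst ℝ _ _))

/-- The state noise as a family of linear functionals. -/
def procF (k : Fin κ) (a : Fin m) : StrongDual ℝ (World m n ι) :=
  ((EuclideanSpace.proj a : StrongDual ℝ (Vec m)).comp
    (ContinuousLinearMap.proj (R := ℝ) (φ := fun _ : Fin κ => Vec m) k)).comp
    ((ContinuousLinearMap.fst ℝ _ _).comp
      ((ContinuousLinearMap.snd ℝ _ _).comp (ContinuousLinearMap.fst ℝ _ _)))

/-- The measurement noise as a family of linear functionals. -/
def measNoiseF (k : Fin κ) (a : Fin n) : StrongDual ℝ (World m n ι) :=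
  ((EuclideanSpace.proj a : StrongDual ℝ (Vec n)).comp
    (ContinuousLinearMap.proj (R := ℝ) (φ := fun _ : Fin κ => Vec n) k)).comp
    ((ContinuousLinearMap.snd ℝ _ _).comp
      ((ContinuousLinearMap.snd ℝ _ _).comp (ContinuousLinearMap.fst ℝ _ _)))

/-- The signaling noise as a family of linear functionals. -/
def sigNoiseF (k : Fin κ) (a : ι k) : StrongDual ℝ (World m n ι) :=
  (EuclideanSpace.proj (⟨k, a⟩ : Σ k, ι k) : StrongDual ℝ (EuclideanSpace ℝ (Σ k, ι k))).comp
    (ContinuousLinearMap.snd ℝ _ _)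

variable (ι) in
/-- The control-free states `x₀, …, x_κ` as linear functionals. -/
def Model.allStateF (k : Fin (κ + 1)) : Fin m → StrongDual ℝ (World m n ι) :=
  Fin.induction (motive := fun _ => Fin m → StrongDual ℝ (World m n ι)) initF
    (fun k X => lin M.A X + procF k) k

variable (ι) in
/-- The control-free states as linear functionals. -/
def Model.stateF (k : Fin κ) : Fin m → StrongDual ℝ (World m n ι) := M.allStateF ι k.castSucc

variable (ι) in
/-- The control-free measurements as linear functionals. -/
def Model.measF (k : Fin κ) : Fin n → StrongDual ℝ (World m n ι) :=
  lin M.C (M.stateF ι k) + measNoiseF k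

variable (ι) in
/-- The control-free augmented measurements as linear functionals. -/
def Model.histF (k : Fin κ) : Hist n k → StrongDual ℝ (World m n ι) :=
  fun p => M.measF ι p.1.1 p.2

/-- The control-free signals as linear functionals. -/
def Model.sigF (η : Rule n ι) (k : Fin κ) : ι k → StrongDual ℝ (World m n ι) :=
  lin (η.L k)ᵀ (M.histF ι k) + sigNoiseF k

theorem Model.state_zero (z : Prim m n κ) (u : Fin κ → Vec r) : M.state z u 0 = z.1 := rfl

theorem Model.state_succ (z : Prim m n κ) (u : Fin κ → Vec r) (k : Fin κ) :
    M.state z u k.succ = act M.A (M.state z u k.castSucc) + act M.B (u k) + z.2.1 k := rfl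

theorem act_zero {α β : Type*} [Fintype β] (M : Matrix α β ℝ) :
    act M (0 : EuclideanSpace ℝ β) = 0 := by
  ext i
  simp

theorem act_add {α β : Type*} [Fintype β] (M : Matrix α β ℝ) (x y : EuclideanSpace ℝ β) :
    act M (x + y) = act M x + act M y := by
  ext i
  simp [mul_add, Finset.sum_add_distrib]

omit [∀ k, Fintype (ι k)] in
theorem Model.allStateF_succ (k : Fin κ) :
    M.allStateF ι k.succ = lin M.A (M.allStateF ι k.castSucc) + procF k := rfl

theorem Model.vec_allStateF (z : World m n ι) (k : Fin (κ + 1)) :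
    vec (M.allStateF ι k) z = M.state z.1 0 k := by
  induction k using Fin.induction with
  | zero => rfl
  | succ k ih =>
    rw [M.allStateF_succ, vec_add, vec_lin, ih, M.state_succ, Pi.zero_apply, act_zero, add_zero]
    rfl

theorem Model.vec_stateF (z : World m n ι) (k : Fin κ) :
    vec (M.stateF ι k) z = M.freeState z.1 k := M.vec_allStateF z _

theorem Model.vec_measF (z : World m n ι) (k : Fin κ) :
    vec (M.measF ι k) z = M.meas z.1 0 k := by
  rw [Model.measF, vec_add, vec_lin, vec_stateF]
  rfl

theorem Model.vec_histF (z : World m n ι) (k : Fin κ) :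
    vec (M.histF ι k) z = M.freeHist z.1 k := by
  ext p
  have := congrArg (fun v => v p.2) (M.vec_measF z p.1.1)
  exact this

theorem Model.vec_sigF (η : Rule n ι) (z : World m n ι) (k : Fin κ) :
    vec (M.sigF η k) z = M.signal η z 0 k := by
  rw [Model.sigF, vec_add, vec_lin, vec_histF]
  rfl

end Functionals

/-! ### Covariances between noises, states, measurements and signals. -/

section Correlations

variable {m r n κ : ℕ} {Ω : Type*} (M : Model m r n κ Ω) {ι : Fin κ → Type} [∀ k, Fintype (ι k)]
  (η : Rule n ι)

/-- Second moments of the linear functionals under the joint law. -/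
abbrev Model.form : LinearMap.BilinForm ℝ (StrongDual ℝ (World m n ι)) := moment (M.law η)

theorem Model.form_psd : (M.form η).IsPosSemidef := moment_isPosSemidef _

open Classical in
theorem Model.form_eq (φ ψ : StrongDual ℝ (World m n ι)) :
    M.form η φ ψ =
      moment M.primLaw (φ.comp (ContinuousLinearMap.inl ℝ _ _))
        (ψ.comp (ContinuousLinearMap.inl ℝ _ _)) +
      moment (multivariateGaussian 0 η.T) (φ.comp (ContinuousLinearMap.inr ℝ (Prim m n κ) _))
        (ψ.comp (ContinuousLinearMap.inr ℝ (Prim m n κ) _)) :=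
  moment_prod (isCentered_primLaw M) φ ψ

theorem Model.moment_primLaw (φ ψ : StrongDual ℝ (Prim m n κ)) :
    moment M.primLaw φ ψ =
      moment (multivariateGaussian 0 M.cov₁) (φ.comp (ContinuousLinearMap.inl ℝ _ _))
        (ψ.comp (ContinuousLinearMap.inl ℝ _ _)) +
      (moment (Measure.pi fun _ : Fin κ => multivariateGaussian 0 M.covw)
        ((φ.comp (ContinuousLinearMap.inr ℝ (Vec m) _)).comp (ContinuousLinearMap.inl ℝ _ _))
        ((ψ.comp (ContinuousLinearMap.inr ℝ (Vec m) _)).comp (ContinuousLinearMap.inl ℝ _ _)) +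
      moment (Measure.pi fun _ : Fin κ => multivariateGaussian 0 M.covv)
        ((φ.comp (ContinuousLinearMap.inr ℝ (Vec m) _)).comp (ContinuousLinearMap.inr ℝ _ _))
        ((ψ.comp (ContinuousLinearMap.inr ℝ (Vec m) _)).comp
          (ContinuousLinearMap.inr ℝ _ _))) := by
  have h := moment_prod (μ := multivariateGaussian 0 M.cov₁)
    (ν := (Measure.pi fun _ : Fin κ => multivariateGaussian 0 M.covw).prod
      (Measure.pi fun _ : Fin κ => multivariateGaussian 0 M.covv))
    (isCentered_multivariateGaussian M.cov₁) φ ψ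
  rw [moment_prod (isCentered_multivariateGaussian M.covw).pi] at h
  exact h

-- These restrictions of the noise functionals to the factors of `World` leave at most one nonzero
-- term in the product formulas for their moments.
omit [∀ k, Fintype (ι k)] in
theorem initF_inr (a : Fin m) :
    (initF a : StrongDual ℝ (World m n ι)).comp (ContinuousLinearMap.inr ℝ _ _) = 0 :=
  ContinuousLinearMap.ext fun _ => rfl

omit [∀ k, Fintype (ι k)] in
theorem initF_inl_inl (a : Fin m) :
    ((initF a : StrongDual ℝ (World m n ι)).comp (ContinuousLinearMap.inl ℝ _ _)).comp
      (ContinuousLinearMap.inl ℝ _ _) = EuclideanSpace.proj a :=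
  ContinuousLinearMap.ext fun _ => rfl

omit [∀ k, Fintype (ι k)] in
theorem initF_inl_inr (a : Fin m) :
    ((initF a : StrongDual ℝ (World m n ι)).comp (ContinuousLinearMap.inl ℝ _ _)).comp
      (ContinuousLinearMap.inr ℝ _ _) = 0 :=
  ContinuousLinearMap.ext fun _ => rfl

omit [∀ k, Fintype (ι k)] in
theorem procF_inr (k : Fin κ) (a : Fin m) :
    (procF k a : StrongDual ℝ (World m n ι)).comp (ContinuousLinearMap.inr ℝ _ _) = 0 :=
  ContinuousLinearMap.ext fun _ => rfl

omit [∀ k, Fintype (ι k)] in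
theorem procF_inl_inl (k : Fin κ) (a : Fin m) :
    ((procF k a : StrongDual ℝ (World m n ι)).comp (ContinuousLinearMap.inl ℝ _ _)).comp
      (ContinuousLinearMap.inl ℝ _ _) = 0 :=
  ContinuousLinearMap.ext fun _ => rfl

omit [∀ k, Fintype (ι k)] in
theorem procF_inl_inr_inl (k : Fin κ) (a : Fin m) :
    (((procF k a : StrongDual ℝ (World m n ι)).comp (ContinuousLinearMap.inl ℝ _ _)).comp
      (ContinuousLinearMap.inr ℝ _ _)).comp (ContinuousLinearMap.inl ℝ _ _) =
      (EuclideanSpace.proj a : StrongDual ℝ (Vec m)).comp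
      (ContinuousLinearMap.proj (R := ℝ) (φ := fun _ : Fin κ => Vec m) k) :=
  ContinuousLinearMap.ext fun _ => rfl

omit [∀ k, Fintype (ι k)] in
theorem procF_inl_inr_inr (k : Fin κ) (a : Fin m) :
    (((procF k a : StrongDual ℝ (World m n ι)).comp (ContinuousLinearMap.inl ℝ _ _)).comp
      (ContinuousLinearMap.inr ℝ _ _)).comp (ContinuousLinearMap.inr ℝ _ _) = 0 :=
  ContinuousLinearMap.ext fun _ => rfl

omit [∀ k, Fintype (ι k)] in
theorem measNoiseF_inr (k : Fin κ) (c : Fin n) :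
    (measNoiseF k c : StrongDual ℝ (World m n ι)).comp (ContinuousLinearMap.inr ℝ _ _) = 0 :=
  ContinuousLinearMap.ext fun _ => rfl

omit [∀ k, Fintype (ι k)] in
theorem measNoiseF_inl_inr_inl (k : Fin κ) (c : Fin n) :
    (((measNoiseF k c : StrongDual ℝ (World m n ι)).comp (ContinuousLinearMap.inl ℝ _ _)).comp
      (ContinuousLinearMap.inr ℝ _ _)).comp (ContinuousLinearMap.inl ℝ _ _) = 0 :=
  ContinuousLinearMap.ext fun _ => rfl

omit [∀ k, Fintype (ι k)] in
theorem sigNoiseF_inl (k : Fin κ) (i : ι k) :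
    (sigNoiseF k i : StrongDual ℝ (World m n ι)).comp (ContinuousLinearMap.inl ℝ _ _) = 0 :=
  ContinuousLinearMap.ext fun _ => rfl

omit [∀ k, Fintype (ι k)] in
theorem sigNoiseF_inr (k : Fin κ) (i : ι k) :
    (sigNoiseF k i : StrongDual ℝ (World m n ι)).comp (ContinuousLinearMap.inr ℝ _ _) =
      (EuclideanSpace.proj (⟨k, i⟩ : Σ k, ι k) : StrongDual ℝ _) :=
  ContinuousLinearMap.ext fun _ => rfl

theorem Model.cross_init_init : cross (M.form η) initF initF = M.cov₁ := by
  ext a c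
  rw [cross_apply, M.form_eq, M.moment_primLaw, initF_inr, initF_inl_inl, initF_inl_inl,
    initF_inl_inr, moment_multivariateGaussian M.cov₁_psd]
  simp

theorem Model.cross_proc_init (k : Fin κ) : cross (M.form η) (procF k) initF = 0 := by
  ext a c
  rw [cross_apply, M.form_eq, M.moment_primLaw, initF_inr, initF_inl_inr, procF_inl_inl]
  simp

theorem Model.cross_proc_proc (k l : Fin κ) :
    cross (M.form η) (procF k) (procF l) = if k = l then M.covw else 0 := by
  ext a c
  rw [cross_apply, M.form_eq, M.moment_primLaw, procF_inr, procF_inl_inl, procF_inl_inr_inl,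
    procF_inl_inr_inl, procF_inl_inr_inr,
    moment_pi_eval (isCentered_multivariateGaussian M.covw),
    moment_multivariateGaussian M.covw_psd]
  split_ifs <;> simp

theorem Model.cross_proc_measNoise (k l : Fin κ) :
    cross (M.form η) (procF k) (measNoiseF l) = 0 := by
  ext a c
  rw [cross_apply, M.form_eq, M.moment_primLaw, procF_inr, procF_inl_inl,
    measNoiseF_inl_inr_inl, procF_inl_inr_inr]
  simp

theorem Model.cross_sigNoise_init (k : Fin κ) :
    cross (M.form η) (sigNoiseF k) initF = 0 := by
  ext a c
  rw [cross_apply, M.form_eq, sigNoiseF_inl, initF_inr]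
  simp

theorem Model.cross_sigNoise_proc (k l : Fin κ) :
    cross (M.form η) (sigNoiseF k) (procF l) = 0 := by
  ext a c
  rw [cross_apply, M.form_eq, sigNoiseF_inl, procF_inr]
  simp

theorem Model.cross_sigNoise_measNoise (k l : Fin κ) :
    cross (M.form η) (sigNoiseF k) (measNoiseF l) = 0 := by
  ext a c
  rw [cross_apply, M.form_eq, sigNoiseF_inl, measNoiseF_inr]
  simp

theorem Model.cross_sigNoise_sigNoise (k l : Fin κ) :
    cross (M.form η) (sigNoiseF k) (sigNoiseF l) =
      Matrix.of fun a c => η.T ⟨k, a⟩ ⟨l, c⟩ := by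
  classical
  ext a c
  rw [cross_apply, M.form_eq, sigNoiseF_inl, sigNoiseF_inr, sigNoiseF_inr,
    moment_multivariateGaussian η.T_psd]
  simp

/-- The state at stage `j` contains only the noises of stages before `j`. -/
theorem Model.cross_proc_allState (k : Fin κ) (j : Fin (κ + 1)) (hj : j ≤ k.castSucc) :
    cross (M.form η) (procF k) (M.allStateF ι j) = 0 := by
  induction j using Fin.induction with
  | zero => exact M.cross_proc_init η k
  | succ j ih =>
    have hjk : k ≠ j := by
      rintro rfl
      exact absurd hj (by simp [Fin.le_def])
    rw [M.allStateF_succ, cross_add_right, cross_lin_right,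
      ih ((Fin.le_def.2 (by simp)).trans hj), M.cross_proc_proc, if_neg hjk, Matrix.zero_mul,
      add_zero]

theorem Model.cross_proc_state {k j : Fin κ} (hj : j ≤ k) :
    cross (M.form η) (procF k) (M.stateF ι j) = 0 :=
  M.cross_proc_allState η k _ (by simpa using hj)

theorem Model.cross_proc_meas {k j : Fin κ} (hj : j ≤ k) :
    cross (M.form η) (procF k) (M.measF ι j) = 0 := by
  rw [Model.measF, cross_add_right, cross_lin_right, M.cross_proc_state η hj,
    M.cross_proc_measNoise, Matrix.zero_mul, add_zero]

theorem Model.cross_proc_hist {k j : Fin κ} (hj : j ≤ k) :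
    cross (M.form η) (procF k) (M.histF ι j) = 0 := by
  ext a p
  exact congrFun (congrFun (M.cross_proc_meas η (p.1.2.trans hj)) a) p.2

theorem Model.cross_sigNoise_allState (k : Fin κ) (j : Fin (κ + 1)) :
    cross (M.form η) (sigNoiseF k) (M.allStateF ι j) = 0 := by
  induction j using Fin.induction with
  | zero => exact M.cross_sigNoise_init η k
  | succ j ih =>
    rw [M.allStateF_succ, cross_add_right, cross_lin_right, ih, M.cross_sigNoise_proc,
      Matrix.zero_mul, add_zero]

theorem Model.cross_sigNoise_state (k j : Fin κ) :
    cross (M.form η) (sigNoiseF k) (M.stateF ι j) = 0 := M.cross_sigNoise_allState η k _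

theorem Model.cross_sigNoise_hist (k j : Fin κ) :
    cross (M.form η) (sigNoiseF k) (M.histF ι j) = 0 := by
  have h : ∀ j, cross (M.form η) (sigNoiseF k) (M.measF ι j) = 0 := by
    intro j
    rw [Model.measF, cross_add_right, cross_lin_right, M.cross_sigNoise_state,
      M.cross_sigNoise_measNoise, Matrix.zero_mul, add_zero]
  ext a p
  exact congrFun (congrFun (h p.1.1) a) p.2

theorem Model.cross_proc_sig {k j : Fin κ} (hj : j ≤ k) :
    cross (M.form η) (procF k) (M.sigF η j) = 0 := by
  rw [Model.sigF, cross_add_right, cross_lin_right, M.cross_proc_hist η hj, Matrix.zero_mul,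
    zero_add]
  exact cross_eq_zero_comm _ (M.form_psd η) (M.cross_sigNoise_proc η j k)

/-- Moments of functionals that ignore the signaling noise do not depend on the rule. Hence
`measMoment`, `D` and `trans`, defined without any rule, can be computed in the form of every rule.
-/
theorem Model.form_eq_integral_primLaw (φ ψ : StrongDual ℝ (World m n ι))
    {f g : Prim m n κ → ℝ} (hf : ∀ z, φ z = f z.1) (hg : ∀ z, ψ z = g z.1) :
    M.form η φ ψ = ∫ z, f z * g z ∂M.primLaw := by
  classical
  rw [moment_apply]
  simp_rw [hf, hg]
  exact (integral_fun_fst (μ := M.primLaw) (ν := multivariateGaussian 0 η.T)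
    fun z => f z * g z).trans (by simp)

theorem Model.stateF_apply (k : Fin κ) (a : Fin m) (z : World m n ι) :
    M.stateF ι k a z = M.freeState z.1 k a := congrArg (fun v => v a) (M.vec_stateF z k)

theorem Model.measF_apply (k : Fin κ) (a : Fin n) (z : World m n ι) :
    M.measF ι k a z = M.meas z.1 0 k a := congrArg (fun v => v a) (M.vec_measF z k)

theorem Model.histF_apply (k : Fin κ) (p : Hist n k) (z : World m n ι) :
    M.histF ι k p z = M.freeHist z.1 k p := congrArg (fun v => v p) (M.vec_histF z k)

theorem Model.sigF_apply (k : Fin κ) (a : ι k) (z : World m n ι) :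
    M.sigF η k a z = M.signal η z 0 k a := congrArg (fun v => v a) (M.vec_sigF η z k)

theorem Model.cross_state_state (k l : Fin κ) :
    cross (M.form η) (M.stateF ι k) (M.stateF ι l) = M.stateMoment k l := by
  ext a c
  exact M.form_eq_integral_primLaw η _ _ (M.stateF_apply k a) (M.stateF_apply l c)

theorem Model.cross_hist_hist (k : Fin κ) :
    cross (M.form η) (M.histF ι k) (M.histF ι k) = M.measMoment k := by
  ext a c
  exact M.form_eq_integral_primLaw η _ _ (M.histF_apply k a) (M.histF_apply k c)

theorem Model.D_eq (k : Fin κ) :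
    M.D k = cross (M.form η) (M.stateF ι k) (M.histF ι k) *
      pinv (cross (M.form η) (M.histF ι k) (M.histF ι k)) := by
  rw [Model.D, M.cross_hist_hist]
  congr 1
  ext a c
  exact (M.form_eq_integral_primLaw η _ _ (M.stateF_apply k a) (M.histF_apply k c)).symm

/-- The prediction of the measurements by the earlier ones. -/
theorem Model.trans_apply_new {j k : Fin κ} {p : Hist n k} (hp : ¬ p.1.1 ≤ j) (q : Hist n j) :
    M.trans j k p q = (cross (M.form η) (M.measF ι k) (M.histF ι j) *
      pinv (cross (M.form η) (M.histF ι j) (M.histF ι j))) p.2 q := by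
  rw [Model.trans, Matrix.of_apply, if_neg hp, M.cross_hist_hist]
  refine congrFun (congrFun (congrArg (· * _) ?_) _) _
  ext a c
  exact (M.form_eq_integral_primLaw η _ _ (M.measF_apply k a) (M.histF_apply j c)).symm

end Correlations

/-! ### Closed-loop information equals control-free information. -/

section ClosedLoop

variable {m r n κ : ℕ} {Ω : Type*} (M : Model m r n κ Ω) {ι : Fin κ → Type} [∀ k, Fintype (ι k)]
  (η : Rule n ι)

theorem Model.state_eq_add (z : Prim m n κ) (u : Fin κ → Vec r) (k : Fin (κ + 1)) :
    M.state z u k = M.state z 0 k + M.state 0 u k := by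
  induction k using Fin.induction with
  | zero => simp [Model.state_zero]
  | succ k ih =>
    rw [M.state_succ, M.state_succ, M.state_succ, ih, act_add]
    simp only [Pi.zero_apply, act_zero, Prod.snd_zero, Prod.fst_zero]
    abel

theorem Model.signal_eq_add (z : World m n ι) (u : Fin κ → Vec r) (k : Fin κ) :
    M.signal η z u k = M.signal η z 0 k + M.signal η 0 u k := by
  have h : M.measHist z.1 u k = M.measHist z.1 0 k + M.measHist 0 u k := by
    ext p
    simp only [Model.measHist, Model.meas, PiLp.add_apply]
    rw [M.state_eq_add z.1 u, act_add]
    simp only [Prod.snd_zero, Pi.zero_apply, PiLp.add_apply, PiLp.zero_apply]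
    ring
  ext a
  simp only [Model.signal, h, act_add, PiLp.add_apply, Prod.fst_zero, Prod.snd_zero,
    PiLp.zero_apply]
  ring

theorem measurable_act {α β : Type*} [Fintype α] [Fintype β] (N : Matrix α β ℝ) :
    Measurable (act N) := by
  refine (WithLp.measurable_toLp 2 _).comp (measurable_pi_lambda _ fun i => ?_)
  have h : (fun x : EuclideanSpace ℝ β => (N *ᵥ x.ofLp) i) = fun x => ∑ j, N i j * x j := rfl
  rw [h]
  fun_prop

theorem Model.measurable_state {X : Type*} [MeasurableSpace X] {z : X → Prim m n κ}
    (hz : Measurable z) {u : X → Fin κ → Vec r} (k : Fin (κ + 1))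
    (hu : ∀ j : Fin κ, j.val < k.val → Measurable fun x => u x j) :
    Measurable fun x => M.state (z x) (u x) k := by
  induction k using Fin.induction with
  | zero => exact hz.fst
  | succ k ih =>
    simp only [M.state_succ]
    refine (((measurable_act M.A).comp (ih fun j hj => hu j ?_)).add
      ((measurable_act M.B).comp (hu k ?_))).add ((measurable_pi_apply k).comp hz.snd.fst)
    · simp at hj ⊢
      omega
    · simp

theorem Model.measurable_signal {X : Type*} [MeasurableSpace X] {z : X → World m n ι}
    (hz : Measurable z) {u : X → Fin κ → Vec r} (k : Fin κ)
    (hu : ∀ j : Fin κ, j < k → Measurable fun x => u x j) :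
    Measurable fun x => M.signal η (z x) (u x) k := by
  have h1 : ∀ i : Fin κ, i ≤ k → Measurable fun x => M.meas (z x).1 (u x) i := fun i hi =>
    ((measurable_act M.C).comp (M.measurable_state hz.fst _ fun j hj => hu j
      (lt_of_lt_of_le (Fin.lt_def.2 (by simpa using hj)) hi))).add
      ((measurable_pi_apply i).comp hz.fst.snd.snd)
  have h2 : Measurable fun x => M.measHist (z x).1 (u x) k :=
    (WithLp.measurable_toLp 2 _).comp (measurable_pi_lambda _ fun p =>
      (EuclideanSpace.proj (𝕜 := ℝ) p.2).continuous.measurable.comp (h1 p.1.1 p.1.2))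
  have h3 : Measurable fun x => (WithLp.toLp 2 fun a => (z x).2 ⟨k, a⟩ :
      EuclideanSpace ℝ (ι k)) :=
    (WithLp.measurable_toLp 2 _).comp (measurable_pi_lambda _ fun a =>
      (EuclideanSpace.proj (𝕜 := ℝ) (⟨k, a⟩ : Σ k, ι k)).continuous.measurable.comp hz.snd)
  exact ((measurable_act (η.L k)ᵀ).comp h2).add h3

/-- The control inputs before stage `j`. -/
def trunc (u : Fin κ → Vec r) (j : Fin κ) : Fin κ → Vec r := fun l => if l < j then u l else 0

/-- The truncation shows that the shift of the signal at stage `j` depends only on strictly earlier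
inputs, as the induction over stages requires. -/
theorem Model.signal_eq_add_trunc (z : World m n ι) (u : Fin κ → Vec r) (j : Fin κ) :
    M.signal η z u j = M.signal η z 0 j + M.signal η 0 (trunc u j) j := by
  rw [M.signal_eq_add η z u]
  congr 1
  exact M.signal_congr η 0 j fun i hi => by simp [trunc, hi]

theorem Model.measurable_trunc {X : Type*} [MeasurableSpace X] {u : X → Fin κ → Vec r} {j : Fin κ}
    (h : ∀ l, l < j → Measurable fun x => u x l) :
    Measurable fun x => M.signal η 0 (trunc (u x) j) j := by
  refine M.measurable_signal η measurable_const j fun l hl => ?_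
  simpa only [trunc, hl, if_true] using h l hl

theorem measurable_comap_apply {X J : Type*} {β : J → Type*} [∀ j, MeasurableSpace (β j)]
    (f : X → ∀ j, β j) (j : J) :
    Measurable[MeasurableSpace.comap f inferInstance] fun x => f x j :=
  (measurable_pi_apply j).comp (comap_measurable f)

/-- The signals of the closed loop carry the information of the control-free signals. -/
theorem Model.info_eq_comap_free (γ : Policy r ι) (k : Fin κ) :
    M.info η γ k = MeasurableSpace.comap
      (fun z => fun j : {j : Fin κ // j ≤ k} => M.signal η z 0 j) inferInstance := by
  apply le_antisymm
  · set I0 := MeasurableSpace.comap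
      (fun z : World m n ι => fun j : {j : Fin κ // j ≤ k} => M.signal η z 0 j) inferInstance
      with hI0
    have hfree : ∀ j, j ≤ k → Measurable[I0] fun z => M.signal η z 0 j := fun j hj =>
      measurable_comap_apply (fun (z : World m n ι) (j : {j : Fin κ // j ≤ k}) =>
        M.signal η z 0 j) ⟨j, hj⟩
    -- Induction over stages: a closed-loop signal is the free signal plus a function of earlier
    -- inputs, and those inputs are functions of earlier closed-loop signals.
    have key : ∀ (t : ℕ) (j : Fin κ), j.val < t → j ≤ k →
        Measurable[I0] fun z => M.signal η z (M.control η γ z) j := by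
      intro t
      induction t with
      | zero => intro j hj; omega
      | succ t ih =>
        intro j hj hjk
        simp only [M.signal_eq_add_trunc η _ (M.control η γ _)]
        refine Measurable.add (hfree j hjk) (@Model.measurable_trunc m r n κ Ω M ι _ η _ I0
          _ j fun l hl => ?_)
        simp only [M.control_eq η γ]
        refine (γ.meas l).comp (@measurable_pi_lambda _ _ _ I0 _ _ fun i => ?_)
        have h1 : i.1.val < j.val := lt_of_le_of_lt (Fin.le_def.1 i.2) (Fin.lt_def.1 hl)
        exact ih i.1 (by omega) ((Fin.le_def.2 h1.le).trans hjk)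
    exact (@measurable_pi_lambda _ _ _ I0 _ _ fun j : {j : Fin κ // j ≤ k} =>
      key κ j.1 j.1.2 j.2).comap_le
  · set I := M.info η γ k with hI
    have hcl : ∀ j, j ≤ k → Measurable[I] fun z => M.signal η z (M.control η γ z) j :=
      fun j hj => measurable_comap_apply (fun (z : World m n ι) (j : {j : Fin κ // j ≤ k}) =>
        M.signal η z (M.control η γ z) j) ⟨j, hj⟩
    refine (@measurable_pi_lambda _ _ _ I _ _ fun j : {j : Fin κ // j ≤ k} => ?_).comap_le
    -- The converse needs no induction: the inputs to be subtracted are explicit functions of the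
    -- closed-loop signals.
    have h1 : (fun z => M.signal η z 0 j) = fun z => M.signal η z (M.control η γ z) j -
        M.signal η 0 (trunc (M.control η γ z) j) j := by
      funext z
      rw [M.signal_eq_add_trunc η z (M.control η γ z), add_sub_cancel_right]
    rw [h1]
    refine Measurable.sub (hcl j j.2) (@Model.measurable_trunc m r n κ Ω M ι _ η _ I
      _ j fun l hl => ?_)
    simp only [M.control_eq η γ]
    refine (γ.meas l).comp (@measurable_pi_lambda _ _ _ I _ _ fun i => ?_)
    exact hcl i.1 ((i.2.trans hl.le).trans j.2)

/-- The control-free signals of the first `t` stages as one family of functionals. -/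
abbrev Model.sigFam (t : ℕ) :
    (Σ j : {j : Fin κ // j.val < t}, ι j.1) → StrongDual ℝ (World m n ι) :=
  fun p => M.sigF η p.1.1 p.2

/-- The right-hand side does not mention `γ` and is generated by finitely many linear functionals,
so conditioning becomes projection. -/
theorem Model.info_eq (γ : Policy r ι) (k : Fin κ) :
    M.info η γ k = dualInfo (M.sigFam η (k.val + 1)) := by
  rw [M.info_eq_comap_free]
  apply le_antisymm
  · refine (@measurable_pi_lambda _ _ _ (dualInfo (M.sigFam η (k.val + 1))) _ _
      fun j : {j : Fin κ // j ≤ k} => ?_).comap_le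
    refine (WithLp.measurable_toLp 2 _).comp (@measurable_pi_lambda _ _ _
      (dualInfo (M.sigFam η (k.val + 1))) _ (fun z a => M.signal η z 0 j a) fun a => ?_)
    have h := measurable_dualInfo (M.sigFam η (k.val + 1)) (Submodule.subset_span
      ⟨⟨⟨j.1, Nat.lt_succ_of_le (Fin.le_def.1 j.2)⟩, a⟩, rfl⟩)
    have h2 : (fun z => M.signal η z 0 j a) = M.sigF η j a := by
      funext z
      exact (M.sigF_apply η j a z).symm
    rw [h2]
    exact h
  · set I0 := MeasurableSpace.comap
      (fun z : World m n ι => fun j : {j : Fin κ // j ≤ k} => M.signal η z 0 j) inferInstance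
      with hI0
    refine (@measurable_pi_lambda _ _ _ I0 _ (fun w p => M.sigFam η (k.val + 1) p w)
      fun p => ?_).comap_le
    have hfree : ∀ j, j ≤ k → Measurable[I0] fun z => M.signal η z 0 j := fun j hj =>
      measurable_comap_apply (fun (z : World m n ι) (j : {j : Fin κ // j ≤ k}) =>
        M.signal η z 0 j) ⟨j, hj⟩
    have h2 : (fun z => M.signal η z 0 p.1.1 p.2) = M.sigF η p.1.1 p.2 := by
      funext z
      exact (M.sigF_apply η _ _ z).symm
    change Measurable[I0] (M.sigF η p.1.1 p.2)
    rw [← h2]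
    exact (EuclideanSpace.proj (𝕜 := ℝ) p.2).continuous.measurable.comp
      (hfree p.1.1 (Fin.le_def.2 (Nat.le_of_lt_succ p.1.2)))

theorem Model.posteriorCov_policy (γ γ' : Policy r ι) :
    M.posteriorCov η γ = M.posteriorCov η γ' := by
  unfold Model.posteriorCov
  simp only [M.info_eq]

/-- Coordinates of a conditional expectation given the signals are projections. -/
theorem Model.condExp_ae_eq (γ : Policy r ι) (k : Fin κ) {α : Type*} [Fintype α]
    {X Xh : α → StrongDual ℝ (World m n ι)}
    (h : IsProj (M.form η) (sigSpan (M.sigF η) (k.val + 1)) X Xh) :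
    (M.law η)[vec X | M.info η γ k] =ᵐ[M.law η] vec Xh := by
  have h1 : ∀ i, (fun z => ((M.law η)[vec X | M.info η γ k]) z i) =ᵐ[M.law η] Xh i := by
    intro i
    have hint : Integrable (vec X) (M.law η) := by
      rw [← memLp_one_iff_integrable]
      refine MemLp.of_eval_piLp fun i => ?_
      exact IsGaussian.memLp_dual _ (X i) 1 (by simp)
    have h2 := (EuclideanSpace.proj (𝕜 := ℝ) i : EuclideanSpace ℝ α →L[ℝ] ℝ).comp_condExp_comm
      (m := M.info η γ k) hint
    refine h2.trans ?_
    rw [M.info_eq]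
    exact condExp_dual (isCentered_law M η) _ (h.mem i) (h.perp i)
  have h3 := ae_all_iff.2 h1
  filter_upwards [h3] with z hz
  ext i
  exact hz i

theorem covariance_congr_ae {X : Type*} [MeasurableSpace X] {μ : Measure X} {f f' g g' : X → ℝ}
    (hf : f =ᵐ[μ] f') (hg : g =ᵐ[μ] g') : cov[f, g; μ] = cov[f', g'; μ] := by
  unfold covariance
  rw [integral_congr_ae hf, integral_congr_ae hg]
  refine integral_congr_ae ?_
  filter_upwards [hf, hg] with x h1 h2
  rw [h1, h2]

theorem Model.posteriorCov_eq (γ : Policy r ι) (k : Fin κ)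
    {Yh : Hist n k → StrongDual ℝ (World m n ι)}
    (h : IsProj (M.form η) (sigSpan (M.sigF η) (k.val + 1)) (M.histF ι k) Yh) :
    M.posteriorCov η γ k = cross (M.form η) Yh Yh := by
  have h1 := M.condExp_ae_eq η γ k h
  have h2 : vec (M.histF ι k) = fun z : World m n ι => M.freeHist z.1 k := by
    funext z
    exact M.vec_histF z k
  rw [h2] at h1
  have h3 : ∀ p, (fun z => ((M.law η)[fun z => M.freeHist z.1 k | M.info η γ k]) z p)
      =ᵐ[M.law η] Yh p := by
    intro p
    filter_upwards [h1] with z hz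
    rw [hz]
    rfl
  ext p q
  rw [Model.posteriorCov, Matrix.of_apply, covariance_congr_ae (h3 p) (h3 q),
    covariance_eq_moment (isCentered_law M η)]
  rfl

end ClosedLoop

/-! ### Predictions of states and measurements, and necessity of the constraints. -/

section Predictions

variable {m r n κ : ℕ} {Ω : Type*} (M : Model m r n κ Ω) {ι : Fin κ → Type} [∀ k, Fintype (ι k)]
  (η : Rule n ι)

theorem Model.cross_hist_eq_zero_of_le {α : Type*} {X : α → StrongDual ℝ (World m n ι)}
    {k l : Fin κ} (hl : l ≤ k) (h : cross (M.form η) X (M.histF ι k) = 0) :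
    cross (M.form η) X (M.histF ι l) = 0 := by
  ext i p
  exact congrFun (congrFun h i) (⟨p.1.1, p.1.2.trans hl⟩, p.2)

/-- Signals are combinations of measurements and signaling noise, so orthogonality may be tested on
these two separately. -/
theorem Model.perp_sigSpan_of_cross {α : Type*} {X : α → StrongDual ℝ (World m n ι)} {t : ℕ}
    (hY : ∀ l : Fin κ, l.val < t → cross (M.form η) X (M.histF ι l) = 0)
    (hΘ : ∀ l : Fin κ, cross (M.form η) (sigNoiseF l) X = 0) :
    Perp (M.form η) X (sigSpan (M.sigF η) t) := by
  refine perp_sigSpan fun l hl => ?_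
  rw [Model.sigF, cross_add_right, cross_lin_right, hY l hl, Matrix.zero_mul, zero_add]
  exact cross_eq_zero_comm _ (M.form_psd η) (hΘ l)

theorem Model.cross_state_residual (k : Fin κ) :
    cross (M.form η) (M.stateF ι k - lin (M.D k) (M.histF ι k)) (M.histF ι k) = 0 := by
  rw [cross_sub_left, cross_lin_left, M.D_eq η, cross_mul_pinv_mul _ (M.form_psd η), sub_self]

theorem Model.cross_sigNoise_lin_hist {α : Type*} (k l : Fin κ) (N : Matrix α (Hist n k) ℝ) :
    cross (M.form η) (sigNoiseF l) (lin N (M.histF ι k)) = 0 := by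
  rw [cross_lin_right, M.cross_sigNoise_hist, Matrix.zero_mul]

/-- The projection of the state is the projection of the measurements multiplied by `D`. -/
theorem Model.isProj_state (k : Fin κ) {Yh : Hist n k → StrongDual ℝ (World m n ι)}
    (h : IsProj (M.form η) (sigSpan (M.sigF η) (k.val + 1)) (M.histF ι k) Yh) :
    IsProj (M.form η) (sigSpan (M.sigF η) (k.val + 1)) (M.stateF ι k) (lin (M.D k) Yh) := by
  refine (h.lin (M.D k)).of_perp (M.perp_sigSpan_of_cross η (fun l hl => ?_) fun l => ?_)
  · exact M.cross_hist_eq_zero_of_le η (Fin.le_def.2 (Nat.le_of_lt_succ hl))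
      (M.cross_state_residual η k)
  · rw [cross_sub_right, M.cross_sigNoise_state, M.cross_sigNoise_lin_hist, sub_zero]

theorem prevStage_lt {k : Fin κ} (hk : k.val ≠ 0) : prevStage k < k :=
  Fin.lt_def.2 (by simp [prevStage]; omega)

theorem le_prevStage {k l : Fin κ} (h : l < k) : l ≤ prevStage k :=
  Fin.le_def.2 (by have := Fin.lt_def.1 h; simp [prevStage]; omega)

theorem Model.cross_trans_residual {k : Fin κ} (hk : k.val ≠ 0) :
    cross (M.form η) (M.histF ι k - lin (M.trans (prevStage k) k) (M.histF ι (prevStage k)))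
      (M.histF ι (prevStage k)) = 0 := by
  set j := prevStage k with hj
  have hjk := prevStage_lt hk
  ext p q
  rw [cross_sub_left, cross_lin_left, Matrix.sub_apply, Matrix.zero_apply, sub_eq_zero]
  -- Rows of old measurements are copied, with residual zero. Since `j` is the stage just before
  -- `k`, every other row belongs to stage `k`, where the normal equations apply.
  by_cases hp : p.1.1 ≤ j
  · have h1 : ∀ i : Hist n j, M.trans j k p i = if (⟨p.1.1, hp⟩, p.2) = i then 1 else 0 := by
      intro i
      rw [Model.trans, Matrix.of_apply, if_pos hp]
      simp [Prod.ext_iff, Subtype.ext_iff]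
    simp only [Matrix.mul_apply, h1, ite_mul, one_mul, zero_mul, Finset.sum_ite_eq,
      Finset.mem_univ, if_true]
    rfl
  · have hpk : p.1.1 = k := by
      by_contra h
      exact hp (le_prevStage (lt_of_le_of_ne p.1.2 h))
    have h2 := cross_mul_pinv_mul (M.form η) (M.form_psd η) (M.measF ι k) (M.histF ι j)
    have h3 := congrFun (congrFun h2 p.2) q
    rw [Matrix.mul_apply] at h3 ⊢
    simp only [M.trans_apply_new η hp]
    rw [h3]
    change (M.form η) (M.measF ι p.1.1 p.2) _ = (M.form η) (M.measF ι k p.2) _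
    rw [hpk]

theorem Model.isProj_trans {k : Fin κ} (hk : k.val ≠ 0)
    {Yh : Hist n (prevStage k) → StrongDual ℝ (World m n ι)}
    (h : IsProj (M.form η) (sigSpan (M.sigF η) k.val) (M.histF ι (prevStage k)) Yh) :
    IsProj (M.form η) (sigSpan (M.sigF η) k.val) (M.histF ι k)
      (lin (M.trans (prevStage k) k) Yh) := by
  refine (h.lin _).of_perp (M.perp_sigSpan_of_cross η (fun l hl => ?_) fun l => ?_)
  · exact M.cross_hist_eq_zero_of_le η (le_prevStage (Fin.lt_def.2 hl))
      (M.cross_trans_residual η hk)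
  · rw [cross_sub_right, M.cross_sigNoise_hist, M.cross_sigNoise_lin_hist, sub_zero]

theorem Model.exists_isProj_hist (k : Fin κ) :
    ∃ Yh, IsProj (M.form η) (sigSpan (M.sigF η) (k.val + 1)) (M.histF ι k) Yh :=
  exists_isProj_sigSpan (M.form_psd η) _ _ _

theorem prevStage_succ {k : Fin κ} (hk : k.val ≠ 0) : (prevStage k).val + 1 = k.val := by
  simp [prevStage]
  omega

/-- All three matrices are Gram matrices: of the posterior, of its residual, and of the change of
the posterior caused by the newest signal. -/
theorem Model.posteriorCov_mem_feasible (γ : Policy r ι) : M.posteriorCov η γ ∈ M.feasible := by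
  intro k
  obtain ⟨Yh, hY⟩ := M.exists_isProj_hist η k
  rw [M.posteriorCov_eq η γ k hY]
  refine ⟨cross_posSemidef _ (M.form_psd η) _, ?_, ?_⟩
  · rw [← M.cross_hist_hist η, ← hY.cross_residual (M.form_psd η)]
    exact cross_posSemidef _ (M.form_psd η) _
  · by_cases hk : k.val = 0
    · rw [Model.prior, if_pos hk, sub_zero]
      exact cross_posSemidef _ (M.form_psd η) _
    · obtain ⟨Yp, hYp⟩ := M.exists_isProj_hist η (prevStage k)
      rw [Model.prior, if_neg hk, M.posteriorCov_eq η γ _ hYp, Matrix.mul_assoc]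
      rw [prevStage_succ hk] at hYp
      have h1 := M.isProj_trans η hk hYp
      -- Tower property: the prediction from earlier signals is also the projection of the current
      -- posterior. Pythagoras then gives the last constraint.
      have h2 : IsProj (M.form η) (sigSpan (M.sigF η) k.val) Yh
          (lin (M.trans (prevStage k) k) Yp) := by
        refine h1.of_perp ?_
        intro p u hu
        have h3 := hY.perp p u (sigSpan_mono (M.sigF η) (Nat.le_succ k.val) hu)
        rw [Pi.sub_apply, map_sub, LinearMap.sub_apply] at h3 ⊢
        linarith
      have h5 := h2.cross_residual (M.form_psd η)
      rw [cross_lin_left _ (M.trans (prevStage k) k), cross_lin_right] at h5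
      rw [← h5]
      exact cross_posSemidef _ (M.form_psd η) _

/-- Prediction of the filtered state by the earlier one. -/
theorem Model.cross_filter_residual {k : Fin κ} (hk : k.val ≠ 0) {l : Fin κ} (hl : l < k) :
    cross (M.form η) (lin (M.D k) (M.histF ι k) -
      lin M.A (lin (M.D (prevStage k)) (M.histF ι (prevStage k)))) (M.histF ι l) = 0 := by
  have h1 := M.cross_hist_eq_zero_of_le η hl.le (M.cross_state_residual η k)
  have h2 := M.cross_hist_eq_zero_of_le η (le_prevStage hl)
    (M.cross_state_residual η (prevStage k))
  have h3 : M.stateF ι k = lin M.A (M.stateF ι (prevStage k)) + procF (prevStage k) := by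
    have h4 := M.allStateF_succ (ι := ι) (prevStage k)
    have h5 : (prevStage k).succ = k.castSucc := by
      ext
      simpa using prevStage_succ hk
    rw [h5] at h4
    exact h4
  have h6 := M.cross_proc_hist η (le_prevStage hl)
  rw [cross_sub_left, sub_eq_zero] at h1 h2
  rw [cross_sub_left, ← h1, cross_lin_left, ← h2, h3, cross_add_left, h6, cross_lin_left, add_zero,
    sub_self]

end Predictions

/-! ### Signals that realize prescribed posterior covariances. -/

section Targets

variable {m r n κ : ℕ} {Ω : Type*} (M : Model m r n κ Ω) {ι : Fin κ → Type} [∀ k, Fintype (ι k)]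
  (η : Rule n ι)

theorem Model.trace_mul_W (ω : Option Ω) (k : Fin κ) (S : Matrix (Hist n k) (Hist n k) ℝ) :
    (S * M.W ω k).trace = (M.Xi ω k * (M.D k * S * (M.D k)ᵀ)).trace := by
  rw [Model.W, Matrix.trace_mul_comm (M.Xi ω k), ← Matrix.mul_assoc, Matrix.trace_mul_comm]
  simp only [Matrix.mul_assoc]

/-- Only `D_k S_k D_k'`, the covariance of the posterior of the state, matters. This is why signals
in `ℝᵐ` suffice. -/
theorem Model.sdpObjective_congr [Fintype Ω] {S S' : ∀ k : Fin κ, Matrix (Hist n k) (Hist n k) ℝ}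
    (h : ∀ k, M.D k * S k * (M.D k)ᵀ = M.D k * S' k * (M.D k)ᵀ) :
    M.sdpObjective S = M.sdpObjective S' := by
  simp only [Model.sdpObjective, M.trace_mul_W, h]

theorem Model.D_mul_posteriorCov (γ : Policy r ι) (k : Fin κ)
    {Xh : Fin m → StrongDual ℝ (World m n ι)}
    (h : IsProj (M.form η) (sigSpan (M.sigF η) (k.val + 1)) (M.stateF ι k) Xh) :
    M.D k * M.posteriorCov η γ k * (M.D k)ᵀ = cross (M.form η) Xh Xh := by
  obtain ⟨Yh, hY⟩ := M.exists_isProj_hist η k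
  rw [M.posteriorCov_eq η γ k hY, h.cross_eq (M.form_psd η) (M.isProj_state η k hY),
    cross_lin_left, cross_lin_right, Matrix.mul_assoc]

/-- Both `D_k A_k` and `A D_{k-1}` predict the state from the earlier measurements, so they agree on
the range of `Σʸ_{k-1}`. That range contains the range of `S`, since `0 ⪯ S ⪯ Σʸ_{k-1}`. -/
theorem Model.D_trans_mul {k : Fin κ} (hk : k.val ≠ 0)
    {S : Matrix (Hist n (prevStage k)) (Hist n (prevStage k)) ℝ} (hS : S.PosSemidef)
    (hS' : (M.measMoment (prevStage k) - S).PosSemidef) :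
    M.D k * M.trans (prevStage k) k * S = M.A * M.D (prevStage k) * S := by
  -- The trivial rule only provides a form in which to compute; the claim does not involve any rule.
  let η : StateRule m n κ := ⟨0, 0, Matrix.PosSemidef.zero⟩
  set Y := M.histF (fun _ : Fin κ => Fin m) with hY
  have h1 : cross (M.form η) (lin (M.D k) (Y k) -
      lin (M.D k) (lin (M.trans (prevStage k) k) (Y (prevStage k)))) (Y (prevStage k))
      = 0 := by
    rw [← lin_sub_right, cross_lin_left, M.cross_trans_residual η hk, Matrix.mul_zero]
  have h2 := M.cross_filter_residual η hk (prevStage_lt hk)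
  rw [cross_sub_left, sub_eq_zero, ← lin_mul, cross_lin_left, cross_lin_left,
    M.cross_hist_hist] at h1
  rw [cross_sub_left, sub_eq_zero, ← lin_mul, cross_lin_left, cross_lin_left,
    M.cross_hist_hist] at h2
  have h3 : (M.D k * M.trans (prevStage k) k - M.A * M.D (prevStage k)) *
      M.measMoment (prevStage k) = 0 := by
    rw [Matrix.sub_mul, sub_eq_zero, ← h1]
    exact h2
  have hsymm : (M.measMoment (prevStage k))ᵀ = M.measMoment (prevStage k) := by
    rw [← M.cross_hist_hist η, cross_transpose _ (M.form_psd η)]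
  have h4 : M.measMoment (prevStage k) *
      (M.D k * M.trans (prevStage k) k - M.A * M.D (prevStage k))ᵀ = 0 := by
    rw [← hsymm, ← Matrix.transpose_mul, h3, Matrix.transpose_zero]
  have h5 := congrArg Matrix.transpose (mul_eq_zero_of_posSemidef_sub hS hS' h4)
  have hSt : Sᵀ = S := hS.1
  rw [Matrix.transpose_mul, Matrix.transpose_transpose, hSt, Matrix.transpose_zero,
    Matrix.sub_mul, sub_eq_zero] at h5
  exact h5

/-- The targets `D_k S_k D_k'` obey the prior recursion of a system of dimension `m` with transition
`A`. -/
theorem Model.D_mul_prior {S : ∀ k : Fin κ, Matrix (Hist n k) (Hist n k) ℝ} (hS : S ∈ M.feasible)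
    (k : Fin κ) :
    M.D k * M.prior S k * (M.D k)ᵀ = if k.val = 0 then 0 else
      M.A * (M.D (prevStage k) * S (prevStage k) * (M.D (prevStage k))ᵀ) * M.Aᵀ := by
  unfold Model.prior
  split_ifs with hk
  · simp
  · have h1 := M.D_trans_mul hk (hS (prevStage k)).1 (hS (prevStage k)).2.1
    have hSt : (S (prevStage k))ᵀ = S (prevStage k) := (hS (prevStage k)).1.1
    have h2 := congrArg Matrix.transpose h1
    simp only [Matrix.transpose_mul, hSt] at h2
    calc _ = (M.D k * M.trans (prevStage k) k * S (prevStage k)) *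
          ((M.trans (prevStage k) k)ᵀ * (M.D k)ᵀ) := by
          simp only [Matrix.mul_assoc]
      _ = M.A * M.D (prevStage k) * (S (prevStage k) *
          ((M.trans (prevStage k) k)ᵀ * (M.D k)ᵀ)) := by
          rw [h1]
          simp only [Matrix.mul_assoc]
      _ = _ := by
          rw [h2]
          simp only [Matrix.mul_assoc]

theorem blockDiagonal'_posSemidef {o : Type*} [Fintype o] [DecidableEq o] {α : o → Type*}
    [∀ i, Fintype (α i)] {T : ∀ i, Matrix (α i) (α i) ℝ} (h : ∀ i, (T i).PosSemidef) :
    (Matrix.blockDiagonal' T).PosSemidef := by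
  refine Matrix.PosSemidef.of_dotProduct_mulVec_nonneg ?_ fun v => ?_
  · rw [Matrix.IsHermitian, Matrix.blockDiagonal'_conjTranspose]
    congr 1
    funext i
    exact (h i).1
  · have h1 : star v ⬝ᵥ (Matrix.blockDiagonal' T *ᵥ v) =
        ∑ i, star (fun a => v ⟨i, a⟩) ⬝ᵥ (T i *ᵥ fun a => v ⟨i, a⟩) := by
      simp only [dotProduct, Matrix.mulVec, Fintype.sum_sigma]
      refine Finset.sum_congr rfl fun i _ => Finset.sum_congr rfl fun a _ => ?_
      congr 1
      rw [Finset.sum_eq_single i]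
      · simp only [Matrix.blockDiagonal'_apply_eq]
      · intro j _ hj
        simp [Matrix.blockDiagonal'_apply_ne T _ _ hj.symm]
      · simp
    rw [h1]
    exact Finset.sum_nonneg fun i _ => (h i).dotProduct_mulVec_nonneg _

/-- Every feasible family of posterior covariances of the state is attained by signals of the
dimension of the state with independent noises. -/
theorem Model.exists_stateRule {S : ∀ k : Fin κ, Matrix (Hist n k) (Hist n k) ℝ}
    (hS : S ∈ M.feasible) :
    ∃ η : StateRule m n κ, η.IndepNoise ∧ ∀ (γ : Policy r (fun _ : Fin κ => Fin m)) k,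
      M.D k * M.posteriorCov η γ k * (M.D k)ᵀ = M.D k * S k * (M.D k)ᵀ := by
  have psd : ∀ (k : Fin κ) {X : Matrix (Hist n k) (Hist n k) ℝ}, X.PosSemidef →
      (M.D k * X * (M.D k)ᵀ).PosSemidef := fun k X hX => by
    simpa [Matrix.conjTranspose_eq_transpose_of_trivial] using
      hX.mul_mul_conjTranspose_same (M.D k)
  have hE : ∀ k, (M.measMoment k - M.prior S k).PosSemidef := fun k => by
    simpa using (hS k).2.1.add (hS k).2.2
  have hdesign : ∀ k : Fin κ, ∃ L T : Matrix (Fin m) (Fin m) ℝ, T.PosSemidef ∧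
      IsDesign (M.D k * (M.measMoment k - M.prior S k) * (M.D k)ᵀ)
        (M.D k * (S k - M.prior S k) * (M.D k)ᵀ) L T := fun k => by
    refine exists_isDesign (psd k (hE k)) (psd k (hS k).2.2) ?_
    rw [← Matrix.sub_mul, ← Matrix.mul_sub, sub_sub_sub_cancel_right]
    exact psd k (hS k).2.1
  choose L T hT hLT using hdesign
  -- The gain factors through `D_k`, so the signal is a noisy linear image of the filtered state
  -- `D_k y_{≤k}`.
  let η : StateRule m n κ := ⟨fun k => (M.D k)ᵀ * L k, Matrix.blockDiagonal' T,
    blockDiagonal'_posSemidef hT⟩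
  have hind : η.IndepNoise := fun k l a b hkl => Matrix.blockDiagonal'_apply_ne T a b hkl
  refine ⟨η, hind, fun γ k => ?_⟩
  set a : ∀ k : Fin κ, Fin m → StrongDual ℝ (World m n fun _ : Fin κ => Fin m) :=
    fun k => lin (M.D k) (M.histF _ k) with ha
  have haa : ∀ k, cross (M.form η) (a k) (a k) = M.D k * M.measMoment k * (M.D k)ᵀ := fun k => by
    rw [ha, cross_lin_left, cross_lin_right, M.cross_hist_hist, Matrix.mul_assoc]
  have hs : (fun k => lin (L k)ᵀ (a k) +
      sigNoiseF (m := m) (n := n) (ι := fun _ : Fin κ => Fin m) k) = M.sigF η := by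
    funext k
    rw [Model.sigF, ha, ← lin_mul, Matrix.transpose_mul, Matrix.transpose_transpose]
  have key := exists_isProj_cross_eq (M.form_psd η) a
    (sigNoiseF (m := m) (n := n) (ι := fun _ : Fin κ => Fin m)) (fun k => (L k)ᵀ)
    (fun _ => M.A) (fun k => M.D k * S k * (M.D k)ᵀ) (fun k => M.D k * M.prior S k * (M.D k)ᵀ)
    (M.D_mul_prior hS)
    (fun k l hkl => by
      rw [M.cross_sigNoise_sigNoise]
      ext a b
      exact hind k l a b hkl)
    (fun k l => M.cross_sigNoise_lin_hist η l k _)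
    (fun k hk l hl => by
      rw [ha, cross_lin_right, M.cross_filter_residual η hk hl, Matrix.zero_mul])
    (fun k => by
      have h1 : cross (M.form η) (sigNoiseF k) (sigNoiseF k) = T k := by
        rw [M.cross_sigNoise_sigNoise]
        ext a b
        exact Matrix.blockDiagonal'_apply_eq T k a b
      have h2 : M.D k * S k * (M.D k)ᵀ - M.D k * M.prior S k * (M.D k)ᵀ =
          M.D k * (S k - M.prior S k) * (M.D k)ᵀ := by
        rw [Matrix.mul_sub, Matrix.sub_mul]
      have h3 : M.D k * M.measMoment k * (M.D k)ᵀ - M.D k * M.prior S k * (M.D k)ᵀ =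
          M.D k * (M.measMoment k - M.prior S k) * (M.D k)ᵀ := by
        rw [Matrix.mul_sub, Matrix.sub_mul]
      rw [h1, haa, h2, h3, Matrix.transpose_transpose]
      refine (hLT k).exists_gain (psd k (hS k).2.2) ?_
      rw [← Matrix.sub_mul, ← Matrix.mul_sub, sub_sub_sub_cancel_right]
      exact psd k (hS k).2.1) k
  rw [hs] at key
  obtain ⟨ah, h1, h2⟩ := key
  rw [← h2]
  -- The state and its filtered version differ by something orthogonal to all signals so far, hence
  -- have the same projection.
  refine M.D_mul_posteriorCov η γ k (h1.of_perp (M.perp_sigSpan_of_cross η (fun l hl => ?_)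
    fun l => ?_))
  · exact M.cross_hist_eq_zero_of_le η (Fin.le_def.2 (Nat.le_of_lt_succ hl))
      (M.cross_state_residual η k)
  · rw [cross_sub_right, M.cross_sigNoise_state, M.cross_sigNoise_lin_hist, sub_zero]

theorem Model.isConstructed_iff {S : ∀ k : Fin κ, Matrix (Hist n k) (Hist n k) ℝ}
    {η : HistRule n κ} : M.IsConstructed S η ↔ η.IndepNoise ∧ ∀ k : Fin κ,
      IsDesign (M.measMoment k - M.prior S k) (S k - M.prior S k) (η.L k)
        (Matrix.of fun a b => η.T ⟨k, a⟩ ⟨k, b⟩) := Iff.rfl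

theorem Model.exists_isConstructed {S : ∀ k : Fin κ, Matrix (Hist n k) (Hist n k) ℝ}
    (hS : S ∈ M.feasible) : ∃ η : HistRule n κ, M.IsConstructed S η := by
  have hdesign : ∀ k : Fin κ, ∃ L T : Matrix (Hist n k) (Hist n k) ℝ, T.PosSemidef ∧
      IsDesign (M.measMoment k - M.prior S k) (S k - M.prior S k) L T := fun k => by
    refine exists_isDesign ?_ (hS k).2.2 ?_
    · simpa using (hS k).2.1.add (hS k).2.2
    · rw [sub_sub_sub_cancel_right]
      exact (hS k).2.1
  choose L T hT hLT using hdesign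
  refine ⟨⟨L, Matrix.blockDiagonal' T, blockDiagonal'_posSemidef hT⟩, M.isConstructed_iff.2
    ⟨fun k l a b hkl => Matrix.blockDiagonal'_apply_ne T a b hkl, fun k => ?_⟩⟩
  have h1 : (Matrix.of fun a b => Matrix.blockDiagonal' T ⟨k, a⟩ ⟨k, b⟩) = T k := by
    ext a b
    exact Matrix.blockDiagonal'_apply_eq T k a b
  change IsDesign _ _ (L k) (Matrix.of fun a b => Matrix.blockDiagonal' T ⟨k, a⟩ ⟨k, b⟩)
  rw [h1]
  exact hLT k

/-- The Kalman filter on the full measurement vectors, with transition `trans`, attains `S` itself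
and not only its image under `D`. -/
theorem Model.IsConstructed.exists_isProj {M : Model m r n κ Ω}
    {S : ∀ k : Fin κ, Matrix (Hist n k) (Hist n k) ℝ}
    {η : HistRule n κ} (h : M.IsConstructed S η) (hS : S ∈ M.feasible) (k : Fin κ) :
    ∃ Yh, IsProj (M.form η) (sigSpan (M.sigF η) (k.val + 1)) (M.histF _ k) Yh ∧
      cross (M.form η) Yh Yh = S k := by
  obtain ⟨hind, hdes⟩ := M.isConstructed_iff.1 h
  exact exists_isProj_cross_eq (M.form_psd η) (M.histF _) sigNoiseF (fun k => (η.L k)ᵀ)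
    (fun k => M.trans (prevStage k) k) S (M.prior S) (fun _ => rfl)
    (fun k l hkl => by
      rw [M.cross_sigNoise_sigNoise]
      ext a b
      exact hind k l a b hkl)
    (fun k l => M.cross_sigNoise_hist η k l)
    (fun k hk l hl => M.cross_hist_eq_zero_of_le η (le_prevStage hl)
      (M.cross_trans_residual η hk))
    (fun k => by
      rw [M.cross_sigNoise_sigNoise, M.cross_hist_hist, Matrix.transpose_transpose]
      refine (hdes k).exists_gain (hS k).2.2 ?_
      rw [sub_sub_sub_cancel_right]
      exact (hS k).2.1) k

end Targets

/-! ### Sending only the posterior of the state. -/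

section Compression

variable {m r n κ : ℕ} {Ω : Type*} (M : Model m r n κ Ω) {ι : Fin κ → Type} [∀ k, Fintype (ι k)]
  (η : Rule n ι) (G : ∀ k : Fin κ, ∀ j : {j : Fin κ // j ≤ k}, Matrix (Fin m) (ι j) ℝ)

/-- The compressed signals as functionals of the original random variables. -/
def Model.compF (k : Fin κ) (a : Fin m) : StrongDual ℝ (World m n ι) :=
  ∑ j : {j : Fin κ // j ≤ k}, ∑ b : ι j, G k j a b • M.sigF η j b

theorem Model.compF_mem {k l : Fin κ} (hl : l ≤ k) (a : Fin m) :
    M.compF η G l a ∈ sigSpan (M.sigF η) (k.val + 1) :=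
  Submodule.sum_mem _ fun j _ => Submodule.sum_mem _ fun b _ => Submodule.smul_mem _ _
    (mem_sigSpan _ (Nat.lt_succ_of_le (Fin.le_def.1 (j.2.trans hl))) b)

theorem Model.vec_compF (k : Fin κ) (z : World m n ι) :
    vec (M.compF η G k) z = ∑ j : {j : Fin κ // j ≤ k}, act (G k j) (M.signal η z 0 j) := by
  ext a
  simp [Model.compF, M.sigF_apply]

/-- Almost sure equality with a projection preserves all second moments, and the combination lies in
the span of the signals by its form. -/
theorem Model.IsPosteriorMap.isProj {M : Model m r n κ Ω} {η : Rule n ι}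
    {G : ∀ k : Fin κ, ∀ j : {j : Fin κ // j ≤ k}, Matrix (Fin m) (ι j) ℝ}
    (h : M.IsPosteriorMap η G) (k : Fin κ) :
    IsProj (M.form η) (sigSpan (M.sigF η) (k.val + 1)) (M.stateF ι k) (M.compF η G k) := by
  obtain ⟨Xh, hX⟩ := exists_isProj_sigSpan (M.form_psd η) (M.stateF ι k) (M.sigF η) (k.val + 1)
  have h1 := M.condExp_ae_eq η (Policy.zero r ι) k hX
  have h2 : vec (M.stateF ι k) = fun z : World m n ι => M.freeState z.1 k := by
    funext z
    exact M.vec_stateF z k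
  rw [h2] at h1
  have h3 : vec Xh =ᵐ[M.law η] vec (M.compF η G k) := by
    refine h1.symm.trans ((h k).trans ?_)
    filter_upwards with z
    rw [M.vec_compF]
  refine ⟨fun a => M.compF_mem η G le_rfl a, fun a u hu => ?_⟩
  rw [← hX.perp a u hu, moment_apply, moment_apply]
  refine integral_congr_ae ?_
  filter_upwards [h3] with z hz
  have h4 : Xh a z = M.compF η G k a z := congrArg (fun v => v a) hz
  simp [h4]

/-- The coefficients of a projection with respect to the spanning signals serve as `G`. -/
theorem Model.exists_isPosteriorMap : ∃ G, M.IsPosteriorMap η G := by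
  have h1 : ∀ k, ∃ Xh, IsProj (M.form η) (sigSpan (M.sigF η) (k.val + 1)) (M.stateF ι k) Xh :=
    fun k => exists_isProj_sigSpan (M.form_psd η) _ _ _
  choose Xh hX using h1
  have h2 : ∀ k a, ∃ c : (Σ j : {j : Fin κ // j.val < k.val + 1}, ι j.1) → ℝ,
      ∑ p, c p • M.sigFam η (k.val + 1) p = Xh k a := fun k a =>
    (Submodule.mem_span_range_iff_exists_fun ℝ).1 ((hX k).mem a)
  choose c hc using h2
  refine ⟨fun k j a b => c k a ⟨⟨j.1, Nat.lt_succ_of_le (Fin.le_def.1 j.2)⟩, b⟩, fun k => ?_⟩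
  set G : ∀ k : Fin κ, ∀ j : {j : Fin κ // j ≤ k}, Matrix (Fin m) (ι j) ℝ :=
    fun k j a b => c k a ⟨⟨j.1, Nat.lt_succ_of_le (Fin.le_def.1 j.2)⟩, b⟩ with hG
  have h3 : M.compF η G k = Xh k := by
    funext a
    rw [← hc, Model.compF, Fintype.sum_sigma]
    exact Fintype.sum_equiv (Equiv.subtypeEquivRight fun j => by
      rw [Nat.lt_succ_iff, Fin.le_def]) _ _ fun j => rfl
  have h4 := M.condExp_ae_eq η (Policy.zero r ι) k (hX k)
  have h5 : vec (M.stateF ι k) = fun z : World m n ι => M.freeState z.1 k := by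
    funext z
    exact M.vec_stateF z k
  rw [h5, ← h3] at h4
  refine h4.trans ?_
  filter_upwards with z
  rw [M.vec_compF]

theorem sum_subtype_eq_sum_dite {J : Type*} [Fintype J] (p : J → Prop) [DecidablePred p]
    (f : {j // p j} → ℝ) : ∑ j : {j // p j}, f j = ∑ j, if h : p j then f ⟨j, h⟩ else 0 := by
  rw [← Fintype.sum_subtype_add_sum_subtype p]
  have h1 : ∀ j : {j // p j}, (if h : p j.1 then f ⟨j.1, h⟩ else 0) = f j := fun j => dif_pos j.2
  have h2 : ∀ j : {j // ¬ p j}, (if h : p j.1 then f ⟨j.1, h⟩ else 0) = 0 := fun j => dif_neg j.2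
  simp only [h1, h2, Finset.sum_const_zero, add_zero]

/-- The values of the noises of the compressed rule. -/
def compressMap : World m n ι →L[ℝ] World m n (fun _ : Fin κ => Fin m) :=
  ContinuousLinearMap.prodMap (ContinuousLinearMap.id ℝ _)
    (LinearMap.toContinuousLinearMap
      { toFun := act (bigG G)
        map_add' := act_add _
        map_smul' := fun c x => by
          ext i
          simp [Finset.mul_sum, mul_left_comm] })

theorem compressMap_fst (z : World m n ι) : (compressMap (n := n) G z).1 = z.1 := rfl

theorem compressMap_snd (z : World m n ι) : (compressMap (n := n) G z).2 = act (bigG G) z.2 := rfl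

open Classical in
theorem Model.form_eq_sum (φ ψ : StrongDual ℝ (World m n ι)) :
    M.form η φ ψ =
      moment M.primLaw (φ.comp (ContinuousLinearMap.inl ℝ _ _))
        (ψ.comp (ContinuousLinearMap.inl ℝ _ _)) +
      ∑ i, ∑ j, φ (0, EuclideanSpace.single i 1) * η.T i j *
        ψ (0, EuclideanSpace.single j 1) := by
  rw [M.form_eq, moment_multivariateGaussian' η.T_psd]
  rfl

theorem sum_sum_mul_eq_dotProduct {α : Type*} [Fintype α] (T : Matrix α α ℝ) (x y : α → ℝ) :
    ∑ i, ∑ j, x i * T i j * y j = x ⬝ᵥ (T *ᵥ y) := by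
  simp [dotProduct, Matrix.mulVec, Finset.mul_sum, mul_assoc]

theorem sum_mul_congruence {α β : Type*} [Fintype α] [Fintype β] (x y : α → ℝ)
    (N : Matrix α β ℝ) (T : Matrix β β ℝ) :
    ∑ i, ∑ j, x i * (N * T * Nᵀ) i j * y j =
      ∑ p, ∑ q, (∑ i, x i * N i p) * T p q * (∑ j, y j * N j q) := by
  rw [sum_sum_mul_eq_dotProduct]
  refine Eq.trans ?_ (sum_sum_mul_eq_dotProduct T (x ᵥ* N) (y ᵥ* N)).symm
  rw [← Matrix.mulVec_mulVec, ← Matrix.mulVec_mulVec, Matrix.mulVec_transpose,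
    Matrix.dotProduct_mulVec]

/-- The noise covariance of the compressed rule is the congruence of the old one by `bigG G`. Hence
its second moments are those of the old world pulled back along `compressMap`. -/
theorem Model.form_compress (φ ψ : StrongDual ℝ (World m n (fun _ : Fin κ => Fin m))) :
    M.form (η.compress G) φ ψ = M.form η (φ.comp (compressMap G)) (ψ.comp (compressMap G)) := by
  classical
  have h1 : ∀ φ : StrongDual ℝ (World m n (fun _ : Fin κ => Fin m)),
      (φ.comp (compressMap G)).comp (ContinuousLinearMap.inl ℝ _ _) =
        φ.comp (ContinuousLinearMap.inl ℝ _ _) := by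
    intro φ
    refine ContinuousLinearMap.ext fun z => ?_
    change φ (compressMap G (z, 0)) = φ (z, 0)
    congr 1
    refine Prod.ext rfl ?_
    rw [compressMap_snd, act_zero]
  have h2 : ∀ (φ : StrongDual ℝ (World m n (fun _ : Fin κ => Fin m))) q,
      φ.comp (compressMap G) (0, EuclideanSpace.single q 1) =
        ∑ i, φ (0, EuclideanSpace.single i 1) * bigG G i q := by
    intro φ q
    have h3 : φ.comp (compressMap G) (0, EuclideanSpace.single q 1) =
        φ.comp (ContinuousLinearMap.inr ℝ _ _)
          (act (bigG G) (EuclideanSpace.single q 1)) := rfl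
    rw [h3, dual_eq_sum_proj (φ.comp (ContinuousLinearMap.inr ℝ _ _))]
    simp
  have e1 := M.form_eq_sum (η.compress G) φ ψ
  have e2 := M.form_eq_sum η (φ.comp (compressMap G)) (ψ.comp (compressMap G))
  rw [h1, h1] at e2
  rw [e1, e2]
  congr 1
  have e3 := sum_mul_congruence
    (fun i : Σ _ : Fin κ, Fin m => φ (0, EuclideanSpace.single i 1))
    (fun i : Σ _ : Fin κ, Fin m => ψ (0, EuclideanSpace.single i 1)) (bigG G) η.T
  refine Eq.trans ?_ (e3.trans ?_)
  · congr!
  · refine Finset.sum_congr rfl fun p _ => Finset.sum_congr rfl fun q _ => ?_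
    rw [← h2, ← h2]

theorem Model.stateF_comp_compressMap (k : Fin κ) (a : Fin m) :
    (M.stateF (fun _ : Fin κ => Fin m) k a).comp (compressMap G) = M.stateF ι k a := by
  refine ContinuousLinearMap.ext fun z => ?_
  rw [ContinuousLinearMap.comp_apply, M.stateF_apply, M.stateF_apply, compressMap_fst]

theorem sum_hist_of_le {k j : Fin κ} (hj : j ≤ k) (f : Hist n j → ℝ) (g : Fin κ → Fin n → ℝ) :
    ∑ p : Hist n k, (if h : p.1.1 ≤ j then f (⟨p.1.1, h⟩, p.2) else 0) * g p.1.1 p.2 =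
      ∑ p : Hist n j, f p * g p.1.1 p.2 := by
  rw [Fintype.sum_prod_type, Fintype.sum_prod_type]
  rw [sum_subtype_eq_sum_dite (fun i => i ≤ k) fun i : {i // i ≤ k} =>
      ∑ c, (if h : i.1 ≤ j then f (⟨i.1, h⟩, c) else 0) * g i.1 c,
    sum_subtype_eq_sum_dite (fun i => i ≤ j) fun i : {i // i ≤ j} => ∑ c, f (i, c) * g i.1 c]
  refine Finset.sum_congr rfl fun i _ => ?_
  by_cases h1 : i ≤ j
  · simp [h1, h1.trans hj]
  · simp [h1]

/-- Matches the gains and noises of `Rule.compress` with the combinations `∑ G_{k,j} s̃_j` of the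
original signals. -/
theorem Model.sigF_comp_compressMap (k : Fin κ) (a : Fin m) :
    (M.sigF (η.compress G) k a).comp (compressMap G) = M.compF η G k a := by
  refine ContinuousLinearMap.ext fun z => ?_
  have e1 : (M.sigF (η.compress G) k a).comp (compressMap G) z =
      M.signal (η.compress G) (compressMap G z) 0 k a := M.sigF_apply (η.compress G) k a _
  have e2 : M.compF η G k a z =
      (∑ j : {j : Fin κ // j ≤ k}, act (G k j) (M.signal η z 0 j)) a :=
    congrArg (fun v => v a) (M.vec_compF η G k z)
  have e3 : M.signal (η.compress G) (compressMap G z) 0 k a =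
      ∑ p : Hist n k, (∑ j : {j : Fin κ // j ≤ k}, ∑ b : ι j,
        G k j a b * (if h : p.1.1 ≤ j.1 then η.L j.1 (⟨p.1.1, h⟩, p.2) b else 0)) *
          M.meas z.1 0 p.1.1 p.2 +
      ∑ q : Σ k, ι k, (if h : q.1 ≤ k then G k ⟨q.1, h⟩ a q.2 else 0) * z.2 q := rfl
  have e4 : ∀ (j : Fin κ) (b : ι j), M.signal η z 0 j b =
      ∑ p : Hist n j, η.L j p b * M.meas z.1 0 p.1.1 p.2 + z.2 ⟨j, b⟩ := fun j b => rfl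
  rw [e1, e2, e3]
  simp only [WithLp.ofLp_sum, Finset.sum_apply, act_apply, e4, mul_add, Finset.sum_add_distrib]
  congr 1
  · simp only [Finset.sum_mul]
    rw [Finset.sum_comm]
    refine Finset.sum_congr rfl fun j _ => ?_
    rw [Finset.sum_comm]
    refine Finset.sum_congr rfl fun b _ => ?_
    simp only [mul_assoc, ← Finset.mul_sum]
    congr 1
    exact sum_hist_of_le j.2 (fun p => η.L j.1 p b) fun i c => M.meas z.1 0 i c
  · rw [Fintype.sum_sigma, sum_subtype_eq_sum_dite (fun j => j ≤ k) fun j : {j // j ≤ k} =>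
      ∑ b, G k j a b * z.2 ⟨j.1, b⟩]
    refine Finset.sum_congr rfl fun j _ => ?_
    by_cases h1 : j ≤ k
    · simp [h1]
    · simp [h1]

/-- The new signals pull back into the old span and `C`, the old projection of the state, is the
pullback of a combination `Xh` of them. A projection that already lies in the smaller span is the
projection to it as well. -/
theorem Model.D_mul_posteriorCov_of_comp {ι' : Fin κ → Type} [∀ k, Fintype (ι' k)]
    (η' : Rule n ι') (J : World m n ι →L[ℝ] World m n ι')
    (hJ : ∀ φ ψ, M.form η' φ ψ = M.form η (φ.comp J) (ψ.comp J))
    (hst : ∀ k a, (M.stateF ι' k a).comp J = M.stateF ι k a) (k : Fin κ)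
    (hsig : ∀ l, l ≤ k → ∀ c, (M.sigF η' l c).comp J ∈ sigSpan (M.sigF η) (k.val + 1))
    {Xh : Fin m → StrongDual ℝ (World m n ι')} {C : Fin m → StrongDual ℝ (World m n ι)}
    (hXh : ∀ a, Xh a ∈ sigSpan (M.sigF η') (k.val + 1)) (hXC : ∀ a, (Xh a).comp J = C a)
    (hC : IsProj (M.form η) (sigSpan (M.sigF η) (k.val + 1)) (M.stateF ι k) C)
    (γ : Policy r ι') :
    M.D k * M.posteriorCov η' γ k * (M.D k)ᵀ = cross (M.form η) C C := by
  have h1 : IsProj (M.form η') (sigSpan (M.sigF η') (k.val + 1)) (M.stateF ι' k) Xh := by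
    refine ⟨hXh, perp_sigSpan fun l hl => ?_⟩
    ext a c
    rw [cross_apply, hJ, Pi.sub_apply, ContinuousLinearMap.sub_comp, hst, hXC]
    exact hC.perp a _ (hsig l (Fin.le_def.2 (Nat.le_of_lt_succ hl)) c)
  rw [M.D_mul_posteriorCov η' γ k h1]
  ext a c
  rw [cross_apply, hJ, hXC, hXC, cross_apply]

theorem Model.D_mul_posteriorCov_compress {G : ∀ k : Fin κ, ∀ j : {j : Fin κ // j ≤ k},
      Matrix (Fin m) (ι j) ℝ}
    (hG : M.IsPosteriorMap η G) (γ : Policy r (fun _ : Fin κ => Fin m)) (k : Fin κ)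
    {Yh : Hist n k → StrongDual ℝ (World m n ι)}
    (hY : IsProj (M.form η) (sigSpan (M.sigF η) (k.val + 1)) (M.histF ι k) Yh) :
    M.D k * M.posteriorCov (η.compress G) γ k * (M.D k)ᵀ =
      M.D k * cross (M.form η) Yh Yh * (M.D k)ᵀ := by
  have h := M.D_mul_posteriorCov_of_comp η (ι' := fun _ : Fin κ => Fin m) (η.compress G)
    (compressMap G) (M.form_compress η G) (M.stateF_comp_compressMap G) k
    (fun l hl c => by
      rw [M.sigF_comp_compressMap η G l c]
      exact M.compF_mem η G hl c)
    -- The current compressed signal is itself the posterior of the state.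
    (Xh := M.sigF (η.compress G) k) (C := M.compF η G k)
    (mem_sigSpan (ι := fun _ : Fin κ => Fin m) (M.sigF (η.compress G)) (Nat.lt_succ_self k.val))
    (M.sigF_comp_compressMap η G k) (hG.isProj k) γ
  rw [h, (hG.isProj k).cross_eq (M.form_psd η) (M.isProj_state η k hY), cross_lin_left,
    cross_lin_right, Matrix.mul_assoc]

end Compression

/-! ### Quadratic forms and completion of squares. -/

section Bilinear

variable {α β γ δ : Type*} [Fintype α] [Fintype β] [Fintype γ] [Fintype δ]

/-- The bilinear form `x' N y`. -/
def bil (N : Matrix α β ℝ) (x : EuclideanSpace ℝ α) (y : EuclideanSpace ℝ β) : ℝ :=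
  x.ofLp ⬝ᵥ (N *ᵥ y.ofLp)

theorem wsq_eq_bil (N : Matrix α α ℝ) (x : EuclideanSpace ℝ α) : wsq N x = bil N x x := rfl

theorem bil_eq_sum (N : Matrix α β ℝ) (x : EuclideanSpace ℝ α) (y : EuclideanSpace ℝ β) :
    bil N x y = ∑ i, ∑ j, N i j * (x i * y j) := by
  simp only [bil, dotProduct, Matrix.mulVec, Finset.mul_sum]
  exact Finset.sum_congr rfl fun _ _ => Finset.sum_congr rfl fun _ _ => by ring

theorem bil_add_left (N : Matrix α β ℝ) (x x' : EuclideanSpace ℝ α) (y : EuclideanSpace ℝ β) :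
    bil N (x + x') y = bil N x y + bil N x' y := by
  simp [bil, add_dotProduct]

theorem bil_add_right (N : Matrix α β ℝ) (x : EuclideanSpace ℝ α) (y y' : EuclideanSpace ℝ β) :
    bil N x (y + y') = bil N x y + bil N x y' := by
  simp [bil, Matrix.mulVec_add, dotProduct_add]

theorem bil_neg_left (N : Matrix α β ℝ) (x : EuclideanSpace ℝ α) (y : EuclideanSpace ℝ β) :
    bil N (-x) y = -bil N x y := by
  simp [bil]

theorem bil_neg_right (N : Matrix α β ℝ) (x : EuclideanSpace ℝ α) (y : EuclideanSpace ℝ β) :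
    bil N x (-y) = -bil N x y := by
  simp [bil, Matrix.mulVec_neg]

theorem bil_act_left (N : Matrix α β ℝ) (P : Matrix α γ ℝ) (x : EuclideanSpace ℝ γ)
    (y : EuclideanSpace ℝ β) : bil N (act P x) y = bil (Pᵀ * N) x y := by
  simp only [bil, act]
  rw [← Matrix.mulVec_mulVec, Matrix.dotProduct_mulVec x.ofLp, Matrix.vecMul_transpose]

theorem bil_act_right (N : Matrix α β ℝ) (P : Matrix β γ ℝ) (x : EuclideanSpace ℝ α)
    (y : EuclideanSpace ℝ γ) : bil N x (act P y) = bil (N * P) x y := by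
  simp only [bil, act, Matrix.mulVec_mulVec]

theorem bil_comm (N : Matrix α β ℝ) (x : EuclideanSpace ℝ α) (y : EuclideanSpace ℝ β) :
    bil N x y = bil Nᵀ y x := by
  simp only [bil]
  rw [Matrix.dotProduct_mulVec, Matrix.mulVec_transpose, dotProduct_comm]

theorem bil_mat_sub (N N' : Matrix α β ℝ) (x : EuclideanSpace ℝ α) (y : EuclideanSpace ℝ β) :
    bil (N - N') x y = bil N x y - bil N' x y := by
  simp [bil, Matrix.sub_mulVec, dotProduct_sub]

theorem wsq_add (N : Matrix α α ℝ) (hN : Nᵀ = N) (x y : EuclideanSpace ℝ α) :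
    wsq N (x + y) = wsq N x + 2 * bil N x y + wsq N y := by
  simp only [wsq_eq_bil, bil_add_left, bil_add_right]
  rw [bil_comm N y x, hN]
  ring

theorem wsq_nonneg {N : Matrix α α ℝ} (hN : N.PosSemidef) (x : EuclideanSpace ℝ α) :
    0 ≤ wsq N x := by
  have h := hN.dotProduct_mulVec_nonneg x.ofLp
  rwa [star_trivial] at h

/-- Completion of squares in one stage of the Riccati recursion. -/
theorem complete_square {A : Matrix α α ℝ} {B : Matrix α β ℝ} {P : Matrix α α ℝ}
    {R Δ : Matrix β β ℝ} [DecidableEq β] (hP : Pᵀ = P) (hΔ : Δ = Bᵀ * P * B + R) (hΔs : Δᵀ = Δ)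
    (hΔu : IsUnit Δ.det) (x w : EuclideanSpace ℝ α) (u : EuclideanSpace ℝ β) :
    wsq P (act A x + act B u + w) + wsq R u =
      wsq (Aᵀ * (P - P * B * Δ⁻¹ * Bᵀ * P) * A) x + wsq Δ (u + act (Δ⁻¹ * Bᵀ * P * A) x) +
      2 * bil P w (act A x + act B u) + wsq P w := by
  have hR : R = Δ - Bᵀ * P * B := by rw [hΔ, add_sub_cancel_left]
  have h1 : Δ * (Δ⁻¹ * Bᵀ * P * A) = Bᵀ * P * A := by
    simp only [Matrix.mul_assoc, Matrix.mul_nonsing_inv_cancel_left _ _ hΔu]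
  have h2 : (Δ⁻¹ * Bᵀ * P * A)ᵀ * (Bᵀ * P * A) = Aᵀ * (P * B * Δ⁻¹ * Bᵀ * P) * A := by
    simp only [Matrix.transpose_mul, Matrix.transpose_transpose, hP, Matrix.transpose_nonsing_inv,
      hΔs, Matrix.mul_assoc]
  rw [wsq_add P hP, wsq_add P hP, wsq_add Δ hΔs, hR]
  simp only [wsq_eq_bil, bil_act_left, bil_act_right, bil_mat_sub, bil_add_left, bil_add_right]
  rw [h1, h2, Matrix.mul_sub, Matrix.sub_mul, bil_mat_sub, bil_comm (Aᵀ * (P * B)) x u,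
    bil_comm (Aᵀ * P) x w, bil_comm (Bᵀ * P) u w]
  simp only [Matrix.transpose_mul, Matrix.transpose_transpose, hP, Matrix.mul_assoc]
  ring

end Bilinear

/-! ### Integrals of quadratic forms of square integrable vectors. -/

section Integrals

variable {X : Type*} [MeasurableSpace X] {μ : Measure X}
variable {α β : Type*} [Fintype α] [Fintype β]

theorem memLp_coord {f : X → EuclideanSpace ℝ α} (hf : MemLp f 2 μ) (i : α) :
    MemLp (fun x => f x i) 2 μ :=
  (EuclideanSpace.proj (𝕜 := ℝ) i : EuclideanSpace ℝ α →L[ℝ] ℝ).comp_memLp' hf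

theorem memLp_act (N : Matrix α β ℝ) {f : X → EuclideanSpace ℝ β} (hf : MemLp f 2 μ) :
    MemLp (fun x => act N (f x)) 2 μ := by
  refine MemLp.of_eval_piLp fun i => ?_
  simp only [act_apply]
  exact memLp_finsetSum _ fun j _ => (memLp_coord hf j).const_mul _

theorem integrable_bil (N : Matrix α β ℝ) {f : X → EuclideanSpace ℝ α}
    {g : X → EuclideanSpace ℝ β} (hf : MemLp f 2 μ) (hg : MemLp g 2 μ) :
    Integrable (fun x => bil N (f x) (g x)) μ := by
  simp only [bil_eq_sum]
  exact integrable_finsetSum _ fun i _ => integrable_finsetSum _ fun j _ =>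
    ((memLp_coord hf i).integrable_mul (memLp_coord hg j)).const_mul _

theorem integrable_wsq (N : Matrix α α ℝ) {f : X → EuclideanSpace ℝ α} (hf : MemLp f 2 μ) :
    Integrable (fun x => wsq N (f x)) μ := integrable_bil N hf hf

theorem integral_bil (N : Matrix α β ℝ) {f : X → EuclideanSpace ℝ α}
    {g : X → EuclideanSpace ℝ β} (hf : MemLp f 2 μ) (hg : MemLp g 2 μ) :
    ∫ x, bil N (f x) (g x) ∂μ = ∑ i, ∑ j, N i j * ∫ x, f x i * g x j ∂μ := by
  have h : ∀ i j, Integrable (fun x => N i j * (f x i * g x j)) μ := fun i j =>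
    ((memLp_coord hf i).integrable_mul (memLp_coord hg j)).const_mul _
  simp only [bil_eq_sum]
  rw [integral_finsetSum _ fun i _ => integrable_finsetSum _ fun j _ => h i j]
  refine Finset.sum_congr rfl fun i _ => ?_
  rw [integral_finsetSum _ fun j _ => h i j]
  exact Finset.sum_congr rfl fun j _ => integral_const_mul _ _

theorem lintegral_wsq {N : Matrix α α ℝ} (hN : N.PosSemidef) {f : X → EuclideanSpace ℝ α}
    (hf : MemLp f 2 μ) :
    ∫⁻ x, ENNReal.ofReal (wsq N (f x)) ∂μ = ENNReal.ofReal (∫ x, wsq N (f x) ∂μ) :=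
  (ofReal_integral_eq_lintegral_ofReal (integrable_wsq N hf)
    (Filter.Eventually.of_forall fun _ => wsq_nonneg hN _)).symm

theorem wsq_eq_sum_of_diagonalization [DecidableEq α] {N U : Matrix α α ℝ} {d : α → ℝ}
    (h : N = U * diagonal d * Uᵀ) (x : EuclideanSpace ℝ α) :
    wsq N x = ∑ i, d i * (act Uᵀ x i) ^ 2 := by
  have h1 : wsq N x = bil (diagonal d) (act Uᵀ x) (act Uᵀ x) := by
    rw [bil_act_left, bil_act_right, Matrix.transpose_transpose, wsq_eq_bil, h]
  rw [h1]
  simp only [bil, dotProduct, Matrix.mulVec_diagonal]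
  exact Finset.sum_congr rfl fun i _ => by ring

theorem diagonalization_pos [DecidableEq α] {N U : Matrix α α ℝ} {d : α → ℝ}
    (hN : N.PosDef) (hU : U ∈ Matrix.orthogonalGroup α ℝ) (h : N = U * diagonal d * Uᵀ)
    (i : α) : 0 < d i := by
  refine lt_of_le_of_ne (diagonalization_nonneg hN.posSemidef hU h i) fun h0 => ?_
  have h1 : N.det = 0 := by
    rw [h, Matrix.det_mul, Matrix.det_mul, Matrix.det_diagonal,
      Finset.prod_eq_zero (Finset.mem_univ i) h0.symm]
    simp
  exact hN.det_pos.ne' h1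

theorem eq_zero_of_wsq_eq_zero {N : Matrix α α ℝ} (hN : N.PosDef) {x : EuclideanSpace ℝ α}
    (h : wsq N x = 0) : x = 0 := by
  by_contra hx
  have h1 : x.ofLp ≠ 0 := fun h0 => hx (by ext i; exact congrFun h0 i)
  have h2 := hN.dotProduct_mulVec_pos h1
  have h3 : star x.ofLp ⬝ᵥ (N *ᵥ x.ofLp) = wsq N x := by simp [wsq]
  rw [h3, h] at h2
  exact lt_irrefl _ h2

/-- A random vector with a finite positive definite energy is square integrable. -/
theorem memLp_of_lintegral_wsq {N : Matrix α α ℝ} (hN : N.PosDef) {f : X → EuclideanSpace ℝ α}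
    (hf : Measurable f) (h : ∫⁻ x, ENNReal.ofReal (wsq N (f x)) ∂μ ≠ ⊤) : MemLp f 2 μ := by
  classical
  obtain ⟨U, hU, d, hd⟩ := exists_orthogonal_diagonalization hN.1
  have hd0 := diagonalization_pos hN hU hd
  have hU2 : U * Uᵀ = 1 := (Matrix.mem_orthogonalGroup_iff _ ℝ).1 hU
  have hmeas : Measurable fun x => wsq N (f x) := by
    simp only [wsq_eq_bil, bil_eq_sum]
    have h1 : ∀ i, Measurable fun x => f x i := fun i =>
      (EuclideanSpace.proj (𝕜 := ℝ) i).continuous.measurable.comp hf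
    exact Finset.measurable_sum _ fun i _ => Finset.measurable_sum _ fun j _ =>
      ((h1 i).mul (h1 j)).const_mul _
  have hint : Integrable (fun x => wsq N (f x)) μ := by
    refine ⟨hmeas.aestronglyMeasurable, ?_⟩
    rw [hasFiniteIntegral_iff_ofReal
      (Filter.Eventually.of_forall fun _ => wsq_nonneg hN.posSemidef _)]
    exact lt_top_iff_ne_top.2 h
  have h1 : MemLp (fun x => act Uᵀ (f x)) 2 μ := by
    refine MemLp.of_eval_piLp fun i => ?_
    have hm : Measurable fun x => act Uᵀ (f x) i :=
      (EuclideanSpace.proj (𝕜 := ℝ) i).continuous.measurable.comp ((measurable_act _).comp hf)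
    rw [memLp_two_iff_integrable_sq hm.aestronglyMeasurable]
    -- In eigencoordinates the energy is a sum of nonnegative terms, so each squared coordinate is
    -- at most the energy divided by its eigenvalue.
    refine (hint.const_mul (d i)⁻¹).mono' (hm.pow_const 2).aestronglyMeasurable
      (Filter.Eventually.of_forall fun x => ?_)
    rw [Real.norm_of_nonneg (sq_nonneg _), wsq_eq_sum_of_diagonalization hd,
      le_inv_mul_iff₀ (hd0 i)]
    exact Finset.single_le_sum (f := fun i => d i * act Uᵀ (f x) i ^ 2)
      (fun j _ => mul_nonneg (hd0 j).le (sq_nonneg _)) (Finset.mem_univ i)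
  have h2 : f = fun x => act U (act Uᵀ (f x)) := by
    funext x
    ext i
    simp [act, hU2]
  rw [h2]
  exact memLp_act U h1

end Integrals

/-! ### Quadratic integrals of Gaussian functionals. -/

section GaussianIntegrals

variable {W : Type*} [NormedAddCommGroup W] [NormedSpace ℝ W] [MeasurableSpace W] [BorelSpace W]
  {μ : Measure W} [IsGaussian μ] {α β : Type*} [Fintype α] [Fintype β]

theorem memLp_vec (φ : α → StrongDual ℝ W) : MemLp (vec φ) 2 μ :=
  MemLp.of_eval_piLp fun i => memLp_two_dual μ (φ i)

theorem integral_wsq_vec (N : Matrix α α ℝ) (φ : α → StrongDual ℝ W) :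
    ∫ w, wsq N (vec φ w) ∂μ = (N * cross (moment μ) φ φ).trace := by
  simp only [wsq_eq_bil]
  rw [integral_bil N (memLp_vec φ) (memLp_vec φ), Matrix.trace]
  simp only [Matrix.diag_apply, Matrix.mul_apply, cross_apply]
  refine Finset.sum_congr rfl fun i _ => Finset.sum_congr rfl fun j _ => ?_
  rw [(moment_isPosSemidef μ).eq]
  rfl

theorem integral_bil_eq_zero {J : Type*} [Fintype J] (h0 : IsCentered μ) (N : Matrix α β ℝ)
    {s : J → StrongDual ℝ W} {φ : α → StrongDual ℝ W}
    (hφ : Perp (moment μ) φ (Submodule.span ℝ (Set.range s))) {g : W → EuclideanSpace ℝ β}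
    (hg : MemLp g 2 μ) (hgm : Measurable[dualInfo s] g) :
    ∫ w, bil N (vec φ w) (g w) ∂μ = 0 := by
  rw [integral_bil N (memLp_vec φ) hg]
  refine Finset.sum_eq_zero fun i _ => Finset.sum_eq_zero fun j _ => ?_
  have h1 : Measurable[dualInfo s] fun w => g w j :=
    (EuclideanSpace.proj (𝕜 := ℝ) j).continuous.measurable.comp hgm
  have h2 := integral_mul_eq_zero h0 s (φ i) (hφ i) h1
  simp only [vec_apply]
  rw [h2, mul_zero]

end GaussianIntegrals

/-! ### The Riccati recursion. -/

section Riccati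

variable {m r n κ : ℕ} {Ω : Type*} (M : Model m r n κ Ω)

theorem posSemidef_transpose_mul_mul {α β : Type*} [Fintype α] [Fintype β] {P : Matrix α α ℝ}
    (hP : P.PosSemidef) (B : Matrix α β ℝ) : (Bᵀ * P * B).PosSemidef := by
  simpa [Matrix.conjTranspose_eq_transpose_of_trivial] using hP.conjTranspose_mul_mul_same B

/-- With `L = Δ⁻¹ B'P` the difference equals `(1 - BL)' P (1 - BL) + L' R L`, a sum of two
semidefinite matrices. -/
theorem riccati_step_posSemidef {α β : Type*} [Fintype α] [Fintype β] [DecidableEq α]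
    [DecidableEq β] {P : Matrix α α ℝ} (hP : P.PosSemidef) (B : Matrix α β ℝ)
    {R : Matrix β β ℝ} (hR : R.PosDef) :
    (P - P * B * (Bᵀ * P * B + R)⁻¹ * Bᵀ * P).PosSemidef := by
  set Δ := Bᵀ * P * B + R with hΔ
  have hΔp : Δ.PosDef := hR.posSemidef_add (posSemidef_transpose_mul_mul hP B)
  have hΔu : IsUnit Δ.det := hΔp.det_pos.ne'.isUnit
  have hΔs : Δᵀ = Δ := hΔp.1
  have hPs : Pᵀ = P := hP.1
  set L := Δ⁻¹ * (Bᵀ * P) with hL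
  have h1 : Δ * L = Bᵀ * P := by rw [hL, Matrix.mul_nonsing_inv_cancel_left _ _ hΔu]
  have h2 : P - P * B * Δ⁻¹ * Bᵀ * P = (1 - B * L)ᵀ * P * (1 - B * L) + Lᵀ * R * L := by
    have h3 : Lᵀ * R * L = Lᵀ * (Bᵀ * P) - Lᵀ * (Bᵀ * (P * (B * L))) := by
      have h4 : R = Δ - Bᵀ * P * B := by rw [hΔ, add_sub_cancel_left]
      rw [h4, Matrix.mul_sub, Matrix.sub_mul, Matrix.mul_assoc Lᵀ Δ, h1]
      simp only [Matrix.mul_assoc]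
    have h5 : P * B * Δ⁻¹ * Bᵀ * P = P * (B * L) := by
      rw [hL]
      simp only [Matrix.mul_assoc]
    rw [h3, h5]
    simp only [Matrix.transpose_sub, Matrix.transpose_one, Matrix.transpose_mul, Matrix.sub_mul,
      Matrix.mul_sub, Matrix.one_mul, Matrix.mul_one, Matrix.mul_assoc]
    abel
  rw [h2]
  exact (posSemidef_transpose_mul_mul hP _).add (posSemidef_transpose_mul_mul hR.posSemidef _)

theorem Model.riccati_posSemidef (ω : Option Ω) (i : ℕ) : (M.riccati ω i).PosSemidef := by
  induction i with
  | zero => exact M.Q_psd ω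
  | succ i ih =>
    exact (M.Q_psd ω).add (posSemidef_transpose_mul_mul
      (riccati_step_posSemidef ih M.B (M.R_pd ω)) M.A)

theorem Model.Qt_posSemidef (ω : Option Ω) (k : ℕ) : (M.Qt ω k).PosSemidef :=
  M.riccati_posSemidef ω _

theorem Model.Qt_last (ω : Option Ω) : M.Qt ω κ = M.Q ω := by
  simp [Model.Qt, Model.riccati]

theorem Model.Del_posDef (ω : Option Ω) (k : Fin κ) : (M.Del ω k).PosDef :=
  (M.R_pd ω).posSemidef_add (posSemidef_transpose_mul_mul (M.Qt_posSemidef ω _) M.B)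

theorem Model.Qt_sub (ω : Option Ω) (k : Fin κ) :
    M.Qt ω k.val - M.Q ω = M.Aᵀ * (M.Qt ω (k.val + 1) - M.Qt ω (k.val + 1) * M.B *
      (M.Del ω k)⁻¹ * M.Bᵀ * M.Qt ω (k.val + 1)) * M.A := by
  have h : κ - k.val = κ - (k.val + 1) + 1 := by omega
  rw [Model.Qt, h, Model.riccati, add_sub_cancel_left]
  rfl

theorem Model.complete_square (ω : Option Ω) (k : Fin κ) (x w : Vec m) (u : Vec r) :
    wsq (M.Qt ω (k.val + 1)) (act M.A x + act M.B u + w) + wsq (M.R ω) u =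
      wsq (M.Qt ω k.val - M.Q ω) x + wsq (M.Del ω k) (u + act (M.K ω k) x) +
      2 * bil (M.Qt ω (k.val + 1)) w (act M.A x + act M.B u) + wsq (M.Qt ω (k.val + 1)) w := by
  rw [M.Qt_sub]
  exact SensorDesign.complete_square (M.Qt_posSemidef ω _).1 rfl (M.Del_posDef ω k).1
    (M.Del_posDef ω k).det_pos.ne'.isUnit x w u

end Riccati

/-! ### The cost of a follower as a constant plus penalties for deviation. -/

section Energy

variable {m r n κ : ℕ} {Ω : Type*} (M : Model m r n κ Ω) {ι : Fin κ → Type} [∀ k, Fintype (ι k)]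
  (η : Rule n ι) (γ : Policy r ι)

theorem Model.measurable_control_info {l k : Fin κ} (hl : l ≤ k) :
    Measurable[dualInfo (M.sigFam η (k.val + 1))] fun z => M.control η γ z l := by
  rw [← M.info_eq η γ k]
  simp only [M.control_eq η γ _ l]
  refine (γ.meas l).comp (@measurable_pi_lambda _ _ _ (M.info η γ k) _ _ fun i => ?_)
  exact measurable_comap_apply (fun (z : World m n ι) (j : {j : Fin κ // j ≤ k}) =>
    M.signal η z (M.control η γ z) j) ⟨i.1, i.2.trans hl⟩

theorem Model.measurable_control (k : Fin κ) : Measurable fun z => M.control η γ z k :=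
  (M.measurable_control_info η γ (le_refl k)).mono (dualInfo_le _) le_rfl

/-- The contribution of the control inputs to the state is known from the signals. -/
theorem Model.measurable_drift (k : Fin κ) (j : Fin (κ + 1)) (hj : j.val ≤ k.val + 1) :
    Measurable[dualInfo (M.sigFam η (k.val + 1))] fun z => M.state 0 (M.control η γ z) j :=
  @Model.measurable_state m r n κ Ω M _ (dualInfo (M.sigFam η (k.val + 1))) (fun _ => 0)
    measurable_const _ j fun _ hl => M.measurable_control_info η γ
      (Fin.le_def.2 (Nat.le_of_lt_succ (hl.trans_le hj)))

variable {η γ}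

theorem Model.memLp_drift (hu : ∀ k, MemLp (fun z => M.control η γ z k) 2 (M.law η))
    (j : Fin (κ + 1)) : MemLp (fun z => M.state 0 (M.control η γ z) j) 2 (M.law η) := by
  induction j using Fin.induction with
  | zero => exact memLp_const _
  | succ k ih =>
    simp only [M.state_succ, Prod.snd_zero, Prod.fst_zero, Pi.zero_apply, add_zero]
    exact (memLp_act M.A ih).add (memLp_act M.B (hu k))

theorem Model.state_eq_vec_add (z : World m n ι) (u : Fin κ → Vec r) (j : Fin (κ + 1)) :
    M.state z.1 u j = vec (M.allStateF ι j) z + M.state 0 u j := by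
  rw [M.vec_allStateF, ← M.state_eq_add]

theorem Model.memLp_state (hu : ∀ k, MemLp (fun z => M.control η γ z k) 2 (M.law η))
    (j : Fin (κ + 1)) : MemLp (fun z => M.state z.1 (M.control η γ z) j) 2 (M.law η) := by
  have h1 : MemLp (vec (M.allStateF ι j)) 2 (M.law η) := memLp_vec _
  have h2 := h1.add (M.memLp_drift hu j)
  have h3 : (fun z => M.state z.1 (M.control η γ z) j) =
      vec (M.allStateF ι j) + fun z => M.state 0 (M.control η γ z) j :=
    funext fun z => M.state_eq_vec_add z _ j
  rwa [h3]

theorem integral_bil_vec_eq_zero {W : Type*} [NormedAddCommGroup W] [NormedSpace ℝ W]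
    [MeasurableSpace W] [BorelSpace W] {μ : Measure W} [IsGaussian μ] {α β : Type*} [Fintype α]
    [Fintype β] (N : Matrix α β ℝ) {φ : α → StrongDual ℝ W} {ψ : β → StrongDual ℝ W}
    (h : cross (moment μ) φ ψ = 0) : ∫ w, bil N (vec φ w) (vec ψ w) ∂μ = 0 := by
  rw [integral_bil N (memLp_vec φ) (memLp_vec ψ)]
  refine Finset.sum_eq_zero fun i _ => Finset.sum_eq_zero fun j _ => ?_
  have h1 : ∫ w, φ i w * ψ j w ∂μ = 0 := congrFun (congrFun h i) j
  simp only [vec_apply]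
  rw [h1, mul_zero]

variable (η) in
theorem Model.perp_proc_sigSpan (k : Fin κ) :
    Perp (M.form η) (procF k) (sigSpan (M.sigF η) (k.val + 1)) :=
  perp_sigSpan fun _ hj => M.cross_proc_sig η (Fin.le_def.2 (Nat.le_of_lt_succ hj))

/-- The state noise is uncorrelated with the sum of the control-free state and of a function of
the signals. -/
theorem Model.integral_bil_proc {d : ℕ} (k : Fin κ) (N : Matrix (Fin m) (Fin d) ℝ)
    (P : Matrix (Fin d) (Fin m) ℝ) {g : World m n ι → Vec d} (hg : MemLp g 2 (M.law η))
    (hgm : Measurable[dualInfo (M.sigFam η (k.val + 1))] g) :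
    ∫ z, bil N (vec (procF k) z) (act P (vec (M.stateF ι k) z) + g z) ∂M.law η = 0 := by
  simp only [bil_add_right]
  rw [integral_add (integrable_bil N (memLp_vec _) (memLp_act P (memLp_vec _)))
    (integrable_bil N (memLp_vec _) hg),
    integral_bil_eq_zero (isCentered_law M η) N (M.perp_proc_sigSpan η k) hg hgm, add_zero]
  simp only [← vec_lin]
  refine integral_bil_vec_eq_zero N ?_
  rw [cross_lin_right, M.cross_proc_state η le_rfl, Matrix.zero_mul]

variable (η γ) in
/-- The deviation of the control input from the certainty equivalent one. -/
def Model.deviation (G : ∀ k : Fin κ, ∀ j : {j : Fin κ // j ≤ k}, Matrix (Fin m) (ι j) ℝ)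
    (ω : Option Ω) (k : Fin κ) (z : World m n ι) : Vec r :=
  M.control η γ z k +
    act (M.K ω k) (vec (M.compF η G k) z + M.state 0 (M.control η γ z) k.castSucc)

variable {G : ∀ k : Fin κ, ∀ j : {j : Fin κ // j ≤ k}, Matrix (Fin m) (ι j) ℝ}

variable (η G) in
theorem Model.measurable_compF (k : Fin κ) :
    Measurable[dualInfo (M.sigFam η (k.val + 1))] fun z => vec (M.compF η G k) z :=
  (WithLp.measurable_toLp 2 _).comp (@measurable_pi_lambda _ _ _
    (dualInfo (M.sigFam η (k.val + 1))) _ (fun z a => M.compF η G k a z) fun a =>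
      measurable_dualInfo (M.sigFam η (k.val + 1)) (M.compF_mem η G le_rfl a))

variable (η γ G) in
theorem Model.measurable_deviation (ω : Option Ω) (k : Fin κ) :
    Measurable[dualInfo (M.sigFam η (k.val + 1))] (M.deviation η γ G ω k) :=
  (M.measurable_control_info η γ le_rfl).add ((measurable_act _).comp
    ((M.measurable_compF η G k).add (M.measurable_drift η γ k _ (by simp))))

theorem Model.memLp_deviation (hu : ∀ k, MemLp (fun z => M.control η γ z k) 2 (M.law η))
    (ω : Option Ω) (k : Fin κ) : MemLp (M.deviation η γ G ω k) 2 (M.law η) := by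
  have h1 : MemLp (vec (M.compF η G k)) 2 (M.law η) := memLp_vec _
  have h2 := memLp_act (M.K ω k) (h1.add (M.memLp_drift hu k.castSucc))
  exact (hu k).add h2

theorem vec_sub {W : Type*} [NormedAddCommGroup W] [NormedSpace ℝ W] {α : Type*}
    (X Y : α → StrongDual ℝ W) (w : W) : vec (X - Y) w = vec X w - vec Y w := by
  ext i
  simp

/-- The first summand is a function of the signals, the second a control-free estimation error
orthogonal to them. -/
theorem Model.control_add_eq (ω : Option Ω) (k : Fin κ) (z : World m n ι) :
    M.control η γ z k + act (M.K ω k) (M.state z.1 (M.control η γ z) k.castSucc) =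
      M.deviation η γ G ω k z +
        vec (lin (M.K ω k) (M.stateF ι k - M.compF η G k)) z := by
  have h : vec (M.stateF ι k) z = vec (M.compF η G k) z + vec (M.stateF ι k - M.compF η G k) z := by
    rw [vec_sub, add_sub_cancel]
  rw [vec_lin, M.state_eq_vec_add, Model.deviation, add_assoc, ← act_add]
  change _ + act _ (vec (M.stateF ι k) z + _) = _
  rw [h]
  congr 2
  abel

/-- The covariance of the posterior of the state. -/
abbrev Model.postCov (M : Model m r n κ Ω) (η : Rule n ι)
    (G : ∀ k : Fin κ, ∀ j : {j : Fin κ // j ≤ k}, Matrix (Fin m) (ι j) ℝ) (k : Fin κ) :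
    Matrix (Fin m) (Fin m) ℝ := cross (M.form η) (M.compF η G k) (M.compF η G k)

/-- The cross term vanishes by orthogonality, and no policy can influence the estimation error:
control has no dual effect. -/
theorem Model.integral_wsq_control_add (hG : M.IsPosteriorMap η G)
    (hu : ∀ k, MemLp (fun z => M.control η γ z k) 2 (M.law η)) (ω : Option Ω) (k : Fin κ) :
    ∫ z, wsq (M.Del ω k) (M.control η γ z k +
        act (M.K ω k) (M.state z.1 (M.control η γ z) k.castSucc)) ∂M.law η =
      ∫ z, wsq (M.Del ω k) (M.deviation η γ G ω k z) ∂M.law η +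
        ((M.K ω k)ᵀ * M.Del ω k * M.K ω k * (M.stateMoment k k - M.postCov η G k)).trace := by
  have hd := M.memLp_deviation (G := G) hu ω k
  have hs : (M.Del ω k)ᵀ = M.Del ω k := (M.Del_posDef ω k).1
  have hp := (hG.isProj k).perp.lin (M.K ω k)
  simp only [M.control_add_eq (G := G), wsq_add _ hs]
  have he : MemLp (vec (lin (M.K ω k) (M.stateF ι k - M.compF η G k))) 2 (M.law η) :=
    memLp_vec _
  have i1 := integrable_wsq (M.Del ω k) hd
  have i2 := (integrable_bil (M.Del ω k) hd he).const_mul 2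
  rw [integral_add (by exact i1.add i2) (integrable_wsq _ he), integral_add i1 i2,
    integral_const_mul, integral_wsq_vec]
  simp only [fun z => bil_comm (M.Del ω k) (M.deviation η γ G ω k z)]
  rw [integral_bil_eq_zero (isCentered_law M η) _ hp hd (M.measurable_deviation η γ G ω k),
    mul_zero, add_zero, cross_lin_left, cross_lin_right,
    (hG.isProj k).cross_residual (M.form_psd η), M.cross_state_state]
  congr 1
  rw [Matrix.trace_mul_comm, Matrix.mul_assoc, Matrix.mul_assoc, Matrix.trace_mul_comm]
  simp only [Matrix.mul_assoc]
  rw [Matrix.trace_mul_comm]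
  simp only [Matrix.mul_assoc]

theorem sum_fin_sub (a : Fin (κ + 1) → ℝ) :
    ∑ k : Fin κ, (a k.succ - a k.castSucc) = a (Fin.last κ) - a 0 := by
  rw [Finset.sum_sub_distrib]
  have h1 := Fin.sum_univ_succ a
  have h2 := Fin.sum_univ_castSucc a
  linarith

variable (η G) in
/-- The cost of the certainty equivalent controller. -/
def Model.baseCost (ω : Option Ω) : ℝ :=
  M.delta₀ ω + ∑ k, ((M.K ω k)ᵀ * M.Del ω k * M.K ω k *
    (M.stateMoment k k - M.postCov η G k)).trace

/-- The sum of the stage costs along a trajectory. -/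
theorem Model.sum_stage_cost (ω : Option Ω) (z : Prim m n κ) (u : Fin κ → Vec r) :
    ∑ k : Fin κ, (wsq (M.Q ω) (M.state z u k.succ) + wsq (M.R ω) (u k)) =
      wsq (M.Qt ω 0 - M.Q ω) z.1 + ∑ k : Fin κ,
        (wsq (M.Del ω k) (u k + act (M.K ω k) (M.state z u k.castSucc)) +
          2 * bil (M.Qt ω (k.val + 1)) (z.2.1 k)
            (act M.A (M.state z u k.castSucc) + act M.B (u k)) +
          wsq (M.Qt ω (k.val + 1)) (z.2.1 k)) := by
  -- The terms weighted by `Qt - Q` telescope over the stages, with no contribution at the end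
  -- because `Qt` equals `Q` at `κ`.
  have h := sum_fin_sub fun j => wsq (M.Qt ω j.val - M.Q ω) (M.state z u j)
  have h0 : wsq (M.Qt ω (Fin.last κ).val - M.Q ω) (M.state z u (Fin.last κ)) = 0 := by
    rw [Fin.val_last, M.Qt_last, sub_self]
    simp [wsq]
  rw [h0, M.state_zero, zero_sub] at h
  rw [← sub_eq_iff_eq_add', sub_eq_add_neg]
  simp only [Fin.val_zero] at h
  rw [← h, ← Finset.sum_add_distrib]
  refine Finset.sum_congr rfl fun k _ => ?_
  have h1 := M.complete_square ω k (M.state z u k.castSucc) (z.2.1 k) (u k)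
  rw [← M.state_succ] at h1
  have h2 : wsq (M.Qt ω (k.val + 1) - M.Q ω) (M.state z u k.succ) =
      wsq (M.Qt ω (k.val + 1)) (M.state z u k.succ) - wsq (M.Q ω) (M.state z u k.succ) :=
    bil_mat_sub _ _ _ _
  simp only [Fin.val_succ, Fin.val_castSucc]
  rw [h2]
  linarith

theorem Model.integral_bil_noise (hu : ∀ k, MemLp (fun z => M.control η γ z k) 2 (M.law η))
    (ω : Option Ω) (k : Fin κ) :
    ∫ z, bil (M.Qt ω (k.val + 1)) (vec (procF k) z)
      (act M.A (M.state z.1 (M.control η γ z) k.castSucc) +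
        act M.B (M.control η γ z k)) ∂M.law η = 0 := by
  have h1 := memLp_act M.A (M.memLp_drift hu k.castSucc)
  have h2 := (measurable_act M.A).comp (M.measurable_drift η γ k k.castSucc (by simp))
  have h3 := (measurable_act M.B).comp (M.measurable_control_info η γ (le_refl k))
  rw [← M.integral_bil_proc k (M.Qt ω (k.val + 1)) M.A (h1.add (memLp_act M.B (hu k)))
    (h2.add h3)]
  congr 1
  funext z
  rw [M.state_eq_vec_add, act_add, add_assoc]
  rfl

theorem Model.integral_stage_cost (hG : M.IsPosteriorMap η G)
    (hu : ∀ k, MemLp (fun z => M.control η γ z k) 2 (M.law η)) (ω : Option Ω) (k : Fin κ) :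
    Integrable (fun z => wsq (M.Del ω k) (M.control η γ z k +
            act (M.K ω k) (M.state z.1 (M.control η γ z) k.castSucc)) +
          2 * bil (M.Qt ω (k.val + 1)) (vec (procF k) z)
            (act M.A (M.state z.1 (M.control η γ z) k.castSucc) + act M.B (M.control η γ z k)) +
          wsq (M.Qt ω (k.val + 1)) (vec (procF k) z)) (M.law η) ∧
    ∫ z, (wsq (M.Del ω k) (M.control η γ z k +
            act (M.K ω k) (M.state z.1 (M.control η γ z) k.castSucc)) +
          2 * bil (M.Qt ω (k.val + 1)) (vec (procF k) z)
            (act M.A (M.state z.1 (M.control η γ z) k.castSucc) + act M.B (M.control η γ z k)) +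
          wsq (M.Qt ω (k.val + 1)) (vec (procF k) z)) ∂M.law η =
      ∫ z, wsq (M.Del ω k) (M.deviation η γ G ω k z) ∂M.law η +
        ((M.K ω k)ᵀ * M.Del ω k * M.K ω k * (M.stateMoment k k - M.postCov η G k)).trace +
        (M.Qt ω (k.val + 1) * M.covw).trace := by
  have hx := M.memLp_state hu k.castSucc
  have hw : MemLp (vec (procF k : Fin m → StrongDual ℝ (World m n ι))) 2 (M.law η) := memLp_vec _
  have i1 := integrable_wsq (M.Del ω k) ((hu k).add (memLp_act (M.K ω k) hx))
  have i2 := (integrable_bil (M.Qt ω (k.val + 1)) hw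
    ((memLp_act M.A hx).add (memLp_act M.B (hu k)))).const_mul 2
  have i3 := integrable_wsq (M.Qt ω (k.val + 1)) hw
  simp only [Pi.add_apply] at i1 i2
  refine ⟨(i1.add i2).add i3, ?_⟩
  rw [integral_add (by exact i1.add i2) i3, integral_add i1 i2, integral_const_mul,
    M.integral_bil_noise hu, mul_zero, add_zero, M.integral_wsq_control_add hG hu,
    integral_wsq_vec, M.cross_proc_proc, if_pos rfl]

theorem Model.sum_integral_cost (hG : M.IsPosteriorMap η G)
    (hu : ∀ k, MemLp (fun z => M.control η γ z k) 2 (M.law η)) (ω : Option Ω) :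
    ∑ k : Fin κ, (∫ z, wsq (M.Q ω) (M.state z.1 (M.control η γ z) k.succ) ∂M.law η +
        ∫ z, wsq (M.R ω) (M.control η γ z k) ∂M.law η) =
      M.baseCost η G ω +
        ∑ k, ∫ z, wsq (M.Del ω k) (M.deviation η γ G ω k z) ∂M.law η := by
  have j1 : ∀ k : Fin κ, Integrable (fun z => wsq (M.Q ω)
      (M.state z.1 (M.control η γ z) k.succ)) (M.law η) :=
    fun k => integrable_wsq _ (M.memLp_state hu k.succ)
  have j2 : ∀ k : Fin κ, Integrable (fun z => wsq (M.R ω) (M.control η γ z k)) (M.law η) :=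
    fun k => integrable_wsq _ (hu k)
  have hi : MemLp (vec (initF : Fin m → StrongDual ℝ (World m n ι))) 2 (M.law η) := memLp_vec _
  have e2 : ∑ k : Fin κ, (∫ z, wsq (M.Q ω) (M.state z.1 (M.control η γ z) k.succ) ∂M.law η +
        ∫ z, wsq (M.R ω) (M.control η γ z k) ∂M.law η) =
      ∫ z, ∑ k : Fin κ, (wsq (M.Q ω) (M.state z.1 (M.control η γ z) k.succ) +
        wsq (M.R ω) (M.control η γ z k)) ∂M.law η := by
    rw [integral_finsetSum _ fun k _ => by exact (j1 k).add (j2 k)]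
    exact Finset.sum_congr rfl fun k _ => (integral_add (j1 k) (j2 k)).symm
  have e3 := fun z : World m n ι => M.sum_stage_cost ω z.1 (M.control η γ z)
  have hv : ∀ (z : World m n ι) (k : Fin κ), z.1.2.1 k = vec (procF k) z := fun _ _ => rfl
  simp only [e2, e3, hv]
  have i0 : Integrable (fun z : World m n ι => wsq (M.Qt ω 0 - M.Q ω) z.1.1) (M.law η) :=
    integrable_wsq _ hi
  have e0 : ∫ z : World m n ι, wsq (M.Qt ω 0 - M.Q ω) z.1.1 ∂M.law η =
      ((M.Qt ω 0 - M.Q ω) * M.cov₁).trace := by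
    rw [← M.cross_init_init η]
    exact integral_wsq_vec (μ := M.law η) _ (initF : Fin m → StrongDual ℝ (World m n ι))
  have i4 := fun k => (M.integral_stage_cost hG hu ω k).1
  have e4 := fun k => (M.integral_stage_cost hG hu ω k).2
  rw [integral_add i0 (integrable_finsetSum _ fun k _ => i4 k),
    integral_finsetSum _ fun k _ => i4 k, e0, Finset.sum_congr rfl fun k _ => e4 k]
  simp only [Finset.sum_add_distrib, Model.baseCost, Model.delta₀]
  ring

theorem Model.followerCost_eq (hG : M.IsPosteriorMap η G)
    (hu : ∀ k, MemLp (fun z => M.control η γ z k) 2 (M.law η)) (ω : Option Ω) :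
    M.followerCost η ω γ = ENNReal.ofReal (M.baseCost η G ω +
      ∑ k, ∫ z, wsq (M.Del ω k) (M.deviation η γ G ω k z) ∂M.law η) := by
  have hx := M.memLp_state hu
  have n1 : ∀ k : Fin κ,
      0 ≤ ∫ z, wsq (M.Q ω) (M.state z.1 (M.control η γ z) k.succ) ∂M.law η :=
    fun k => integral_nonneg fun z => wsq_nonneg (M.Q_psd ω) _
  have n2 : ∀ k : Fin κ, 0 ≤ ∫ z, wsq (M.R ω) (M.control η γ z k) ∂M.law η :=
    fun k => integral_nonneg fun z => wsq_nonneg (M.R_pd ω).posSemidef _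
  rw [← M.sum_integral_cost hG hu, Model.followerCost, Model.stateCost, Model.inputCost,
    ← Finset.sum_add_distrib,
    ENNReal.ofReal_sum_of_nonneg fun k _ => add_nonneg (n1 k) (n2 k)]
  refine Finset.sum_congr rfl fun k _ => ?_
  rw [lintegral_wsq (M.Q_psd ω) (hx k.succ), lintegral_wsq (M.R_pd ω).posSemidef (hu k),
    ENNReal.ofReal_add (n1 k) (n2 k)]

/-- As `R ≻ 0`, finite cost forces square integrable inputs. Every other policy has cost `⊤` and is
harmless in comparisons. -/
theorem Model.memLp_control {ω : Option Ω} (h : M.followerCost η ω γ ≠ ⊤) (k : Fin κ) :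
    MemLp (fun z => M.control η γ z k) 2 (M.law η) := by
  refine memLp_of_lintegral_wsq (M.R_pd ω) (M.measurable_control η γ k) ?_
  have h1 : M.inputCost η γ (M.R ω) ≠ ⊤ := fun h2 => h (by simp [Model.followerCost, h2])
  exact (ENNReal.sum_ne_top.1 h1) k (Finset.mem_univ k)

end Energy

/-! ### Certainty equivalence and uniqueness of best responses. -/

section BestResponse

variable {m r n κ : ℕ} {Ω : Type*} (M : Model m r n κ Ω) {ι : Fin κ → Type} [∀ k, Fintype (ι k)]
  (η : Rule n ι) (G : ∀ k : Fin κ, ∀ j : {j : Fin κ // j ≤ k}, Matrix (Fin m) (ι j) ℝ)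
  (ω : Option Ω)

/-- The certainty equivalent control inputs of the first `t` stages as a function of the received
signals (zero from stage `t` on). -/
def Model.ceInputs (s : ∀ j, EuclideanSpace ℝ (ι j)) : ℕ → Fin κ → Vec r
  | 0 => 0
  | t + 1 => fun k =>
      if k.val = t then
        -- Subtracting the response to the earlier inputs recovers the control-free signals, to
        -- which the posterior map `G` applies; the known shift of the state is then added back.
        -act (M.K ω k) (∑ j : {j : Fin κ // j ≤ k},
          act (G k j) (s j - M.signal η 0 (Model.ceInputs s t) j) +
            M.state 0 (Model.ceInputs s t) k.castSucc)
      else Model.ceInputs s t k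

theorem Model.ceInputs_stable (s : ∀ j, EuclideanSpace ℝ (ι j)) (k : Fin κ) (t : ℕ)
    (ht : k.val < t) : M.ceInputs η G ω s t k = M.ceInputs η G ω s (k.val + 1) k := by
  induction t with
  | zero => omega
  | succ t ih =>
    rcases Nat.lt_succ_iff_lt_or_eq.1 ht with h | h
    · rw [← ih h]
      simp [Model.ceInputs, h.ne]
    · rw [h]

theorem Model.ceInputs_congr {s s' : ∀ j, EuclideanSpace ℝ (ι j)} {k : Fin κ}
    (h : ∀ j, j ≤ k → s j = s' j) (t : ℕ) (l : Fin κ) (hl : l ≤ k) :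
    M.ceInputs η G ω s t l = M.ceInputs η G ω s' t l := by
  induction t generalizing l with
  | zero => rfl
  | succ t ih =>
    simp only [Model.ceInputs]
    rw [ih l hl]
    split_ifs
    · have h1 : ∀ j : {j : Fin κ // j ≤ l}, M.signal η 0 (M.ceInputs η G ω s t) j =
          M.signal η 0 (M.ceInputs η G ω s' t) j := fun j =>
        M.signal_congr η 0 j.1 fun i hi => ih i (hi.le.trans (j.2.trans hl))
      have h2 : M.state 0 (M.ceInputs η G ω s t) l.castSucc =
          M.state 0 (M.ceInputs η G ω s' t) l.castSucc :=
        M.state_congr 0 _ fun i hi => ih i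
          ((Fin.le_def.2 (by simpa using hi.le) : i ≤ l).trans hl)
      simp only [h1, h2]
      congr 4
      funext j
      rw [h j.1 (j.2.trans hl)]
    · rfl

theorem Model.measurable_ceInputs (t : ℕ) (k : Fin κ) :
    Measurable fun s => M.ceInputs η G ω s t k := by
  induction t generalizing k with
  | zero => exact measurable_const
  | succ t ih =>
    simp only [Model.ceInputs]
    split_ifs
    · refine Measurable.neg ((measurable_act _).comp (Measurable.add ?_ ?_))
      · exact Finset.measurable_sum _ fun j _ => (measurable_act _).comp
          ((measurable_pi_apply _).sub (M.measurable_signal η measurable_const _ fun l _ => ih l))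
      · exact M.measurable_state measurable_const _ fun l _ => ih l
    · exact ih k

open Classical in
/-- A signal history, extended by zero. -/
def extendHist {k : Fin κ} (s : SigHist ι k) (j : Fin κ) : EuclideanSpace ℝ (ι j) :=
  if h : j ≤ k then s ⟨j, h⟩ else 0

omit [∀ k, Fintype (ι k)] in
theorem measurable_extendHist (k : Fin κ) :
    Measurable (extendHist : SigHist ι k → ∀ j, EuclideanSpace ℝ (ι j)) := by
  refine measurable_pi_lambda _ fun j => ?_
  unfold extendHist
  split_ifs with h
  · exact measurable_pi_apply _
  · exact measurable_const

/-- The certainty equivalent controller. -/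
def Model.cePolicy : Policy r ι where
  act k s := M.ceInputs η G ω (extendHist s) (k.val + 1) k
  meas k := (M.measurable_ceInputs η G ω (k.val + 1) k).comp (measurable_extendHist k)

theorem Model.control_cePolicy (z : World m n ι) (k : Fin κ) :
    M.control η (M.cePolicy η G ω) z k =
      M.ceInputs η G ω (M.signal η z (M.control η (M.cePolicy η G ω) z)) (k.val + 1) k := by
  rw [M.control_eq]
  refine M.ceInputs_congr η G ω (k := k) (fun j hj => ?_) _ k le_rfl
  rw [extendHist, dif_pos hj]

theorem Model.deviation_cePolicy (k : Fin κ) (z : World m n ι) :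
    M.deviation η (M.cePolicy η G ω) G ω k z = 0 := by
  set u := M.control η (M.cePolicy η G ω) z with hu
  set s := M.signal η z u with hs
  have h1 : ∀ l, l < k → M.ceInputs η G ω s k.val l = u l := fun l hl => by
    rw [hu, M.control_cePolicy η G ω z l]
    exact M.ceInputs_stable η G ω s l _ (Fin.lt_def.1 hl)
  have h2 : M.state 0 (M.ceInputs η G ω s k.val) k.castSucc = M.state 0 u k.castSucc :=
    M.state_congr 0 _ fun l hl => h1 l (Fin.lt_def.2 (by simpa using hl))
  have h3 : ∀ j : {j : Fin κ // j ≤ k},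
      s j - M.signal η 0 (M.ceInputs η G ω s k.val) j = M.signal η z 0 j := fun j => by
    rw [M.signal_congr η 0 j.1 fun l hl => h1 l (lt_of_lt_of_le hl j.2), hs,
      M.signal_eq_add η z u, add_sub_cancel_right]
  rw [Model.deviation, M.control_cePolicy, ← hu, ← hs]
  simp only [Model.ceInputs, if_true, h2, h3]
  rw [M.vec_compF, neg_add_cancel]

/-- Each input is linear in a Gaussian posterior and in the shift caused by earlier inputs, so
square integrability propagates along the stages. -/
theorem Model.memLp_control_cePolicy (k : Fin κ) :
    MemLp (fun z => M.control η (M.cePolicy η G ω) z k) 2 (M.law η) := by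
  set γ := M.cePolicy η G ω with hγ
  have h1 : ∀ (k : Fin κ) z, M.control η γ z k =
      -act (M.K ω k) (vec (M.compF η G k) z + M.state 0 (M.control η γ z) k.castSucc) :=
    fun k z => eq_neg_of_add_eq_zero_left (M.deviation_cePolicy η G ω k z)
  have step : ∀ k : Fin κ,
      MemLp (fun z => M.state 0 (M.control η γ z) k.castSucc) 2 (M.law η) →
        MemLp (fun z => M.control η γ z k) 2 (M.law η) := by
    intro k hk
    have h2 : MemLp (vec (M.compF η G k)) 2 (M.law η) := memLp_vec _
    simp only [h1 k]
    exact (memLp_act (M.K ω k) (h2.add hk)).neg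
  have key : ∀ j : Fin (κ + 1),
      MemLp (fun z => M.state 0 (M.control η γ z) j) 2 (M.law η) := by
    intro j
    induction j using Fin.induction with
    | zero => exact memLp_const _
    | succ k ih =>
      simp only [M.state_succ, Prod.snd_zero, Prod.fst_zero, Pi.zero_apply, add_zero]
      exact (memLp_act M.A ih).add (memLp_act M.B (step k ih))
  exact step k (key _)

variable {η G}

theorem Model.sum_integral_deviation_nonneg (γ : Policy r ι) :
    0 ≤ ∑ k, ∫ z, wsq (M.Del ω k) (M.deviation η γ G ω k z) ∂M.law η :=
  Finset.sum_nonneg fun k _ => integral_nonneg fun _ => wsq_nonneg (M.Del_posDef ω k).posSemidef _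

theorem Model.sum_integral_deviation_eq_zero {γ : Policy r ι}
    (h : ∀ k, M.deviation η γ G ω k =ᵐ[M.law η] 0) :
    ∑ k, ∫ z, wsq (M.Del ω k) (M.deviation η γ G ω k z) ∂M.law η = 0 := by
  refine Finset.sum_eq_zero fun k _ => integral_eq_zero_of_ae ?_
  filter_upwards [h k] with z hz
  simp [hz, wsq]

theorem Model.deviation_cePolicy_ae (k : Fin κ) :
    M.deviation η (M.cePolicy η G ω) G ω k =ᵐ[M.law η] 0 :=
  Filter.Eventually.of_forall (M.deviation_cePolicy η G ω k)

theorem Model.followerCost_cePolicy (hG : M.IsPosteriorMap η G) :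
    M.followerCost η ω (M.cePolicy η G ω) = ENNReal.ofReal (M.baseCost η G ω) := by
  rw [M.followerCost_eq hG (M.memLp_control_cePolicy η G ω) ω,
    M.sum_integral_deviation_eq_zero ω (M.deviation_cePolicy_ae ω), add_zero]

theorem Model.baseCost_nonneg (hG : M.IsPosteriorMap η G) : 0 ≤ M.baseCost η G ω := by
  have h1 := M.sum_integral_cost hG (M.memLp_control_cePolicy η G ω) ω
  rw [M.sum_integral_deviation_eq_zero ω (M.deviation_cePolicy_ae ω), add_zero] at h1
  rw [← h1]
  exact Finset.sum_nonneg fun k _ => add_nonneg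
    (integral_nonneg fun z => wsq_nonneg (M.Q_psd ω) _)
    (integral_nonneg fun z => wsq_nonneg (M.R_pd ω).posSemidef _)

/-- Policies of finite cost pay the same constant plus nonnegative penalties, and the certainty
equivalent controller pays no penalty. -/
theorem Model.isBestResponse_cePolicy (hG : M.IsPosteriorMap η G) :
    M.IsBestResponse η ω (M.cePolicy η G ω) := by
  intro γ'
  by_cases h : M.followerCost η ω γ' = ⊤
  · rw [h]
    exact le_top
  · rw [M.followerCost_cePolicy ω hG, M.followerCost_eq hG (M.memLp_control h) ω]
    exact ENNReal.ofReal_le_ofReal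
      (le_add_of_nonneg_right (M.sum_integral_deviation_nonneg ω γ'))

variable {ω}

theorem Model.IsBestResponse.followerCost_eq {M : Model m r n κ Ω} {γ : Policy r ι}
    (h : M.IsBestResponse η ω γ) (hG : M.IsPosteriorMap η G) :
    M.followerCost η ω γ = ENNReal.ofReal (M.baseCost η G ω) := by
  rw [← M.followerCost_cePolicy ω hG]
  exact le_antisymm (h _) (M.isBestResponse_cePolicy ω hG γ)

theorem Model.IsBestResponse.memLp_control {M : Model m r n κ Ω} {γ : Policy r ι}
    (h : M.IsBestResponse η ω γ) (hG : M.IsPosteriorMap η G) (k : Fin κ) :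
    MemLp (fun z => M.control η γ z k) 2 (M.law η) :=
  M.memLp_control (ω := ω) (by rw [h.followerCost_eq hG]; exact ENNReal.ofReal_ne_top) k

/-- Best responses are certainty equivalent almost surely. -/
theorem Model.IsBestResponse.deviation_eq_zero {M : Model m r n κ Ω} {γ : Policy r ι}
    (h : M.IsBestResponse η ω γ) (hG : M.IsPosteriorMap η G) (k : Fin κ) :
    M.deviation η γ G ω k =ᵐ[M.law η] 0 := by
  have hu := h.memLp_control hG
  have h1 := M.followerCost_eq hG hu ω
  rw [h.followerCost_eq hG] at h1
  have h0 := M.baseCost_nonneg ω hG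
  have h2 := M.sum_integral_deviation_nonneg (η := η) (G := G) ω γ
  -- Both values are nonnegative, so the truncation in `ENNReal.ofReal` loses nothing. The total
  -- penalty is then zero, and so is each stage penalty.
  have h3 := (ENNReal.ofReal_eq_ofReal_iff h0 (add_nonneg h0 h2)).1 h1
  have h4 := (Finset.sum_eq_zero_iff_of_nonneg fun k _ => integral_nonneg fun _ =>
    wsq_nonneg (M.Del_posDef ω k).posSemidef _).1 (left_eq_add.1 h3) k (Finset.mem_univ k)
  have h5 := (integral_eq_zero_iff_of_nonneg
    (fun z => wsq_nonneg (M.Del_posDef ω k).posSemidef _)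
    (integrable_wsq _ (M.memLp_deviation hu ω k))).1 h4
  filter_upwards [h5] with z hz
  exact eq_zero_of_wsq_eq_zero (M.Del_posDef ω k) hz

end BestResponse

/-! ### Block matrices and stacked vectors over the horizon. -/

section Blocks

variable {κ a b c : ℕ}

theorem blk_mul (f : Fin κ → Fin κ → Matrix (Fin a) (Fin b) ℝ)
    (g : Fin κ → Fin κ → Matrix (Fin b) (Fin c) ℝ) :
    blk f * blk g = blk fun k l => ∑ j, f k j * g j l := by
  ext p q
  simp only [blk, Matrix.mul_apply, Matrix.of_apply, Fintype.sum_prod_type, Matrix.sum_apply]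

theorem blk_transpose (f : Fin κ → Fin κ → Matrix (Fin a) (Fin b) ℝ) :
    (blk f)ᵀ = blk fun k l => (f l k)ᵀ := rfl

theorem trace_blk (f : Fin κ → Fin κ → Matrix (Fin a) (Fin a) ℝ) :
    (blk f).trace = ∑ k, (f k k).trace := by
  simp [Matrix.trace, blk, Fintype.sum_prod_type]

/-- The block diagonal matrix over the horizon. -/
abbrev blkDiag (f : Fin κ → Matrix (Fin a) (Fin b) ℝ) :
    Matrix (Fin κ × Fin a) (Fin κ × Fin b) ℝ := blk fun k l => if l = k then f k else 0

theorem blkDiag_mul (f : Fin κ → Matrix (Fin a) (Fin b) ℝ)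
    (g : Fin κ → Matrix (Fin b) (Fin c) ℝ) :
    blkDiag f * blkDiag g = blkDiag fun k => f k * g k := by
  rw [blk_mul]
  congr 1
  funext k l
  rw [Finset.sum_eq_single k]
  · by_cases h : l = k <;> simp [h]
  · intro j _ hj
    simp [hj]
  · simp

theorem blkDiag_transpose (f : Fin κ → Matrix (Fin a) (Fin b) ℝ) :
    (blkDiag f)ᵀ = blkDiag fun k => (f k)ᵀ := by
  rw [blk_transpose]
  congr 1
  funext k l
  by_cases h : l = k
  · subst h
    simp
  · simp [h, Ne.symm h]

theorem trace_blk_mul_blkDiag (f : Fin κ → Fin κ → Matrix (Fin a) (Fin b) ℝ)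
    (g : Fin κ → Matrix (Fin b) (Fin a) ℝ) :
    (blk f * blkDiag g).trace = ∑ k, (f k k * g k).trace := by
  rw [blk_mul, trace_blk]
  refine Finset.sum_congr rfl fun k _ => ?_
  congr 1
  rw [Finset.sum_eq_single k]
  · simp
  · intro j _ hj
    simp [Ne.symm hj]
  · simp

/-- The vector with the given blocks. -/
def stack (x : Fin κ → Vec a) : EuclideanSpace ℝ (Fin κ × Fin a) :=
  WithLp.toLp 2 fun p => x p.1 p.2

theorem act_blk_stack (f : Fin κ → Fin κ → Matrix (Fin a) (Fin b) ℝ) (x : Fin κ → Vec b) :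
    act (blk f) (stack x) = stack fun k => ∑ l, act (f k l) (x l) := by
  ext p
  simp [stack, blk, Fintype.sum_prod_type]

theorem act_blkDiag_stack (f : Fin κ → Matrix (Fin a) (Fin b) ℝ) (x : Fin κ → Vec b) :
    act (blkDiag f) (stack x) = stack fun k => act (f k) (x k) := by
  rw [act_blk_stack]
  congr 1
  funext k
  rw [Finset.sum_eq_single k]
  · simp
  · intro j _ hj
    ext i
    simp [hj]
  · simp

theorem bil_blkDiag_stack (f : Fin κ → Matrix (Fin a) (Fin b) ℝ) (x : Fin κ → Vec a)
    (y : Fin κ → Vec b) :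
    bil (blkDiag f) (stack x) (stack y) = ∑ k, bil (f k) (x k) (y k) := by
  have h : ∀ (N : Matrix (Fin κ × Fin a) (Fin κ × Fin b) ℝ), bil N (stack x) (stack y) =
      stack x ⬝ᵥ act N (stack y) := fun _ => rfl
  rw [h, act_blkDiag_stack]
  simp only [dotProduct, Fintype.sum_prod_type, bil]
  rfl

end Blocks

/-! ### The response to certainty equivalent inputs in block form. -/

section ControlFree

variable {m r n κ : ℕ} {Ω : Type*} (M : Model m r n κ Ω)

/-- For the controller `V` is block diagonal, so no cross terms occur in `Ξ`. -/
theorem Model.Xi_none (k : Fin κ) :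
    M.Xi none k = -((M.K none k)ᵀ * M.Del none k * M.K none k) := by
  have h : M.V none = -blkDiag fun k => (M.K none k)ᵀ * M.Del none k * M.K none k := by
    rw [Model.V, Model.KK, Model.DD, blkDiag_transpose, blkDiag_mul, blkDiag_mul]
  have h1 : ∀ k l, M.Vblock none k l =
      if l = k then -((M.K none k)ᵀ * M.Del none k * M.K none k) else 0 := by
    intro k l
    ext i j
    rw [Model.Vblock, h]
    by_cases hkl : l = k
    · simp [blk, hkl]
    · simp [blk, hkl]
  have h2 : ∀ l ∈ Finset.Ioi k, (M.Vblock none k l * M.A ^ (l.val - k.val) +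
      (M.A ^ (l.val - k.val))ᵀ * M.Vblock none l k) = 0 := by
    intro l hl
    have hlk : k < l := Finset.mem_Ioi.1 hl
    simp [h1, hlk.ne, hlk.ne']
  rw [Model.Xi, Finset.sum_eq_zero h2, add_zero, h1, if_pos rfl]

theorem act_act {α β γ : Type*} [Fintype β] [Fintype γ] (N : Matrix α β ℝ) (P : Matrix β γ ℝ)
    (x : EuclideanSpace ℝ γ) : act N (act P x) = act (N * P) x := by
  simp [act]

theorem act_neg {α β : Type*} [Fintype β] (N : Matrix α β ℝ) (x : EuclideanSpace ℝ β) :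
    act N (-x) = -act N x := by
  ext i
  simp

theorem act_sum {α β J : Type*} [Fintype β] (N : Matrix α β ℝ) (s : Finset J)
    (x : J → EuclideanSpace ℝ β) : act N (∑ j ∈ s, x j) = ∑ j ∈ s, act N (x j) := by
  classical
  induction s using Finset.induction with
  | empty => simp [act_zero]
  | insert j s hj ih => rw [Finset.sum_insert hj, Finset.sum_insert hj, act_add, ih]

theorem act_one {α : Type*} [Fintype α] [DecidableEq α] (x : EuclideanSpace ℝ α) :
    act (1 : Matrix α α ℝ) x = x := by
  simp [act]

theorem act_zero_mat {α β : Type*} [Fintype β] (x : EuclideanSpace ℝ β) :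
    act (0 : Matrix α β ℝ) x = 0 := by
  ext i
  simp

/-- The response of the state to the control inputs. -/
theorem Model.state_zero_eq_sum (u : Fin κ → Vec r) (j : Fin (κ + 1)) :
    M.state 0 u j = ∑ l : Fin κ,
      act (if l.val < j.val then M.A ^ (j.val - l.val - 1) * M.B else 0) (u l) := by
  induction j using Fin.induction with
  | zero =>
    simp [act_zero_mat, Model.state_zero]
  | succ k ih =>
    rw [M.state_succ, ih, act_sum]
    simp only [Prod.snd_zero, Prod.fst_zero, Pi.zero_apply, add_zero, act_act]
    have h : ∀ l : Fin κ, act (if l.val < k.succ.val then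
        M.A ^ (k.succ.val - l.val - 1) * M.B else 0) (u l) =
        act (M.A * if l.val < k.castSucc.val then
          M.A ^ (k.castSucc.val - l.val - 1) * M.B else 0) (u l) +
        if l = k then act M.B (u k) else 0 := by
      intro l
      simp only [Fin.val_succ, Fin.val_castSucc]
      rcases lt_trichotomy l.val k.val with h1 | h1 | h1
      · have h2 : l ≠ k := fun h => by simp [h] at h1
        have h3 : k.val + 1 - l.val - 1 = k.val - l.val - 1 + 1 := by omega
        rw [if_pos (by omega), if_pos h1, if_neg h2, h3, pow_succ', add_zero, Matrix.mul_assoc]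
      · obtain rfl := Fin.ext h1
        simp [act_zero_mat]
      · have h2 : l ≠ k := fun h => by simp [h] at h1
        rw [if_neg (by omega), if_neg (by omega), if_neg h2, Matrix.mul_zero, act_zero_mat,
          add_zero]
    simp only [h, Finset.sum_add_distrib, Finset.sum_ite_eq', Finset.mem_univ, if_true]

theorem Model.stack_state_succ (u : Fin κ → Vec r) :
    stack (fun k => M.state 0 u k.succ) = act M.Z (stack u) := by
  rw [Model.Z, act_blk_stack]
  congr 1
  funext k
  rw [M.state_zero_eq_sum]
  refine Finset.sum_congr rfl fun l _ => ?_
  congr 1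
  have h : l.val < k.succ.val ↔ l ≤ k := by
    rw [Fin.val_succ, Nat.lt_succ_iff, Fin.le_def]
  by_cases hl : l ≤ k
  · rw [if_pos hl, if_pos (h.2 hl)]
    congr 2
    simp
    omega
  · rw [if_neg hl, if_neg fun h' => hl (h.1 h')]

theorem Model.act_Phi_stack (ω : Option Ω) (u : Fin κ → Vec r) :
    act (M.Phi ω) (stack u) =
      stack fun k => u k + act (M.K ω k) (M.state 0 u k.castSucc) := by
  rw [Model.Phi, act_blk_stack]
  congr 1
  funext k
  rw [M.state_zero_eq_sum, act_sum]
  simp only [act_act]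
  have h : ∀ l : Fin κ, act (if l = k then 1 else if l < k then
      M.K ω k * M.A ^ (k.val - l.val - 1) * M.B else 0) (u l) =
      (if l = k then u k else 0) + act (M.K ω k * if l.val < k.castSucc.val then
        M.A ^ (k.castSucc.val - l.val - 1) * M.B else 0) (u l) := by
    intro l
    by_cases h1 : l = k
    · subst h1
      simp [act_one, act_zero_mat]
    · by_cases h2 : l < k
      · simp [h1, h2, Matrix.mul_assoc]
      · simp [h1, h2, act_zero_mat]
  simp only [h, Finset.sum_add_distrib, Finset.sum_ite_eq', Finset.mem_univ, if_true]

/-- A kernel vector is an input sequence that cancels the feedback `K` on the trajectory it drives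
from the zero state. By induction over stages it vanishes. -/
theorem Model.isUnit_det_Phi (ω : Option Ω) : IsUnit (M.Phi ω).det := by
  rw [← Matrix.isUnit_iff_isUnit_det, ← Matrix.mulVec_injective_iff_isUnit]
  intro v v' hvv
  rw [← sub_eq_zero]
  have h0 : M.Phi ω *ᵥ (v - v') = 0 := by rw [Matrix.mulVec_sub, sub_eq_zero]; exact hvv
  set u : Fin κ → Vec r := fun k => WithLp.toLp 2 fun i => (v - v') (k, i) with hu
  have h1 : act (M.Phi ω) (stack u) = 0 := by
    ext p
    exact congrFun h0 p
  rw [M.act_Phi_stack] at h1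
  have h2 : ∀ (t : ℕ) (k : Fin κ), k.val < t → u k = 0 := by
    intro t
    induction t with
    | zero => intro k hk; omega
    | succ t ih =>
      intro k hk
      have h3 : M.state 0 u k.castSucc = M.state 0 0 k.castSucc :=
        M.state_congr 0 _ fun l hl => ih l (by simp at hl; omega)
      have h4 : M.state (0 : Prim m n κ) 0 k.castSucc = 0 := by
        rw [M.state_zero_eq_sum]
        simp [act_zero]
      ext i
      have h5 := congrArg (fun x => x (k, i)) h1
      simpa [stack, h3, h4, act_zero] using h5
  funext p
  exact congrArg (fun x => x p.2) (h2 _ p.1 (Nat.lt_succ_self _))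

/-- The response of the state to certainty equivalent control inputs. -/
theorem Model.stack_state_of_certainty_equivalent (ω : Option Ω) {u : Fin κ → Vec r}
    {x : Fin κ → Vec m} (h : ∀ k, u k + act (M.K ω k) (x k + M.state 0 u k.castSucc) = 0) :
    stack (fun k => M.state 0 u k.succ) = -act (M.TT ω) (stack x) := by
  have h1 : act (M.Phi ω) (stack u) = -act (M.KK ω) (stack x) := by
    rw [M.act_Phi_stack, Model.KK, act_blkDiag_stack]
    ext p
    have h2 := congrArg (fun y => y p.2) (h p.1)
    simp only [act_add] at h2
    simp only [stack, PiLp.neg_apply, PiLp.add_apply, PiLp.zero_apply] at h2 ⊢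
    linarith
  have h2 := congrArg (act (M.Phi ω)⁻¹) h1
  rw [act_act, Matrix.nonsing_inv_mul _ (M.isUnit_det_Phi ω), act_one] at h2
  rw [M.stack_state_succ, h2, act_neg, act_act, act_neg, act_act, Model.TT, Matrix.mul_assoc]

end ControlFree

/-! ### The cost of the sensor as a function of the posterior covariances. -/

section LeaderCost

variable {m r n κ : ℕ} {Ω : Type*} (M : Model m r n κ Ω) {ι : Fin κ → Type} [∀ k, Fintype (ι k)]
  {η : Rule n ι} {γ : Policy r ι}
  {G : ∀ k : Fin κ, ∀ j : {j : Fin κ // j ≤ k}, Matrix (Fin m) (ι j) ℝ}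

theorem sum_sum_eq_sum_Ioi (F : Fin κ → Fin κ → ℝ) :
    ∑ k, ∑ l, F k l = ∑ k, (F k k + ∑ l ∈ Finset.Ioi k, (F k l + F l k)) := by
  have h1 : ∀ k l, F k l = (if l = k then F k l else 0) +
      ((if k < l then F k l else 0) + if l < k then F k l else 0) := by
    intro k l
    rcases lt_trichotomy k l with h | h | h
    · simp [h, h.ne', h.not_gt]
    · simp [h]
    · simp [h, h.ne, h.not_gt]
  have h2 : ∑ k, ∑ l, (if l < k then F k l else 0) = ∑ k, ∑ l, if k < l then F l k else 0 :=
    Finset.sum_comm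
  have h3 : ∀ (k : Fin κ) (f : Fin κ → ℝ),
      ∑ l ∈ Finset.Ioi k, f l = ∑ l, if k < l then f l else 0 := by
    intro k f
    rw [← Finset.sum_filter, Finset.filter_lt_eq_Ioi]
  conv_lhs => enter [2, k, 2, l]; rw [h1 k l]
  simp only [h3]
  simp only [Finset.sum_add_distrib, h2, ← h3, Finset.sum_ite_eq', Finset.mem_univ, if_true]

theorem trace_blk_mul_blk {a b : ℕ} (f : Fin κ → Fin κ → Matrix (Fin a) (Fin b) ℝ)
    (g : Fin κ → Fin κ → Matrix (Fin b) (Fin a) ℝ) :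
    (blk f * blk g).trace = ∑ k, ∑ l, (f k l * g l k).trace := by
  rw [blk_mul, trace_blk]
  exact Finset.sum_congr rfl fun k _ => Matrix.trace_sum _ _

-- The difference is a combination of state noises of stages from `k` on, which are uncorrelated
-- with the signals up to `k`.
variable (ι) in
theorem Model.perp_allState_sub (η : Rule n ι) (k : Fin κ) (i : ℕ) (hi : k.val + i < κ + 1) :
    Perp (M.form η) (M.allStateF ι ⟨k.val + i, hi⟩ - lin (M.A ^ i) (M.stateF ι k))
      (sigSpan (M.sigF η) (k.val + 1)) := by
  induction i with
  | zero =>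
    intro a u _
    have h : M.allStateF ι ⟨k.val + 0, hi⟩ = M.stateF ι k := rfl
    rw [h, pow_zero, lin_one, sub_self]
    simp
  | succ i ih =>
    have hi' : k.val + i < κ := by omega
    have h1 := (ih (by omega)).lin M.A
    have h2 : Perp (M.form η) (procF ⟨k.val + i, hi'⟩) (sigSpan (M.sigF η) (k.val + 1)) :=
      (M.perp_proc_sigSpan η ⟨k.val + i, hi'⟩).mono (sigSpan_mono _ (by simp))
    have h3 : M.allStateF ι ⟨k.val + (i + 1), hi⟩ =
        lin M.A (M.allStateF ι ⟨k.val + i, by omega⟩) + procF ⟨k.val + i, hi'⟩ :=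
      M.allStateF_succ ⟨k.val + i, hi'⟩
    rw [h3, pow_succ', lin_mul]
    have h4 := h1.add h2
    rw [lin_sub_right] at h4
    rwa [sub_add_eq_add_sub] at h4

/-- The covariance of the posteriors of the states at two stages. -/
theorem Model.cross_compF (hG : M.IsPosteriorMap η G) {k l : Fin κ} (hkl : k ≤ l) :
    cross (M.form η) (M.compF η G l) (M.compF η G k) =
      M.A ^ (l.val - k.val) * M.postCov η G k := by
  have hkl' : k.val ≤ l.val := Fin.le_def.1 hkl
  have hk := M.compF_mem η G (le_refl k)
  have h1 := M.perp_allState_sub ι η k (l.val - k.val) (by omega)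
  have h2 : (⟨k.val + (l.val - k.val), by omega⟩ : Fin (κ + 1)) = l.castSucc :=
    Fin.ext (by simp; omega)
  rw [h2] at h1
  -- The earlier posterior lies in both signal spans. Against it the later posterior may be replaced
  -- by the later state, then by `A^(l-k)` times the earlier state, then by the same power times the
  -- earlier posterior.
  have h3 := h1.cross_eq_zero hk
  rw [cross_sub_left, sub_eq_zero, cross_lin_left, (hG.isProj k).cross_left hk] at h3
  rw [← h3, ← (hG.isProj l).cross_left (M.compF_mem η G hkl)]
  rfl

variable (η G) in
/-- The posteriors of the states of all stages. -/
def Model.compAll (p : Fin κ × Fin m) : StrongDual ℝ (World m n ι) := M.compF η G p.1 p.2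

/-- Off-diagonal blocks of the posterior covariance are determined by the diagonal ones through
powers of `A`; gathering the two blocks of each pair `k < l` gives `Ξ_k`. -/
theorem Model.trace_V_mul (hG : M.IsPosteriorMap η G) (ω : Option Ω) :
    (M.V ω * cross (M.form η) (M.compAll η G) (M.compAll η G)).trace =
      ∑ k, (M.Xi ω k * M.postCov η G k).trace := by
  have h1 : M.V ω = blk (M.Vblock ω) := rfl
  have h2 : cross (M.form η) (M.compAll η G) (M.compAll η G) =
      blk fun k l => cross (M.form η) (M.compF η G k) (M.compF η G l) := rfl
  rw [h1, h2, trace_blk_mul_blk, sum_sum_eq_sum_Ioi]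
  refine Finset.sum_congr rfl fun k _ => ?_
  rw [Model.Xi, Matrix.add_mul, Matrix.trace_add, Finset.sum_mul, Matrix.trace_sum]
  congr 1
  refine Finset.sum_congr rfl fun l hl => ?_
  have hkl : k ≤ l := (Finset.mem_Ioi.1 hl).le
  have h3 := M.cross_compF hG hkl
  have h4 : cross (M.form η) (M.compF η G k) (M.compF η G l) =
      M.postCov η G k * (M.A ^ (l.val - k.val))ᵀ := by
    rw [← cross_transpose _ (M.form_psd η), h3, Matrix.transpose_mul,
      cross_transpose _ (M.form_psd η)]
  rw [Matrix.add_mul, Matrix.trace_add, h3, h4, Matrix.mul_assoc,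
    ← Matrix.mul_assoc (M.Vblock ω l k),
    Matrix.trace_mul_comm (M.Vblock ω l k * _), Matrix.mul_assoc]

/-- The expected cost of one state, with the known part of the control-free state replaced by its
posterior. -/
theorem Model.integral_wsq_state (hG : M.IsPosteriorMap η G)
    (hu : ∀ k, MemLp (fun z => M.control η γ z k) 2 (M.law η)) {Q : Matrix (Fin m) (Fin m) ℝ}
    (hQ : Qᵀ = Q) (k : Fin κ) :
    Integrable (fun z => 2 * bil (M.Aᵀ * Q) (vec (M.compF η G k) z)
        (M.state 0 (M.control η γ z) k.succ) + wsq Q (M.state 0 (M.control η γ z) k.succ))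
      (M.law η) ∧
    ∫ z, wsq Q (M.state z.1 (M.control η γ z) k.succ) ∂M.law η =
      (M.Aᵀ * Q * M.A * M.stateMoment k k).trace + (Q * M.covw).trace +
        ∫ z, (2 * bil (M.Aᵀ * Q) (vec (M.compF η G k) z)
          (M.state 0 (M.control η γ z) k.succ) +
            wsq Q (M.state 0 (M.control η γ z) k.succ)) ∂M.law η := by
  have hy := M.memLp_drift hu k.succ
  have hym := M.measurable_drift η γ k k.succ (by simp)
  have hx : MemLp (vec (M.stateF ι k)) 2 (M.law η) := memLp_vec _
  have hh : MemLp (vec (M.compF η G k)) 2 (M.law η) := memLp_vec _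
  have he : MemLp (vec (M.stateF ι k - M.compF η G k)) 2 (M.law η) := memLp_vec _
  have hw : MemLp (vec (procF k : Fin m → StrongDual ℝ (World m n ι))) 2 (M.law η) := memLp_vec _
  have i1 := integrable_wsq (M.Aᵀ * Q * M.A) hx
  have i2 := (integrable_bil (M.Aᵀ * Q) he hy).const_mul 2
  have i3 := (integrable_bil Q hw ((memLp_act M.A hx).add hy)).const_mul 2
  have i4 := integrable_wsq Q hw
  have i5 := (integrable_bil (M.Aᵀ * Q) hh hy).const_mul 2
  have i6 := integrable_wsq Q hy
  simp only [Pi.add_apply] at i3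
  refine ⟨i5.add i6, ?_⟩
  -- The state splits into noise, free motion and response to control. Replacing the free state by
  -- its posterior in the product with the response creates an error term orthogonal to functions of
  -- the signals; the noise term vanishes for the same reason.
  have h1 : ∀ z : World m n ι, wsq Q (M.state z.1 (M.control η γ z) k.succ) =
      wsq (M.Aᵀ * Q * M.A) (vec (M.stateF ι k) z) +
      2 * bil (M.Aᵀ * Q) (vec (M.stateF ι k - M.compF η G k) z)
        (M.state 0 (M.control η γ z) k.succ) +
      2 * bil Q (vec (procF k) z) (act M.A (vec (M.stateF ι k) z) +
        M.state 0 (M.control η γ z) k.succ) + wsq Q (vec (procF k) z) +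
      (2 * bil (M.Aᵀ * Q) (vec (M.compF η G k) z)
          (M.state 0 (M.control η γ z) k.succ) +
            wsq Q (M.state 0 (M.control η γ z) k.succ)) := by
    intro z
    set y := M.state 0 (M.control η γ z) k.succ with hy
    have e1 : M.state z.1 (M.control η γ z) k.succ =
        vec (procF k) z + (act M.A (vec (M.stateF ι k) z) + y) := by
      rw [M.state_eq_vec_add, M.allStateF_succ, vec_add, vec_lin, ← hy]
      change act M.A (vec (M.stateF ι k) z) + _ + _ = _
      abel
    have e2 : bil (M.Aᵀ * Q) (vec (M.stateF ι k) z) y =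
        bil (M.Aᵀ * Q) (vec (M.stateF ι k - M.compF η G k) z) y +
          bil (M.Aᵀ * Q) (vec (M.compF η G k) z) y := by
      rw [← bil_add_left, vec_sub, sub_add_cancel]
    have e3 : wsq Q (act M.A (vec (M.stateF ι k) z)) =
        wsq (M.Aᵀ * Q * M.A) (vec (M.stateF ι k) z) := by
      rw [wsq_eq_bil, bil_act_left, bil_act_right, ← wsq_eq_bil]
    rw [e1, wsq_add Q hQ, wsq_add Q hQ, e3, bil_act_left, e2]
    ring
  simp only [h1]
  rw [integral_add (by exact ((i1.add i2).add i3).add i4) (by exact i5.add i6),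
    integral_add (by exact (i1.add i2).add i3) i4, integral_add (by exact i1.add i2) i3,
    integral_add i1 i2, integral_const_mul, integral_const_mul,
    integral_bil_eq_zero (isCentered_law M η) _ (hG.isProj k).perp hy hym,
    M.integral_bil_proc k Q M.A hy hym, integral_wsq_vec, integral_wsq_vec,
    M.cross_state_state, M.cross_proc_proc, if_pos rfl]
  ring

theorem Model.xi_some (ω : Ω) : M.xi (some ω) =
    ∑ k : Fin κ, ((M.Aᵀ * M.Q none * M.A * M.stateMoment k k).trace +
      (M.Q none * M.covw).trace) := by
  rw [Model.xi, Model.Abar, Model.Qbar, blkDiag_transpose, Matrix.mul_assoc, Matrix.mul_assoc,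
    blkDiag_mul, blkDiag_mul, trace_blk_mul_blkDiag, Finset.sum_add_distrib, Finset.sum_const,
    Finset.card_univ, Fintype.card_fin, nsmul_eq_mul, Matrix.trace_mul_comm M.covw]
  congr 1
  refine Finset.sum_congr rfl fun k _ => ?_
  rw [Matrix.trace_mul_comm]
  simp only [Matrix.mul_assoc]

theorem Model.Qbar_transpose : (M.Qbar)ᵀ = M.Qbar := by
  have h : (M.Q none)ᵀ = M.Q none := (M.Q_psd none).1
  rw [Model.Qbar, blkDiag_transpose, h]

/-- This is the origin of `V`: the response to certainty equivalent inputs is `-T` applied to the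
stacked posteriors. -/
theorem Model.wsq_V (ω : Ω) (x : EuclideanSpace ℝ (Fin κ × Fin m)) :
    2 * bil ((M.Abar)ᵀ * M.Qbar) x (-act (M.TT (some ω)) x) +
      wsq M.Qbar (-act (M.TT (some ω)) x) = wsq (M.V (some ω)) x := by
  have h : M.V (some ω) = (M.TT (some ω))ᵀ * M.Qbar * M.TT (some ω) -
      (M.TT (some ω))ᵀ * M.Qbar * M.Abar - (M.Abar)ᵀ * M.Qbar * M.TT (some ω) := rfl
  rw [h]
  simp only [wsq_eq_bil, bil_mat_sub, bil_neg_left, bil_neg_right, bil_act_left, bil_act_right]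
  rw [bil_comm ((M.TT (some ω))ᵀ * M.Qbar * M.Abar)]
  simp only [Matrix.transpose_mul, Matrix.transpose_transpose, M.Qbar_transpose, Matrix.mul_assoc]
  ring

/-- What an attacker costs to the sensor. -/
theorem Model.stateCost_eq (hG : M.IsPosteriorMap η G)
    (hu : ∀ k, MemLp (fun z => M.control η γ z k) 2 (M.law η)) (ω : Ω)
    (hd : ∀ k, M.deviation η γ G (some ω) k =ᵐ[M.law η] 0) :
    M.stateCost η γ (M.Q none) = ENNReal.ofReal (M.xi (some ω) +
      ∑ k, (M.Xi (some ω) k * M.postCov η G k).trace) := by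
  have hQ : (M.Q none)ᵀ = M.Q none := (M.Q_psd none).1
  rw [Model.stateCost, Finset.sum_congr rfl fun k _ =>
    lintegral_wsq (M.Q_psd none) (M.memLp_state hu k.succ),
    ← ENNReal.ofReal_sum_of_nonneg fun k _ => integral_nonneg fun z => wsq_nonneg (M.Q_psd none) _,
    Finset.sum_congr rfl fun k _ => (M.integral_wsq_state hG hu hQ k).2, Finset.sum_add_distrib,
    ← M.xi_some ω, ← integral_finsetSum _ fun k _ => (M.integral_wsq_state hG hu hQ k).1]
  congr 2
  rw [← M.trace_V_mul hG, ← integral_wsq_vec]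
  refine integral_congr_ae ?_
  filter_upwards [ae_all_iff.2 hd] with z hz
  have h1 : stack (fun k => vec (M.compF η G k) z) = vec (M.compAll η G) z := rfl
  have h2 := M.stack_state_of_certainty_equivalent (some ω) (u := M.control η γ z)
    (x := fun k => vec (M.compF η G k) z) hz
  rw [h1] at h2
  have h3 : (M.Abar)ᵀ * M.Qbar = blkDiag fun _ => M.Aᵀ * M.Q none := by
    rw [Model.Abar, Model.Qbar, blkDiag_transpose, blkDiag_mul]
  rw [← M.wsq_V, ← h2, ← h1, h3, bil_blkDiag_stack, wsq_eq_bil, Model.Qbar, bil_blkDiag_stack,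
    Finset.mul_sum, ← Finset.sum_add_distrib]
  rfl

/-- For the controller `Ξ = -K'ΔK`; the part of the error cost that involves only the state moments
is absorbed into `ξ`. -/
theorem Model.baseCost_none : M.baseCost η G none =
    M.xi none + ∑ k, (M.Xi none k * M.postCov η G k).trace := by
  simp only [Model.baseCost, Model.xi, M.Xi_none, Matrix.mul_sub, Matrix.trace_sub, Matrix.neg_mul,
    Matrix.trace_neg, Finset.sum_sub_distrib, Finset.sum_neg_distrib, Matrix.mul_neg]
  rw [Finset.sum_congr rfl fun k _ => Matrix.trace_mul_comm (M.stateMoment k k) _]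
  ring

theorem Model.IsBestResponse.leaderTypeCost_eq {M : Model m r n κ Ω} {ω : Option Ω}
    (h : M.IsBestResponse η ω γ) (hG : M.IsPosteriorMap η G) :
    M.leaderTypeCost η ω γ = ENNReal.ofReal (M.xi ω +
      ∑ k, (M.Xi ω k * M.postCov η G k).trace) := by
  match ω, h with
  | none, h => exact (h.followerCost_eq hG).trans (by rw [M.baseCost_none])
  | some ω, h => exact M.stateCost_eq hG (h.memLp_control hG) ω (h.deviation_eq_zero hG)

theorem Model.trace_posteriorCov_mul_W (hG : M.IsPosteriorMap η G) (γ : Policy r ι) (ω : Option Ω)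
    (k : Fin κ) : (M.posteriorCov η γ k * M.W ω k).trace =
      (M.Xi ω k * M.postCov η G k).trace := by
  rw [M.trace_mul_W, M.D_mul_posteriorCov η γ k (hG.isProj k)]

end LeaderCost

/-! ### Maxima of linear functions over the simplex. -/

section Simplex

variable {J : Type*} [Fintype J]

/-- A convex combination is at most the largest value, which is attained at a vertex. -/
theorem iSup_stdSimplex_eq {c : J → ℝ} {i : J} (hi : ∀ j, c j ≤ c i) :
    ⨆ p : stdSimplex ℝ J, ∑ j, p.1 j * c j = c i := by
  classical
  have h1 : ∀ p : stdSimplex ℝ J, ∑ j, p.1 j * c j ≤ c i := fun p =>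
    calc ∑ j, p.1 j * c j ≤ ∑ j, p.1 j * c i :=
          Finset.sum_le_sum fun j _ => mul_le_mul_of_nonneg_left (hi j) (p.2.1 j)
      _ = c i := by rw [← Finset.sum_mul, p.2.2, one_mul]
  have : Nonempty (stdSimplex ℝ J) := ⟨⟨_, single_mem_stdSimplex ℝ i⟩⟩
  refine le_antisymm (ciSup_le h1) ?_
  refine le_ciSup_of_le ⟨c i, by rintro _ ⟨p, rfl⟩; exact h1 p⟩
    ⟨_, single_mem_stdSimplex ℝ i⟩ ?_
  simp [Pi.single_apply]

theorem iSup_stdSimplex_ofReal_eq {c : J → ℝ} {i : J} (hi : ∀ j, c j ≤ c i) :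
    ⨆ p : stdSimplex ℝ J, ∑ j, ENNReal.ofReal (p.1 j) * ENNReal.ofReal (c j) =
      ENNReal.ofReal (c i) := by
  classical
  refine le_antisymm (iSup_le fun p => ?_) ?_
  · calc ∑ j, ENNReal.ofReal (p.1 j) * ENNReal.ofReal (c j)
        ≤ ∑ j, ENNReal.ofReal (p.1 j) * ENNReal.ofReal (c i) :=
          Finset.sum_le_sum fun j _ => mul_le_mul_right (ENNReal.ofReal_le_ofReal (hi j)) _
      _ = ENNReal.ofReal (c i) := by
          rw [← Finset.sum_mul, ← ENNReal.ofReal_sum_of_nonneg fun j _ => p.2.1 j, p.2.2,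
            ENNReal.ofReal_one, one_mul]
  · refine le_iSup_of_le ⟨_, single_mem_stdSimplex ℝ i⟩ ?_
    rw [Finset.sum_eq_single i]
    · simp
    · intro j _ hj
      simp [hj]
    · simp

end Simplex

/-! ### Compactness, continuity and the link between game and program. -/

section Existence

variable {m r n κ : ℕ} {Ω : Type*} (M : Model m r n κ Ω)

/-- The objective of the semidefinite program for a known type. -/
def Model.typeObjective (ω : Option Ω) (S : ∀ k : Fin κ, Matrix (Hist n k) (Hist n k) ℝ) : ℝ :=
  M.xi ω + ∑ k, (S k * M.W ω k).trace

theorem Model.exists_sdpObjective_eq [Fintype Ω]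
    (S : ∀ k : Fin κ, Matrix (Hist n k) (Hist n k) ℝ) :
    ∃ ω, (∀ ω', M.typeObjective ω' S ≤ M.typeObjective ω S) ∧
      M.sdpObjective S = M.typeObjective ω S := by
  obtain ⟨ω, hω⟩ := Finite.exists_max fun ω => M.typeObjective ω S
  exact ⟨ω, hω, iSup_stdSimplex_eq hω⟩

/-- The objective is a maximum of finitely many affine functions, one for each type. -/
theorem Model.continuous_sdpObjective [Fintype Ω] : Continuous M.sdpObjective := by
  have h1 : M.sdpObjective = fun S => Finset.univ.sup' Finset.univ_nonempty
      fun ω => M.typeObjective ω S := by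
    funext S
    obtain ⟨ω, h1, h2⟩ := M.exists_sdpObjective_eq S
    rw [h2]
    exact le_antisymm (Finset.le_sup' (fun ω => M.typeObjective ω S) (Finset.mem_univ ω))
      (Finset.sup'_le _ _ fun ω' _ => h1 ω')
  rw [h1]
  refine Continuous.finset_sup'_apply _ fun ω _ => ?_
  unfold Model.typeObjective
  exact continuous_const.add (continuous_finsetSum _ fun k _ =>
    ((continuous_apply k).matrix_mul continuous_const).matrix_trace)

theorem isClosed_posSemidef {α : Type*} [Fintype α] :
    IsClosed {X : Matrix α α ℝ | X.PosSemidef} := by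
  have h : {X : Matrix α α ℝ | X.PosSemidef} = {X | Xᴴ = X} ∩
      ⋂ v : α → ℝ, {X | 0 ≤ star v ⬝ᵥ (X *ᵥ v)} := by
    ext X
    simp only [Matrix.posSemidef_iff_dotProduct_mulVec, Set.mem_ofPred_eq, Set.mem_inter_iff,
      Set.mem_iInter]
    rfl
  rw [h]
  refine (isClosed_eq continuous_id.matrix_conjTranspose continuous_id).inter
    (isClosed_iInter fun v => isClosed_le continuous_const ?_)
  exact continuous_const.dotProduct (continuous_id.matrix_mulVec continuous_const)

/-- Nonnegative principal minors of order two bound entries by diagonal entries, and those of `X`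
are at most those of `Y`. This makes the feasible set bounded. -/
theorem abs_apply_le_trace {α : Type*} [Fintype α] {X Y : Matrix α α ℝ} (hX : X.PosSemidef)
    (hY : (Y - X).PosSemidef) (i j : α) : |X i j| ≤ Y.trace := by
  classical
  have hYp : Y.PosSemidef := by simpa using hY.add hX
  have h1 : ∀ i, X i i ≤ Y.trace := fun i =>
    calc X i i ≤ Y i i := sub_nonneg.1 (hY.diag_nonneg (i := i))
      _ ≤ Y.trace := Finset.single_le_sum (f := fun i => Y i i)
        (fun i _ => hYp.diag_nonneg (i := i)) (Finset.mem_univ i)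
  have h2 := (hX.submatrix ![i, j]).det_nonneg
  rw [Matrix.det_fin_two] at h2
  simp only [Matrix.submatrix_apply, Matrix.cons_val_zero, Matrix.cons_val_one] at h2
  have h3 : X j i = X i j := congrFun (congrFun (hX.1 : Xᵀ = X) i) j
  have h4 : X i i * X j j ≤ Y.trace * Y.trace :=
    mul_le_mul (h1 i) (h1 j) hX.diag_nonneg (hX.diag_nonneg.trans (h1 i))
  refine abs_le_of_sq_le_sq ?_ (hX.diag_nonneg.trans (h1 i))
  rw [h3] at h2
  nlinarith

theorem Model.continuous_prior (k : Fin κ) :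
    Continuous fun S : ∀ k : Fin κ, Matrix (Hist n k) (Hist n k) ℝ => M.prior S k := by
  unfold Model.prior
  split_ifs
  · exact continuous_const
  · exact (continuous_const.matrix_mul (continuous_apply _)).matrix_mul continuous_const

theorem Model.isCompact_feasible : IsCompact M.feasible := by
  have h1 : IsCompact (Set.pi Set.univ fun k : Fin κ => Set.pi Set.univ fun _ : Hist n k =>
      Set.pi Set.univ fun _ : Hist n k =>
        Set.Icc (-(M.measMoment k).trace) (M.measMoment k).trace) :=
    isCompact_univ_pi fun k => isCompact_univ_pi fun _ => isCompact_univ_pi fun _ => isCompact_Icc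
  refine h1.of_isClosed_subset ?_ fun S hS k _ i _ j _ =>
    abs_le.1 (abs_apply_le_trace (hS k).1 (hS k).2.1 i j)
  have h2 : M.feasible = ⋂ k, ({S | (S k).PosSemidef} ∩
      ({S | (M.measMoment k - S k).PosSemidef} ∩ {S | (S k - M.prior S k).PosSemidef})) := by
    ext S
    simp [Model.feasible]
  rw [h2]
  refine isClosed_iInter fun k => ?_
  have h3 : Continuous fun S : ∀ k : Fin κ, Matrix (Hist n k) (Hist n k) ℝ => S k :=
    continuous_apply k
  have h4 : Continuous fun S : ∀ k : Fin κ, Matrix (Hist n k) (Hist n k) ℝ =>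
    M.measMoment k - S k := continuous_const.sub h3
  have h5 : Continuous fun S : ∀ k : Fin κ, Matrix (Hist n k) (Hist n k) ℝ =>
    S k - M.prior S k := h3.sub (M.continuous_prior k)
  exact (isClosed_posSemidef.preimage h3).inter
    ((isClosed_posSemidef.preimage h4).inter (isClosed_posSemidef.preimage h5))

/-- The posterior covariances of any rule are feasible; the rule with zero signals is enough. -/
theorem Model.feasible_nonempty : M.feasible.Nonempty :=
  ⟨_, M.posteriorCov_mem_feasible (ι := fun _ : Fin κ => Fin m) ⟨0, 0, Matrix.PosSemidef.zero⟩
    (Policy.zero r _)⟩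

variable {ι : Fin κ → Type} [∀ k, Fintype (ι k)]

theorem Model.leaderCost_eq [Fintype Ω] (η : Rule n ι) {γ : Option Ω → Policy r ι}
    (h : ∀ ω, M.IsBestResponse η ω (γ ω)) (γ' : Policy r ι) :
    M.leaderCost η γ = ENNReal.ofReal (M.sdpObjective (M.posteriorCov η γ')) := by
  obtain ⟨G, hG⟩ := M.exists_isPosteriorMap η
  obtain ⟨ω, h1, h2⟩ := M.exists_sdpObjective_eq (M.posteriorCov η γ')
  have h3 : ∀ ω, M.leaderTypeCost η ω (γ ω) =
      ENNReal.ofReal (M.typeObjective ω (M.posteriorCov η γ')) := fun ω => by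
    rw [(h ω).leaderTypeCost_eq hG, Model.typeObjective]
    simp only [M.trace_posteriorCov_mul_W hG]
  rw [h2, Model.leaderCost]
  simp only [h3]
  exact iSup_stdSimplex_ofReal_eq h1

/-- The objective dominates the value for the type `none`, which is an actual expected cost. So
passing to `ENNReal` does not truncate it. -/
theorem Model.sdpObjective_posteriorCov_nonneg [Fintype Ω] (η : Rule n ι) (γ : Policy r ι) :
    0 ≤ M.sdpObjective (M.posteriorCov η γ) := by
  obtain ⟨G, hG⟩ := M.exists_isPosteriorMap η
  obtain ⟨ω, h1, h2⟩ := M.exists_sdpObjective_eq (M.posteriorCov η γ)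
  rw [h2]
  refine le_trans ?_ (h1 none)
  have h3 := M.baseCost_nonneg none hG
  rw [M.baseCost_none] at h3
  rw [Model.typeObjective]
  simpa only [M.trace_posteriorCov_mul_W hG] using h3

end Existence

end SensorDesign

end

open SensorDesign in
theorem corollary3 {m r n κ : ℕ} {Ω : Type*} [Fintype Ω] (M : Model m r n κ Ω) :
    -- the sensor's cost under best responses of the follower is the reduced objective
    (∀ η : StateRule m n κ,
      (∀ ω, ∃ γ, M.IsBestResponse η ω γ) ∧
      (∀ γ γ' : Policy r (fun _ : Fin κ => Fin m),
        M.posteriorCov η γ = M.posteriorCov η γ') ∧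
      ∀ γ : Option Ω → Policy r (fun _ : Fin κ => Fin m),
        (∀ ω, M.IsBestResponse η ω (γ ω)) →
          M.leaderCost η γ ≠ ⊤ ∧ (M.leaderCost η γ).toReal = M.sensorObjective η) ∧
    -- the sensor's problem and the semidefinite program attain the same values
    (∀ η : StateRule m n κ, M.posteriorCov η (Policy.zero r _) ∈ M.feasible) ∧
    (∀ S ∈ M.feasible, ∃ η : StateRule m n κ,
      η.IndepNoise ∧ M.sensorObjective η = M.sdpObjective S) ∧
    -- both have a solution, and the minimal values agree
    (∃ v : ℝ, IsLeast (M.sdpObjective '' M.feasible) v ∧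
      IsLeast {c | ∃ η : StateRule m n κ, η.IndepNoise ∧ c = M.sensorObjective η} v ∧
      IsLeast {c | ∃ η : StateRule m n κ, c = M.sensorObjective η} v ∧
      0 ≤ v ∧
      IsLeast {c | ∃ (η : StateRule m n κ) (γ : Option Ω → Policy r (fun _ : Fin κ => Fin m)),
        η.IndepNoise ∧ (∀ ω, M.IsBestResponse η ω (γ ω)) ∧ c = M.leaderCost η γ}
        (ENNReal.ofReal v)) ∧
    -- optimal signaling rules from a solution of the semidefinite program
    (∀ S ∈ M.feasible, (∀ S' ∈ M.feasible, M.sdpObjective S ≤ M.sdpObjective S') →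
      (∃ ηt : HistRule n κ, M.IsConstructed S ηt) ∧
      ∀ ηt : HistRule n κ, M.IsConstructed S ηt →
        (∃ G, M.IsPosteriorMap ηt G) ∧
        ∀ G, M.IsPosteriorMap ηt G →
          M.sensorObjective (ηt.compress G) = M.sdpObjective S ∧
          ∀ η : StateRule m n κ,
            M.sensorObjective (ηt.compress G) ≤ M.sensorObjective η) := by
  have hcost : ∀ (η : StateRule m n κ) (γ : Option Ω → Policy r (fun _ : Fin κ => Fin m)),
      (∀ ω, M.IsBestResponse η ω (γ ω)) →
        M.leaderCost η γ = ENNReal.ofReal (M.sensorObjective η) := fun η γ h =>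
    M.leaderCost_eq (ι := fun _ : Fin κ => Fin m) η h _
  have hnonneg : ∀ η : StateRule m n κ, 0 ≤ M.sensorObjective η := fun η =>
    M.sdpObjective_posteriorCov_nonneg (ι := fun _ : Fin κ => Fin m) η _
  have hbest : ∀ (η : StateRule m n κ) ω, ∃ γ, M.IsBestResponse η ω γ := fun η ω => by
    obtain ⟨G, hG⟩ := M.exists_isPosteriorMap (ι := fun _ : Fin κ => Fin m) η
    exact ⟨_, M.isBestResponse_cePolicy (ι := fun _ : Fin κ => Fin m) ω hG⟩
  have hfeas : ∀ η : StateRule m n κ, M.posteriorCov η (Policy.zero r _) ∈ M.feasible := fun η =>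
    M.posteriorCov_mem_feasible (ι := fun _ : Fin κ => Fin m) η _
  have hrule : ∀ S ∈ M.feasible, ∃ η : StateRule m n κ,
      η.IndepNoise ∧ M.sensorObjective η = M.sdpObjective S := fun S hS => by
    obtain ⟨η, h1, h2⟩ := M.exists_stateRule hS
    exact ⟨η, h1, M.sdpObjective_congr (h2 _)⟩
  refine ⟨fun η => ⟨hbest η, M.posteriorCov_policy (ι := fun _ : Fin κ => Fin m) η,
    fun γ hγ => ?_⟩, hfeas, hrule, ?_, fun S hS hmin =>
      ⟨M.exists_isConstructed hS, fun ηt hη =>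
        ⟨M.exists_isPosteriorMap ηt, fun G hG => ?_⟩⟩⟩
  · rw [hcost η γ hγ]
    exact ⟨ENNReal.ofReal_ne_top, ENNReal.toReal_ofReal (hnonneg η)⟩
  · obtain ⟨S, hS, hmin⟩ := M.isCompact_feasible.exists_isMinOn M.feasible_nonempty
      M.continuous_sdpObjective.continuousOn
    obtain ⟨η, h1, h2⟩ := hrule S hS
    have hlow : ∀ η : StateRule m n κ, M.sdpObjective S ≤ M.sensorObjective η := fun η =>
      hmin (hfeas η)
    -- A minimizer of the program is realized with independent noises, while feasibility of
    -- posterior covariances bounds all rules from below. Hence the minima with and without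
    -- correlated noise coincide.
    refine ⟨M.sdpObjective S, ⟨⟨S, hS, rfl⟩, ?_⟩, ⟨⟨η, h1, h2.symm⟩, ?_⟩, ⟨⟨η, h2.symm⟩, ?_⟩,
      h2 ▸ hnonneg η, ⟨?_, ?_⟩⟩
    · rintro _ ⟨S', hS', rfl⟩
      exact hmin hS'
    · rintro _ ⟨η', -, rfl⟩
      exact hlow η'
    · rintro _ ⟨η', rfl⟩
      exact hlow η'
    · choose γ hγ using hbest η
      exact ⟨η, γ, h1, hγ, by rw [hcost η γ hγ, h2]⟩
    · rintro _ ⟨η', γ, -, hγ, rfl⟩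
      rw [hcost η' γ hγ]
      exact ENNReal.ofReal_le_ofReal (hlow η')
  · have h1 : M.sensorObjective (ηt.compress G) = M.sdpObjective S := by
      refine M.sdpObjective_congr fun k => ?_
      obtain ⟨Yh, hY, hYS⟩ := hη.exists_isProj hS k
      -- The compressed rule need not have posterior covariance `S_k`, but its image under `D_k`
      -- agrees with that of `S_k`, which is all that the objective sees.
      rw [M.D_mul_posteriorCov_compress ηt hG _ k hY, hYS]
    exact ⟨h1, fun η => h1.trans_le (hmin _ (hfeas η))⟩
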